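/- Let $0<r_i<r_e$, $\rho=r_i/r_e$, $\Gamma_i=\{x\in\mathbb R^3:|x|=r_i\}$, $\Gamma_e=\{x\in\mathbb R^3:|x|=r_e\}$, with outward unit normals $\nu_i,\nu_e$, and let $G(x)=-\frac{1}{4\pi|x|}$. For a sphere $\Gamma$ centred at $0$ with surface measure $\sigma$ and outward unit normal $\nu$ put $$\mathcal S_\Gamma[\varphi](x)=\int_\Gamma G(x-y)\varphi(y)\,d\sigma(y),\qquad \mathcal K_\Gamma^*[\varphi](x)=\int_\Gamma\frac{\partial G(x-y)}{\partial\nu(x)}\varphi(y)\,d\sigma(y).$$ For $n\ge 0$ let $Y_n^m$, $m=-n,\dots,n$, denote orthonormal (complex) spherical harmonics of degree $n$, i.e. restrictions to the unit sphere of harmonic homogeneous polynomials of degree $n$ that are orthonormal in $L^2$ of the unit sphere, regarded as functions $x\mapsto Y_n^m(\hat x)$, $\hat x=x/|x|$. (a) If $\Gamma=\{|x|=r_0\}$, $r_0>0$, then $\mathcal K_\Gamma^*[Y_n^m](x)=\frac{1}{2(2n+1)}Y_n^m(\hat x)$ for all $|x|=r_0$, $n\ge0$, $m=-n,\dots,n$.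 (b) The formula $$\mathbb K^*\begin{bmatrix}\varphi_i\\ \varphi_e\end{bmatrix}=\begin{bmatrix}-\mathcal K_{\Gamma_i}^*[\varphi_i]-\frac{\partial}{\partial\nu_i}\mathcal S_{\Gamma_e}[\varphi_e]\\[2pt] \frac{\partial}{\partial\nu_e}\mathcal S_{\Gamma_i}[\varphi_i]+\mathcal K_{\Gamma_e}^*[\varphi_e]\end{bmatrix}$$ defines a bounded linear operator on the complex space $\mathcal H=L^2(\Gamma_i)\times L^2(\Gamma_e)$, and its eigenvalues are exactly the numbers $$\pm\lambda_n,\qquad \lambda_n=\frac{1}{2(2n+1)}\sqrt{1+4n(n+1)\rho^{2n+1}},\qquad n=0,1,\dots.$$ (c) For every $n$, corresponding eigenfunctions for $+\lambda_n$ and $-\lambda_n$ are, respectively, $$\begin{bmatrix}\bigl(\sqrt{1+4n(n+1)\rho^{2n+1}}-1\bigr)Y_n^m\\ 2(n+1)\rho^{n+2}Y_n^m\end{bmatrix},\qquad \begin{bmatrix}\bigl(-\sqrt{1+4n(n+1)\rho^{2n+1}}-1\bigr)Y_n^m\\ 2(n+1)\rho^{n+2}Y_n^m\end{bmatrix},\qquad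 m=-n,\dots,n,$$ and they span the eigenspaces of $+\lambda_n$ and $-\lambda_n$. -/

import Mathlib

open MeasureTheory Module.End

noncomputable section

/-- Euclidean three-space. -/
abbrev E3 : Type := EuclideanSpace ℝ (Fin 3)

/-- Surface measure `σ` of the sphere `{|x| = r}`, as a measure on `ℝ³`: the surface measure of
the unit sphere, transported by `ω ↦ r ω` and multiplied by `r ^ 2`. -/
def surfaceMeasure (r : ℝ) : Measure E3 :=
  ENNReal.ofReal (r ^ 2) •
    ((volume : Measure E3).toSphere.map fun ω : Metric.sphere (0 : E3) 1 => r • (ω : E3))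

/-- The fundamental solution `-1 / (4 π |x|)` of the Laplacian in `ℝ³`. -/
def fundSol (x : E3) : ℝ := -(1 / (4 * Real.pi * ‖x‖))

/-- The unit vector `x̂ = x / |x|`; on a sphere centred at `0` it is the outward unit normal. -/
def unitVec (x : E3) : E3 := ‖x‖⁻¹ • x

/-- The single layer potential of the density `φ` on the sphere `{|x| = r}`. -/
def singleLayer (r : ℝ) (φ : E3 → ℂ) (x : E3) : ℂ :=
  ∫ y, fundSol (x - y) • φ y ∂(surfaceMeasure r)

/-- The normal derivative, along the centred sphere through `x`, of a function `u` on `ℝ³`. -/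
def normalDeriv (u : E3 → ℂ) (x : E3) : ℂ := fderiv ℝ u x (unitVec x)

/-- The Neumann–Poincaré operator `𝒦*` of the sphere `{|x| = r}`: the integral operator whose
kernel is the derivative of `G (x - y)` in the direction of the normal at `x`. -/
def neumannPoincareStar (r : ℝ) (φ : E3 → ℂ) (x : E3) : ℂ :=
  ∫ y, fderiv ℝ fundSol (x - y) (unitVec x) • φ y ∂(surfaceMeasure r)

/-- `ℋ = L²(Γᵢ) × L²(Γₑ)`, complex valued. -/
abbrev DensitySpace (ri re : ℝ) : Type :=
  Lp ℂ 2 (surfaceMeasure ri) × Lp ℂ 2 (surfaceMeasure re)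

/-- `T` is the Neumann–Poincaré-type operator `𝕂*` of the spheres of radii `ri` and `re`, that is,
`T (φᵢ, φₑ) = (-𝒦*ᵢ φᵢ - ∂_{νᵢ} 𝒮ₑ φₑ, ∂_{νₑ} 𝒮ᵢ φᵢ + 𝒦*ₑ φₑ)` for every `(φᵢ, φₑ)` in `ℋ`.
There is at most one such `T`. -/
def IsNPOperator (ri re : ℝ) (T : DensitySpace ri re →L[ℂ] DensitySpace ri re) : Prop :=
  ∀ φ : DensitySpace ri re,
    ((T φ).1 =ᵐ[surfaceMeasure ri] fun x =>
      -neumannPoincareStar ri φ.1 x - normalDeriv (singleLayer re φ.2) x) ∧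
    ((T φ).2 =ᵐ[surfaceMeasure re] fun x =>
      normalDeriv (singleLayer ri φ.1) x + neumannPoincareStar re φ.2 x)

/-- The function `x ↦ p(x̂)` given by a polynomial `p` in three variables. -/
def angular (p : MvPolynomial (Fin 3) ℂ) (x : E3) : ℂ :=
  MvPolynomial.eval (fun i => ((unitVec x i : ℝ) : ℂ)) p

/-- The family `x ↦ angular (Y m) x`, `m = -n, …, n`, is an orthonormal family of spherical
harmonics of degree `n`: the `Y m` are harmonic homogeneous polynomials of degree `n` (so that
`Y m` is the solid harmonic `|x|ⁿ Yₙᵐ(x̂)`), orthonormal in `L²` of the unit sphere. -/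
structure IsOrthonormalSphericalHarmonics (n : ℕ)
    (Y : Set.Icc (-(n : ℤ)) n → MvPolynomial (Fin 3) ℂ) : Prop where
  homogeneous : ∀ m, (Y m).IsHomogeneous n
  harmonic : ∀ m, ∑ i, MvPolynomial.pderiv i (MvPolynomial.pderiv i (Y m)) = 0
  orthonormal : ∀ m m', ∫ x, angular (Y m) x * starRingEnd ℂ (angular (Y m') x)
    ∂(surfaceMeasure 1) = if m = m' then 1 else 0

instance surfaceMeasure_isFinite (r : ℝ) : IsFiniteMeasure (surfaceMeasure r) := by
  unfold surfaceMeasure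
  exact Measure.smul_finite _ ENNReal.ofReal_ne_top

theorem measurable_unitVec : Measurable unitVec := by
  unfold unitVec
  fun_prop

theorem norm_unitVec_le (x : E3) : ‖unitVec x‖ ≤ 1 := by
  unfold unitVec
  rw [norm_smul, norm_inv, norm_norm]
  exact inv_mul_le_one

theorem memLp_angular (r : ℝ) (p : MvPolynomial (Fin 3) ℂ) :
    MemLp (angular p) 2 (surfaceMeasure r) := by
  have hc : Continuous fun x : E3 => MvPolynomial.eval (fun i => ((x i : ℝ) : ℂ)) p :=
    p.continuous_eval.comp (by fun_prop)
  obtain ⟨C, hC⟩ := (isCompact_closedBall (0 : E3) 1).exists_bound_of_continuousOn hc.continuousOn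
  refine MemLp.of_bound (hc.measurable.comp measurable_unitVec).aestronglyMeasurable C
    (Filter.Eventually.of_forall fun x => hC (unitVec x) ?_)
  simpa using norm_unitVec_le x

/-- `x ↦ p(x̂)` as an element of `L²` of the sphere of radius `r`. -/
def angularLp (r : ℝ) (p : MvPolynomial (Fin 3) ℂ) : Lp ℂ 2 (surfaceMeasure r) :=
  (memLp_angular r p).toLp (angular p)

/-- `√(1 + 4 n (n + 1) ρ ^ (2 n + 1))` -/
def npRoot (ρ : ℝ) (n : ℕ) : ℝ := √(1 + 4 * n * (n + 1) * ρ ^ (2 * n + 1))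

/-- `√(1 + 4 n (n + 1) ρ ^ (2 n + 1)) / (2 (2 n + 1))` -/
def npEigenvalue (ρ : ℝ) (n : ℕ) : ℝ := 1 / (2 * (2 * n + 1)) * npRoot ρ n

/-- The pair `((s - 1) Yₙᵐ, 2 (n + 1) ρ ^ (n + 2) Yₙᵐ)`, with `ρ = ri / re`, in `ℋ`. -/
def npPair (ri re : ℝ) (n : ℕ) (s : ℝ) (p : MvPolynomial (Fin 3) ℂ) : DensitySpace ri re :=
  (((s - 1 : ℝ) : ℂ) • angularLp ri p,
    ((2 * (n + 1) * (ri / re) ^ (n + 2) : ℝ) : ℂ) • angularLp re p)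

end

noncomputable section

/-! Every entry of the operator comes from one kernel, `npKernel x y`, the normal derivative at `x`
of the fundamental solution with pole `y`: it gives `𝒦*` on a single sphere and, off the sphere, the
normal derivative of the single layer. From the sphere of radius `r` to that of radius `ρ` it
multiplies each spherical harmonic of degree `n` by a scalar `npFactor r ρ n`
(`integral_npKernel_harmonic`). On degree `n` the operator is thus the matrix with rows `(-a, -b)`
and `(c, a)`, where `a = 1 / (2 (2 n + 1))`, `b = npFactor re ri n`, `c = npFactor ri re n`. Its
trace is zero, so its eigenvalues solve `λ² = a² - b c` (`npFactor_mul_npFactor`), and since `c ≠ 0`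
the eigenvectors are the multiples of `(λ - a, c)`.

The scalars come from `u(s) = ∫ p(ω) / |s ξ - ω|` for a harmonic polynomial `p` of degree `n`.
Integration by parts along infinitesimal rotations (`integral_zonal_laplacian`) turns harmonicity of
the kernel into `s² u'' + 2 s u' = n (n + 1) u` on `(-1, 1)`, and regularity at `0` leaves `u = C
sⁿ` on `(0, 1)`. The combination `2 s u' + u` is the Poisson integral of `p`, which tends to `4 π
p(ξ)` as `s → 1`; this determines `C` (`zonalPotential_eq_interior`). Inversion gives the exterior,
and dominated convergence the value at `s = 1`. That value suffices for `𝒦*`, whose kernel on a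
sphere is a multiple of `1 / |x - y|`.

There are no further eigenvectors, because spherical harmonics are complete in `L²`
(`topologicalClosure_sphericalHarmonicsSpan`) and different degrees are orthogonal: an eigenvector
is determined by its coefficients, which solve the 2×2 systems. The squares of the `λₙ` strictly
decrease (`strictAnti_npEigenvalue_sq`), so an eigenspace involves a single degree, and the `2 n +
1` given harmonics span that degree by a dimension count
(`IsOrthonormalSphericalHarmonics.span_eq`). Boundedness is the Schur test. -/

/-! ### Rotation invariance of the surface measure -/

/-- The unit sphere of `ℝ³`. -/
abbrev UnitSphere : Type := Metric.sphere (0 : E3) 1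

/-- The surface measure of the unit sphere, as a measure on the unit sphere. -/
abbrev sphereMeasure : Measure UnitSphere := (volume : Measure E3).toSphere

theorem UnitSphere.norm_coe (ω : UnitSphere) : ‖(ω : E3)‖ = 1 := by simp

theorem UnitSphere.sum_sq (ω : UnitSphere) :
    (ω : E3) 0 ^ 2 + (ω : E3) 1 ^ 2 + (ω : E3) 2 ^ 2 = 1 := by
  have h := EuclideanSpace.norm_sq_eq (ω : E3)
  rw [ω.norm_coe, Fin.sum_univ_three] at h
  simpa using h.symm

theorem UnitSphere.inner_mem_Icc (ξ ω : UnitSphere) :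
    inner ℝ (ξ : E3) (ω : E3) ∈ Set.Icc (-1 : ℝ) 1 := by
  have h := abs_real_inner_le_norm (ξ : E3) (ω : E3)
  rw [ξ.norm_coe, ω.norm_coe, one_mul] at h
  exact abs_le.1 h

theorem integrable_sphereMeasure {F : Type*} [NormedAddCommGroup F]
    {g : UnitSphere → F} (hg : Continuous g) : Integrable g sphereMeasure :=
  hg.integrable_of_hasCompactSupport (HasCompactSupport.of_compactSpace g)

theorem sphereMeasure_real_univ : sphereMeasure.real Set.univ = 4 * Real.pi := by
  rw [Measure.toSphere_real_apply_univ, measureReal_def, EuclideanSpace.volume_ball_fin_three]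
  rw [ENNReal.ofReal_one, one_pow, one_mul, ENNReal.toReal_ofReal (by positivity)]
  simp
  ring

/-- The action of a linear isometry on the unit sphere. -/
def sphereMap (R : E3 ≃ₗᵢ[ℝ] E3) (ω : UnitSphere) : UnitSphere :=
  ⟨R ω, by simp [R.norm_map]⟩

theorem continuous_sphereMap (R : E3 ≃ₗᵢ[ℝ] E3) : Continuous (sphereMap R) := by
  unfold sphereMap
  fun_prop

/-- `toSphere` measures a set through the volume of the cone over it; an isometry maps cones to
cones and preserves volume. -/
theorem measurePreserving_sphereMap (R : E3 ≃ₗᵢ[ℝ] E3) :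
    MeasurePreserving (sphereMap R) sphereMeasure sphereMeasure := by
  refine ⟨(continuous_sphereMap R).measurable, ?_⟩
  ext s hs
  rw [Measure.map_apply (continuous_sphereMap R).measurable hs, Measure.toSphere_apply' _ hs,
    Measure.toSphere_apply' _ ((continuous_sphereMap R).measurable hs)]
  congr 1
  conv_rhs => rw [← R.measurePreserving.measure_preimage_emb R.toHomeomorph.measurableEmbedding]
  congr 1
  ext x
  simp only [Set.mem_smul, Set.mem_image, Set.mem_preimage, Subtype.exists, exists_and_right,
    exists_eq_right]
  constructor
  · rintro ⟨r, hr, y, ⟨hy, hys⟩, rfl⟩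
    exact ⟨r, hr, R y, ⟨(sphereMap R ⟨y, hy⟩).2, hys⟩, by simp⟩
  · rintro ⟨r, hr, y, ⟨hy, hys⟩, h⟩
    refine ⟨r, hr, R.symm y, ⟨by simpa using hy, ?_⟩, ?_⟩
    · simpa [sphereMap] using hys
    · rw [← map_smul, h, R.symm_apply_apply]

theorem integral_sphereMap (R : E3 ≃ₗᵢ[ℝ] E3) {g : UnitSphere → ℂ} (hg : Continuous g) :
    ∫ ω, g (sphereMap R ω) ∂sphereMeasure = ∫ ω, g ω ∂sphereMeasure := by
  have h := measurePreserving_sphereMap R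
  conv_rhs => rw [← h.map_eq]
  rw [integral_map h.measurable.aemeasurable hg.aestronglyMeasurable]

/-- The derivative of a function along an infinitesimal rotation has mean zero on the sphere. -/
theorem integral_fderiv_skewAdjoint {A : E3 →L[ℝ] E3} (hA : A ∈ skewAdjoint (E3 →L[ℝ] E3))
    {g : E3 → ℂ} {g' : E3 → E3 →L[ℝ] ℂ}
    (hg : ∀ ω : UnitSphere, HasFDerivAt g (g' ω) ω)
    (hg' : Continuous fun ω : UnitSphere => g' ω) :
    ∫ ω : UnitSphere, g' ω (A ω) ∂sphereMeasure = 0 := by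
  let _ : NormedAlgebra ℚ (E3 →L[ℝ] E3) := NormedAlgebra.restrictScalars ℚ ℝ _
  have hunit : ∀ θ : ℝ, NormedSpace.exp (θ • A) ∈ unitary (E3 →L[ℝ] E3) := fun θ =>
    NormedSpace.exp_mem_unitary_of_mem_skewAdjoint (skewAdjoint.smul_mem θ hA)
  let R : ℝ → E3 ≃ₗᵢ[ℝ] E3 := fun θ => Unitary.linearIsometryEquiv ⟨_, hunit θ⟩
  have hgc : Continuous fun ω : UnitSphere => g ω :=
    continuous_iff_continuousAt.2 fun ω =>
      (hg ω).continuousAt.comp continuous_subtype_val.continuousAt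
  obtain ⟨C, hC⟩ := isCompact_univ.exists_bound_of_continuousOn
    (f := fun ω : UnitSphere => g' ω) hg'.continuousOn
  have hderiv : ∀ (ω : UnitSphere) (θ : ℝ), HasDerivAt (fun θ => g (R θ ω))
      (g' (sphereMap (R θ) ω) (A (R θ ω))) θ := by
    intro ω θ
    have h1 : HasDerivAt (fun θ : ℝ => NormedSpace.exp (θ • A) (ω : E3))
        (A (R θ ω)) θ := by
      have := (hasDerivAt_exp_smul_const' A θ).clm_apply (hasDerivAt_const θ (ω : E3))
      rw [map_zero, add_zero] at this
      exact this
    exact (hg (sphereMap (R θ) ω)).comp_hasDerivAt θ h1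
  have key := hasDerivAt_integral_of_dominated_loc_of_deriv_le (μ := sphereMeasure)
    (F := fun (θ : ℝ) (ω : UnitSphere) => g (R θ ω))
    (F' := fun θ ω => g' (sphereMap (R θ) ω) (A (R θ ω))) (x₀ := 0) (s := Set.univ)
    (bound := fun _ => C * ‖A‖) Filter.univ_mem
    (Filter.Eventually.of_forall fun θ =>
      (hgc.comp (continuous_sphereMap (R θ))).aestronglyMeasurable)
    (integrable_sphereMeasure (hgc.comp (continuous_sphereMap (R 0)))) ?_ ?_
    (integrable_const _) (Filter.Eventually.of_forall fun ω θ _ => hderiv ω θ)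
  -- By invariance the integral does not depend on `θ`, so its derivative at `θ = 0`, the integral
  -- in question, vanishes.
  · have hconst : (fun θ : ℝ => ∫ ω, g (R θ ω) ∂sphereMeasure)
        = fun _ => ∫ ω : UnitSphere, g ω ∂sphereMeasure :=
      funext fun θ => integral_sphereMap (R θ) hgc
    have h2 := key.2
    rw [hconst] at h2
    have h3 := h2.unique (hasDerivAt_const _ _)
    have h0 : ∀ ω : UnitSphere, R 0 ω = ω := fun ω =>
      congrArg (fun B : E3 →L[ℝ] E3 => B ω)
        ((congrArg NormedSpace.exp (zero_smul ℝ A)).trans NormedSpace.exp_zero)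
    have h0' : ∀ ω : UnitSphere, sphereMap (R 0) ω = ω := fun ω => Subtype.ext (h0 ω)
    simpa only [h0, h0'] using h3
  · have h1 : Continuous fun ω : UnitSphere => g' (sphereMap (R 0) ω) :=
      hg'.comp (continuous_sphereMap (R 0))
    have h2 : Continuous fun ω : UnitSphere => A (R 0 ω) := by fun_prop
    exact (h1.clm_apply h2).aestronglyMeasurable
  · refine Filter.Eventually.of_forall fun ω θ _ => ?_
    refine ((g' (sphereMap (R θ) ω)).le_opNorm _).trans ?_
    have h1 : ‖A (R θ ω)‖ ≤ ‖A‖ := by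
      refine (A.le_opNorm _).trans ?_
      rw [(R θ).norm_map, ω.norm_coe, mul_one]
    exact mul_le_mul (hC _ (Set.mem_univ _)) h1 (norm_nonneg _)
      ((norm_nonneg _).trans (hC ω (Set.mem_univ _)))

/-! ### Polynomial functions and infinitesimal rotations -/

/-- The function on `ℝ³` defined by a polynomial with complex coefficients. -/
def polyFun (p : MvPolynomial (Fin 3) ℂ) (y : E3) : ℂ :=
  MvPolynomial.eval (fun i => ((y i : ℝ) : ℂ)) p

theorem polyFun_add (p q : MvPolynomial (Fin 3) ℂ) (y : E3) :
    polyFun (p + q) y = polyFun p y + polyFun q y := map_add _ _ _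

theorem polyFun_sub (p q : MvPolynomial (Fin 3) ℂ) (y : E3) :
    polyFun (p - q) y = polyFun p y - polyFun q y := map_sub _ _ _

theorem polyFun_mul (p q : MvPolynomial (Fin 3) ℂ) (y : E3) :
    polyFun (p * q) y = polyFun p y * polyFun q y := map_mul _ _ _

theorem polyFun_X (i : Fin 3) (y : E3) : polyFun (MvPolynomial.X i) y = (y i : ℂ) :=
  MvPolynomial.eval_X _

theorem polyFun_C (c : ℂ) (y : E3) : polyFun (MvPolynomial.C c) y = c :=
  MvPolynomial.eval_C _

theorem continuous_polyFun (p : MvPolynomial (Fin 3) ℂ) : Continuous (polyFun p) :=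
  p.continuous_eval.comp (by fun_prop)

/-- The `i`-th coordinate as a complex valued real linear form. -/
def coordCLM (i : Fin 3) : E3 →L[ℝ] ℂ :=
  Complex.ofRealCLM.comp (EuclideanSpace.proj i)

theorem coordCLM_apply (i : Fin 3) (y : E3) : coordCLM i y = (y i : ℂ) := rfl

/-- The derivative of a polynomial function. -/
def polyDeriv (p : MvPolynomial (Fin 3) ℂ) (y : E3) : E3 →L[ℝ] ℂ :=
  ∑ i, polyFun (MvPolynomial.pderiv i p) y • coordCLM i

theorem polyDeriv_apply (p : MvPolynomial (Fin 3) ℂ) (y v : E3) :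
    polyDeriv p y v = ∑ i, polyFun (MvPolynomial.pderiv i p) y * (v i : ℂ) := by
  simp [polyDeriv, sum_apply, coordCLM_apply]

theorem continuous_polyDeriv (p : MvPolynomial (Fin 3) ℂ) : Continuous (polyDeriv p) :=
  continuous_finsetSum _ fun _ _ => (continuous_polyFun _).smul continuous_const

theorem hasFDerivAt_polyFun (p : MvPolynomial (Fin 3) ℂ) (y : E3) :
    HasFDerivAt (polyFun p) (polyDeriv p y) y := by
  induction p using MvPolynomial.induction_on with
  | C a =>
    have h1 : polyFun (MvPolynomial.C a) = fun _ => a := funext fun y => polyFun_C a y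
    have h2 : polyDeriv (MvPolynomial.C a) y = 0 := by
      ext v
      simp [polyDeriv_apply, polyFun]
    rw [h1, h2]
    exact hasFDerivAt_const a y
  | add p q hp hq =>
    have h1 : polyFun (p + q) = fun y => polyFun p y + polyFun q y :=
      funext fun y => polyFun_add p q y
    have h2 : polyDeriv (p + q) y = polyDeriv p y + polyDeriv q y := by
      ext v
      simp [polyDeriv_apply, polyFun_add, add_mul, Finset.sum_add_distrib]
    rw [h1, h2]
    exact hp.add hq
  | mul_X p i hp =>
    have h1 : polyFun (p * MvPolynomial.X i) = fun y => polyFun p y * coordCLM i y :=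
      funext fun y => by rw [polyFun_mul, polyFun_X, coordCLM_apply]
    have h2 : polyDeriv (p * MvPolynomial.X i) y
        = polyFun p y • coordCLM i + coordCLM i y • polyDeriv p y := by
      ext v
      have h3 : ∀ j, polyFun (MvPolynomial.pderiv j (MvPolynomial.X i)) y * (v j : ℂ)
          = if j = i then (v i : ℂ) else 0 := by
        intro j
        rcases eq_or_ne j i with rfl | hj
        · simp [polyFun]
        · simp [polyFun, MvPolynomial.pderiv_X_of_ne hj.symm, hj]
      simp only [polyDeriv_apply, MvPolynomial.pderiv_mul, polyFun_add, polyFun_mul, polyFun_X,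
        add_mul, Finset.sum_add_distrib, mul_assoc, h3, add_apply, smul_apply, coordCLM_apply,
        smul_eq_mul, Finset.mul_sum, mul_ite, mul_zero, Finset.sum_ite_eq', Finset.mem_univ,
        if_true]
      rw [add_comm]
      congr 1
      exact Finset.sum_congr rfl fun j _ => by ring
    rw [h1, h2]
    exact hp.mul (coordCLM i).hasFDerivAt

theorem pderiv_pderiv_comm (i j : Fin 3) (p : MvPolynomial (Fin 3) ℂ) :
    MvPolynomial.pderiv i (MvPolynomial.pderiv j p)
      = MvPolynomial.pderiv j (MvPolynomial.pderiv i p) := by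
  ext m
  simp only [MvPolynomial.coeff_pderiv, add_right_comm m]
  rcases eq_or_ne i j with rfl | h
  · rfl
  · simp [h, h.symm]
    ring

/-- The harmonic homogeneous polynomials of degree `n`. -/
def harmonicSubmodule (n : ℕ) : Submodule ℂ (MvPolynomial (Fin 3) ℂ) where
  carrier := {p | p.IsHomogeneous n ∧
    ∑ i, MvPolynomial.pderiv i (MvPolynomial.pderiv i p) = 0}
  add_mem' := fun ⟨ha, ha'⟩ ⟨hb, hb'⟩ => ⟨ha.add hb, by
    simp only [map_add, Finset.sum_add_distrib, ha', hb', add_zero]⟩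
  zero_mem' := ⟨MvPolynomial.isHomogeneous_zero _ _ _, by simp⟩
  smul_mem' := fun c p ⟨hp, hp'⟩ =>
    ⟨(MvPolynomial.homogeneousSubmodule (Fin 3) ℂ n).smul_mem c hp, by
      simp only [Derivation.map_smul, ← Finset.smul_sum, hp', smul_zero]⟩

/-- The derivative of a polynomial along the infinitesimal rotation in the plane of the
coordinates `i` and `j`. -/
def angMomentum (i j : Fin 3) (p : MvPolynomial (Fin 3) ℂ) : MvPolynomial (Fin 3) ℂ :=
  MvPolynomial.X i * MvPolynomial.pderiv j p - MvPolynomial.X j * MvPolynomial.pderiv i p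

/-- The infinitesimal rotation in the plane of the coordinates `i` and `j`. -/
def rotGenerator (i j : Fin 3) : E3 →L[ℝ] E3 :=
  (EuclideanSpace.proj i).smulRight (EuclideanSpace.single j (1 : ℝ))
    - (EuclideanSpace.proj j).smulRight (EuclideanSpace.single i (1 : ℝ))

theorem rotGenerator_apply (i j : Fin 3) (y : E3) :
    rotGenerator i j y = y i • EuclideanSpace.single j (1 : ℝ)
      - y j • EuclideanSpace.single i (1 : ℝ) := rfl

theorem inner_rotGenerator (i j : Fin 3) (x y : E3) :
    inner ℝ x (rotGenerator i j y) = y i * x j - y j * x i := by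
  rw [rotGenerator_apply, inner_sub_right, inner_smul_right, inner_smul_right,
    EuclideanSpace.inner_single_right, EuclideanSpace.inner_single_right]
  simp

theorem rotGenerator_mem_skewAdjoint (i j : Fin 3) :
    rotGenerator i j ∈ skewAdjoint (E3 →L[ℝ] E3) := by
  rw [skewAdjoint.mem_iff, ContinuousLinearMap.star_eq_adjoint, eq_comm,
    ContinuousLinearMap.eq_adjoint_iff]
  intro x y
  rw [neg_apply, inner_neg_left, inner_rotGenerator, real_inner_comm,
    inner_rotGenerator]
  ring

theorem polyDeriv_rotGenerator (i j : Fin 3) (p : MvPolynomial (Fin 3) ℂ) (y : E3) :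
    polyDeriv p y (rotGenerator i j y) = polyFun (angMomentum i j p) y := by
  have h : ∀ k, ((rotGenerator i j y k : ℝ) : ℂ)
      = (if k = j then (y i : ℂ) else 0) - (if k = i then (y j : ℂ) else 0) := by
    intro k
    simp only [rotGenerator_apply, PiLp.sub_apply, PiLp.smul_apply, PiLp.single_apply]
    split_ifs <;> simp
  simp only [polyDeriv_apply, h, angMomentum, polyFun_sub, polyFun_mul, polyFun_X, mul_sub,
    Finset.sum_sub_distrib, mul_ite, mul_zero, Finset.sum_ite_eq', Finset.mem_univ, if_true]
  ring

/-! ### The spherical Laplacian against zonal kernels -/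

/-- The derivative of a zonal function times a polynomial along an infinitesimal rotation has
mean zero on the sphere. -/
theorem integral_zonal_mul_angMomentum (ξ : UnitSphere) {F F' : ℝ → ℝ}
    (hF : ∀ t ∈ Set.Icc (-1 : ℝ) 1, HasDerivAt F (F' t) t)
    (hF' : ContinuousOn F' (Set.Icc (-1 : ℝ) 1)) (i j : Fin 3) (q : MvPolynomial (Fin 3) ℂ) :
    ∫ ω : UnitSphere, ((F' (inner ℝ (ξ : E3) ω) : ℂ)
        * (((ω : E3) i * (ξ : E3) j - (ω : E3) j * (ξ : E3) i : ℝ) : ℂ) * polyFun q ω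
      + (F (inner ℝ (ξ : E3) ω) : ℂ) * polyFun (angMomentum i j q) ω) ∂sphereMeasure = 0 := by
  let g' : E3 → E3 →L[ℝ] ℂ := fun y =>
    (F (inner ℝ (ξ : E3) y) : ℂ) • polyDeriv q y
      + polyFun q y • Complex.ofRealCLM.comp (F' (inner ℝ (ξ : E3) y) • innerSL ℝ (ξ : E3))
  have hinner : Continuous fun ω : UnitSphere => inner ℝ (ξ : E3) (ω : E3) := by fun_prop
  have hFc : ContinuousOn F (Set.Icc (-1 : ℝ) 1) := fun t ht =>
    (hF t ht).continuousAt.continuousWithinAt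
  have c1 : Continuous fun ω : UnitSphere => F (inner ℝ (ξ : E3) (ω : E3)) :=
    hFc.comp_continuous hinner fun ω => UnitSphere.inner_mem_Icc ξ ω
  have c2 : Continuous fun ω : UnitSphere => F' (inner ℝ (ξ : E3) (ω : E3)) :=
    hF'.comp_continuous hinner fun ω => UnitSphere.inner_mem_Icc ξ ω
  have hg : ∀ ω : UnitSphere, HasFDerivAt
      (fun y : E3 => (F (inner ℝ (ξ : E3) y) : ℂ) * polyFun q y) (g' ω) ω := by
    intro ω
    have h1 : HasFDerivAt (fun y : E3 => F (inner ℝ (ξ : E3) y))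
        (F' (inner ℝ (ξ : E3) ω) • innerSL ℝ (ξ : E3)) (ω : E3) :=
      (hF _ (UnitSphere.inner_mem_Icc ξ ω)).comp_hasFDerivAt (ω : E3)
        (innerSL ℝ (ξ : E3)).hasFDerivAt
    exact (Complex.ofRealCLM.hasFDerivAt.comp (ω : E3) h1).mul (hasFDerivAt_polyFun q ω)
  have hg' : Continuous fun ω : UnitSphere => g' ω := by
    refine Continuous.add ?_ ?_
    · exact (Complex.continuous_ofReal.comp c1).smul
        ((continuous_polyDeriv q).comp continuous_subtype_val)
    · exact ((continuous_polyFun q).comp continuous_subtype_val).smul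
        (continuous_const.clm_comp (c2.smul continuous_const))
  rw [← integral_fderiv_skewAdjoint (rotGenerator_mem_skewAdjoint i j) hg hg']
  refine integral_congr_ae (Filter.Eventually.of_forall fun ω => ?_)
  simp only [g', add_apply, smul_apply, polyDeriv_rotGenerator, ContinuousLinearMap.comp_apply,
    smul_eq_mul, innerSL_apply_apply, inner_rotGenerator, Complex.ofRealCLM_apply]
  push_cast
  ring

theorem sum_coord_mul_polyFun_pderiv {n : ℕ} {p : MvPolynomial (Fin 3) ℂ}
    (hp : p.IsHomogeneous n) (y : E3) :
    ∑ i, (y i : ℂ) * polyFun (MvPolynomial.pderiv i p) y = n * polyFun p y := by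
  have h := congrArg (fun q => polyFun q y) hp.sum_X_mul_pderiv
  simpa [polyFun] using h

/-- Euler's identity for `∂ₖ p`, obtained by differentiating that of `p`; thus `n - 1` is a complex
number and `n = 0` is no exception. -/
theorem sum_coord_mul_polyFun_pderiv_pderiv {n : ℕ} {p : MvPolynomial (Fin 3) ℂ}
    (hp : p.IsHomogeneous n) (k : Fin 3) (y : E3) :
    ∑ i, (y i : ℂ) * polyFun (MvPolynomial.pderiv k (MvPolynomial.pderiv i p)) y
      = (n - 1) * polyFun (MvPolynomial.pderiv k p) y := by
  have h := congrArg (fun q => polyFun (MvPolynomial.pderiv k q) y) hp.sum_X_mul_pderiv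
  simp only [map_sum, MvPolynomial.pderiv_mul, map_nsmul, Finset.sum_add_distrib,
    MvPolynomial.pderiv_X, Pi.single_apply, ite_mul, one_mul, zero_mul,
    Finset.sum_ite_eq', Finset.mem_univ, if_true] at h
  simp only [polyFun, map_add, map_sum, map_mul, MvPolynomial.eval_X, nsmul_eq_mul,
    map_natCast] at h ⊢
  linear_combination h

/-- Symmetry of the spherical Laplacian `∑ Lᵢⱼ²`, where `Lᵢⱼ = xᵢ ∂ⱼ - xⱼ ∂ᵢ`. On a zonal function
it is Legendre's operator, on `p` it is `-n (n + 1)`. -/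
theorem integral_zonal_laplacian {n : ℕ} {p : MvPolynomial (Fin 3) ℂ}
    (hp : p ∈ harmonicSubmodule n) (ξ : UnitSphere) {F F' F'' : ℝ → ℝ}
    (hF : ∀ t ∈ Set.Icc (-1 : ℝ) 1, HasDerivAt F (F' t) t)
    (hF' : ∀ t ∈ Set.Icc (-1 : ℝ) 1, HasDerivAt F' (F'' t) t)
    (hF'' : ContinuousOn F'' (Set.Icc (-1 : ℝ) 1)) :
    ∫ ω : UnitSphere, (((1 - inner ℝ (ξ : E3) ω ^ 2) * F'' (inner ℝ (ξ : E3) ω)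
        - 2 * inner ℝ (ξ : E3) ω * F' (inner ℝ (ξ : E3) ω) : ℝ) : ℂ) * polyFun p ω ∂sphereMeasure
      = -(n * (n + 1)) * ∫ ω : UnitSphere, (F (inner ℝ (ξ : E3) ω) : ℂ) * polyFun p ω
          ∂sphereMeasure := by
  have hinner : Continuous fun ω : UnitSphere => inner ℝ (ξ : E3) (ω : E3) := by fun_prop
  have hF'c : ContinuousOn F' (Set.Icc (-1 : ℝ) 1) := fun t ht =>
    (hF' t ht).continuousAt.continuousWithinAt
  have hFc : ContinuousOn F (Set.Icc (-1 : ℝ) 1) := fun t ht =>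
    (hF t ht).continuousAt.continuousWithinAt
  have c0 : Continuous fun ω : UnitSphere => (F (inner ℝ (ξ : E3) (ω : E3)) : ℂ) :=
    Complex.continuous_ofReal.comp
      (hFc.comp_continuous hinner fun ω => UnitSphere.inner_mem_Icc ξ ω)
  have c1 : Continuous fun ω : UnitSphere => (F' (inner ℝ (ξ : E3) (ω : E3)) : ℂ) :=
    Complex.continuous_ofReal.comp
      (hF'c.comp_continuous hinner fun ω => UnitSphere.inner_mem_Icc ξ ω)
  have c2 : Continuous fun ω : UnitSphere => (F'' (inner ℝ (ξ : E3) (ω : E3)) : ℂ) :=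
    Complex.continuous_ofReal.comp
      (hF''.comp_continuous hinner fun ω => UnitSphere.inner_mem_Icc ξ ω)
  have cp : ∀ q, Continuous fun ω : UnitSphere => polyFun q ω := fun q =>
    (continuous_polyFun q).comp continuous_subtype_val
  have cl : ∀ i j : Fin 3, Continuous fun ω : UnitSphere =>
      (((ω : E3) i * (ξ : E3) j - (ω : E3) j * (ξ : E3) i : ℝ) : ℂ) := fun i j => by fun_prop
  -- `ℓ i j` is `Lᵢⱼ` applied to `y ↦ ξ · y`. So `a i j` is `Lᵢⱼ ((Lᵢⱼ F) p)`, `b i j` is `Lᵢⱼ (F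
  -- Lᵢⱼ p)`, and the difference `(Lᵢⱼ² F) p - F Lᵢⱼ² p` has mean zero.
  let ℓ : Fin 3 → Fin 3 → MvPolynomial (Fin 3) ℂ := fun i j =>
    MvPolynomial.X i * MvPolynomial.C ((ξ : E3) j : ℂ)
      - MvPolynomial.X j * MvPolynomial.C ((ξ : E3) i : ℂ)
  let a : Fin 3 → Fin 3 → UnitSphere → ℂ := fun i j ω =>
    (F'' (inner ℝ (ξ : E3) ω) : ℂ)
        * (((ω : E3) i * (ξ : E3) j - (ω : E3) j * (ξ : E3) i : ℝ) : ℂ) * polyFun (ℓ i j * p) ω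
      + (F' (inner ℝ (ξ : E3) ω) : ℂ) * polyFun (angMomentum i j (ℓ i j * p)) ω
  let b : Fin 3 → Fin 3 → UnitSphere → ℂ := fun i j ω =>
    (F' (inner ℝ (ξ : E3) ω) : ℂ)
        * (((ω : E3) i * (ξ : E3) j - (ω : E3) j * (ξ : E3) i : ℝ) : ℂ)
        * polyFun (angMomentum i j p) ω
      + (F (inner ℝ (ξ : E3) ω) : ℂ) * polyFun (angMomentum i j (angMomentum i j p)) ω
  have ia : ∀ i j, Integrable (a i j) sphereMeasure := fun i j =>
    integrable_sphereMeasure (((c2.mul (cl i j)).mul (cp _)).add (c1.mul (cp _)))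
  have ib : ∀ i j, Integrable (b i j) sphereMeasure := fun i j =>
    integrable_sphereMeasure (((c1.mul (cl i j)).mul (cp _)).add (c0.mul (cp _)))
  have hab : ∀ i j, ∫ ω, (a i j ω - b i j ω) ∂sphereMeasure = 0 := fun i j => by
    rw [integral_sub (ia i j) (ib i j), integral_zonal_mul_angMomentum ξ hF' hF'',
      integral_zonal_mul_angMomentum ξ hF hF'c, sub_zero]
  have iab : ∀ i j, Integrable (fun ω => a i j ω - b i j ω) sphereMeasure := fun i j =>
    (ia i j).sub (ib i j)
  have hsum : ∫ ω, ((a 0 1 ω - b 0 1 ω) + ((a 0 2 ω - b 0 2 ω) + (a 1 2 ω - b 1 2 ω)))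
      ∂sphereMeasure = 0 := by
    have i2 : Integrable (fun ω => (a 0 2 ω - b 0 2 ω) + (a 1 2 ω - b 1 2 ω)) sphereMeasure :=
      (iab 0 2).add (iab 1 2)
    rw [integral_add (iab 0 1) i2, integral_add (iab 0 2) (iab 1 2),
      hab, hab, hab, add_zero, add_zero]
  rw [← integral_const_mul, ← sub_eq_zero, ← integral_sub, ← hsum]
  · refine integral_congr_ae (Filter.Eventually.of_forall fun ω => ?_)
    have e := sum_coord_mul_polyFun_pderiv hp.1 (ω : E3)
    have e0 := sum_coord_mul_polyFun_pderiv_pderiv hp.1 0 (ω : E3)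
    have e1 := sum_coord_mul_polyFun_pderiv_pderiv hp.1 1 (ω : E3)
    have e2 := sum_coord_mul_polyFun_pderiv_pderiv hp.1 2 (ω : E3)
    have hΔ := congrArg (fun q => polyFun q ω) hp.2
    have hω := congrArg (fun u : ℝ => (u : ℂ)) ω.sum_sq
    have hξ := congrArg (fun u : ℝ => (u : ℂ)) ξ.sum_sq
    have ht : (inner ℝ (ξ : E3) (ω : E3) : ℝ) = (ξ : E3) 0 * (ω : E3) 0 + (ξ : E3) 1 * (ω : E3) 1
        + (ξ : E3) 2 * (ω : E3) 2 := by
      rw [PiLp.inner_apply, Fin.sum_univ_three]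
      simp [mul_comm]
    simp only [a, b, ℓ, angMomentum, polyFun_sub, polyFun_mul, polyFun_X, polyFun_C, polyFun_add,
      map_sub, MvPolynomial.pderiv_mul, MvPolynomial.pderiv_C]
    generalize F (inner ℝ (ξ : E3) ω) = f0
    generalize F' (inner ℝ (ξ : E3) ω) = f1
    generalize F'' (inner ℝ (ξ : E3) ω) = f2
    rw [ht]
    simp only [Fin.sum_univ_three, polyFun_add, pderiv_pderiv_comm 1 0, pderiv_pderiv_comm 2 0,
      pderiv_pderiv_comm 2 1] at e e0 e1 e2 hΔ ⊢
    simp [MvPolynomial.pderiv_X, polyFun] at e e0 e1 e2 hΔ hω hξ ⊢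
    -- The terms in `f0` express `∑ Lᵢⱼ² = |x|² Δ - E (E + 1)` with `E` the Euler operator; those in
    -- `f2` express Lagrange's identity `∑ ℓᵢⱼ² = |ω|² |ξ|² - t²`.
    linear_combination (f0 : ℂ) * ((((ω : E3) 0 : ℂ) ^ 2 + ((ω : E3) 1 : ℂ) ^ 2
        + ((ω : E3) 2 : ℂ) ^ 2) * hΔ - ((ω : E3) 0 : ℂ) * e0 - ((ω : E3) 1 : ℂ) * e1
        - ((ω : E3) 2 : ℂ) * e2 - (n + 1) * e)
      + (f2 : ℂ) * (MvPolynomial.eval fun i => (((ω : E3) i : ℝ) : ℂ)) p * (-hω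
        - (((ω : E3) 0 : ℂ) ^ 2 + ((ω : E3) 1 : ℂ) ^ 2 + ((ω : E3) 2 : ℂ) ^ 2) * hξ)
  · refine integrable_sphereMeasure (Continuous.mul ?_ (cp p))
    push_cast
    exact ((continuous_const.sub ((Complex.continuous_ofReal.comp hinner).pow 2)).mul c2).sub
      ((continuous_const.mul (Complex.continuous_ofReal.comp hinner)).mul c1)
  · exact integrable_sphereMeasure (continuous_const.mul (c0.mul (cp p)))

/-! ### The inverse distance kernel and its radial equation -/

/-- For unit vectors `ξ`, `ω` with inner product `t`, the inverse distance of `s ξ` and `ω`. -/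
def invDist (s t : ℝ) : ℝ := (√(1 + s ^ 2 - 2 * s * t))⁻¹

/-- Negative `s` is admitted because the radial equation is solved on an interval around `s = 0`. -/
theorem sq_one_sub_abs_le (s : ℝ) {t : ℝ} (ht : t ∈ Set.Icc (-1 : ℝ) 1) :
    (1 - |s|) ^ 2 ≤ 1 + s ^ 2 - 2 * s * t := by
  have h1 : s * t ≤ |s| := by
    calc s * t ≤ |s * t| := le_abs_self _
      _ = |s| * |t| := abs_mul _ _
      _ ≤ |s| * 1 := by gcongr; exact abs_le.2 ht
      _ = |s| := mul_one _
  nlinarith [sq_abs s]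

theorem invDist_radicand_pos {s t : ℝ} (hs : |s| ≠ 1) (ht : t ∈ Set.Icc (-1 : ℝ) 1) :
    0 < 1 + s ^ 2 - 2 * s * t :=
  lt_of_lt_of_le (by have := sub_ne_zero.2 hs.symm; positivity) (sq_one_sub_abs_le s ht)

theorem invDist_nonneg (s t : ℝ) : 0 ≤ invDist s t := inv_nonneg.2 (Real.sqrt_nonneg _)

/-- The only relation on the square root that later identities need; with it they become polynomial
in `s`, `t` and `invDist s t`. -/
theorem invDist_eq_pow_mul {s t : ℝ} (h : 0 < 1 + s ^ 2 - 2 * s * t) :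
    invDist s t = invDist s t ^ 3 * (1 + s ^ 2 - 2 * s * t) := by
  have h1 := Real.sqrt_pos.2 h
  have h2 := Real.sq_sqrt h.le
  unfold invDist
  rw [← h2]
  generalize √(1 + s ^ 2 - 2 * s * t) = u at *
  rw [Real.sqrt_sq h1.le]
  field_simp

theorem HasDerivAt.inv_sqrt {q : ℝ → ℝ} {q' x : ℝ} (h : HasDerivAt q q' x) (hq : 0 < q x) :
    HasDerivAt (fun x => (√(q x))⁻¹) (-(q' / 2) * (√(q x))⁻¹ ^ 3) x := by
  have h1 := Real.sqrt_pos.2 hq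
  refine ((h.sqrt hq.ne').inv h1.ne').congr_deriv ?_
  field_simp

theorem hasDerivAt_invDist_left {s t : ℝ} (h : 0 < 1 + s ^ 2 - 2 * s * t) :
    HasDerivAt (fun s => invDist s t) ((t - s) * invDist s t ^ 3) s := by
  have h1 : HasDerivAt (fun s : ℝ => 1 + s ^ 2 - 2 * s * t) (2 * s - 2 * t) s := by
    refine ((((hasDerivAt_id s).pow 2).const_add 1).sub
      (((hasDerivAt_id s).const_mul 2).mul_const t)).congr_deriv ?_
    simp
  refine (h1.inv_sqrt h).congr_deriv ?_
  unfold invDist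
  ring

theorem hasDerivAt_invDist_right {s t : ℝ} (h : 0 < 1 + s ^ 2 - 2 * s * t) :
    HasDerivAt (fun t => invDist s t) (s * invDist s t ^ 3) t := by
  have h1 : HasDerivAt (fun t : ℝ => 1 + s ^ 2 - 2 * s * t) (-(2 * s)) t := by
    refine (((hasDerivAt_id t).const_mul (2 * s)).const_sub (1 + s ^ 2)).congr_deriv ?_
    simp
  refine (h1.inv_sqrt h).congr_deriv ?_
  unfold invDist
  ring

theorem continuousOn_invDist {U : Set ℝ} (hU : ∀ s ∈ U, |s| ≠ 1) :
    ContinuousOn (fun z : ℝ × ℝ => invDist z.1 z.2) (U ×ˢ Set.Icc (-1 : ℝ) 1) := by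
  unfold invDist
  refine ContinuousOn.inv₀ (by fun_prop) fun z hz => ?_
  exact (Real.sqrt_pos.2 (invDist_radicand_pos (hU _ hz.1) hz.2)).ne'

/-- Differentiation of the integral of a zonal kernel with respect to a parameter. -/
theorem hasDerivAt_integral_zonal (ξ : UnitSphere) (p : MvPolynomial (Fin 3) ℂ) {U : Set ℝ}
    (hU : IsOpen U) {Φ Φ' : ℝ → ℝ → ℝ}
    (hΦ : ∀ s ∈ U, ∀ t ∈ Set.Icc (-1 : ℝ) 1, HasDerivAt (fun s => Φ s t) (Φ' s t) s)
    (hc : ContinuousOn (fun z : ℝ × ℝ => Φ z.1 z.2) (U ×ˢ Set.Icc (-1 : ℝ) 1))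
    (hc' : ContinuousOn (fun z : ℝ × ℝ => Φ' z.1 z.2) (U ×ˢ Set.Icc (-1 : ℝ) 1))
    {s : ℝ} (hs : s ∈ U) :
    HasDerivAt (fun s => ∫ ω : UnitSphere, (Φ s (inner ℝ (ξ : E3) ω) : ℂ) * polyFun p ω
        ∂sphereMeasure)
      (∫ ω : UnitSphere, (Φ' s (inner ℝ (ξ : E3) ω) : ℂ) * polyFun p ω ∂sphereMeasure) s := by
  have hinner : Continuous fun ω : UnitSphere => inner ℝ (ξ : E3) (ω : E3) := by fun_prop
  have cp : Continuous fun ω : UnitSphere => polyFun p ω :=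
    (continuous_polyFun p).comp continuous_subtype_val
  have cont : ∀ {Ψ : ℝ → ℝ → ℝ},
      ContinuousOn (fun z : ℝ × ℝ => Ψ z.1 z.2) (U ×ˢ Set.Icc (-1 : ℝ) 1) → ∀ s ∈ U,
      Continuous fun ω : UnitSphere => (Ψ s (inner ℝ (ξ : E3) ω) : ℂ) * polyFun p ω := by
    intro Ψ hΨ s hs
    refine (Complex.continuous_ofReal.comp ?_).mul cp
    exact hΨ.comp_continuous (f := fun ω : UnitSphere => (s, inner ℝ (ξ : E3) (ω : E3)))
      (by fun_prop) fun ω => ⟨hs, UnitSphere.inner_mem_Icc ξ ω⟩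
  obtain ⟨ε, hε, hball⟩ := Metric.nhds_basis_closedBall.mem_iff.1 (hU.mem_nhds hs)
  obtain ⟨C, hC⟩ := ((isCompact_closedBall s ε).prod
    (isCompact_Icc (a := (-1 : ℝ)) (b := 1))).exists_bound_of_continuousOn
    (hc'.mono (Set.prod_mono hball subset_rfl))
  obtain ⟨M, hM⟩ := isCompact_univ.exists_bound_of_continuousOn cp.continuousOn
  refine (hasDerivAt_integral_of_dominated_loc_of_deriv_le (μ := sphereMeasure)
    (F := fun s (ω : UnitSphere) => (Φ s (inner ℝ (ξ : E3) ω) : ℂ) * polyFun p ω)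
    (F' := fun s (ω : UnitSphere) => (Φ' s (inner ℝ (ξ : E3) ω) : ℂ) * polyFun p ω)
    (s := Metric.closedBall s ε) (bound := fun _ => C * M) (Metric.closedBall_mem_nhds s hε)
    ?_ (integrable_sphereMeasure (cont hc s hs)) (cont hc' s hs).aestronglyMeasurable ?_
    (integrable_const _) ?_).2
  · filter_upwards [hU.mem_nhds hs] with u hu
    exact (cont hc u hu).aestronglyMeasurable
  · refine Filter.Eventually.of_forall fun ω u hu => ?_
    rw [norm_mul, Complex.norm_real]
    have h1 := hC (u, inner ℝ (ξ : E3) ω) ⟨hu, UnitSphere.inner_mem_Icc ξ ω⟩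
    exact mul_le_mul h1 (hM ω (Set.mem_univ _)) (norm_nonneg _) ((norm_nonneg _).trans h1)
  · refine Filter.Eventually.of_forall fun ω u hu => ?_
    exact ((hΦ u (hball hu) _ (UnitSphere.inner_mem_Icc ξ ω)).ofReal_comp).mul_const _

/-- A solution of the radial Laplace equation that is regular at the origin is a multiple of
`s ^ n`. -/
theorem eq_pow_mul_of_radial_equation (n : ℕ) {f f' f'' : ℝ → ℂ}
    (hf : ∀ s ∈ Set.Ioo (-1 : ℝ) 1, HasDerivAt f (f' s) s)
    (hf' : ∀ s ∈ Set.Ioo (-1 : ℝ) 1, HasDerivAt f' (f'' s) s)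
    (heq : ∀ s ∈ Set.Ioo (-1 : ℝ) 1, (s : ℂ) ^ 2 * f'' s + 2 * s * f' s = n * (n + 1) * f s) :
    ∃ c : ℂ, ∀ s ∈ Set.Ioo (0 : ℝ) 1, f s = (s : ℂ) ^ n * c ∧ s * f' s = n * f s := by
  have hid : ∀ s : ℝ, HasDerivAt (fun s : ℝ => (s : ℂ)) 1 s := fun s =>
    (hasDerivAt_id s).ofReal_comp
  -- `s ^ (n + 1) * (s f' - n f)` is a first integral of the equation. Its value at `s = 0` is zero,
  -- which excludes the second solution `s ^ (-n - 1)`.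
  have h1 : ∀ s ∈ Set.Ioo (-1 : ℝ) 1,
      HasDerivAt (fun s : ℝ => (s : ℂ) ^ (n + 1) * (s * f' s - n * f s)) 0 s := by
    intro s hs
    refine (((hid s).pow (n + 1)).mul
      (((hid s).mul (hf' s hs)).sub ((hf s hs).const_mul (n : ℂ)))).congr_deriv ?_
    simp only [Pi.mul_apply, Pi.sub_apply, Pi.pow_apply, Nat.add_sub_cancel, mul_one, one_mul,
      Nat.cast_add, Nat.cast_one]
    linear_combination (s : ℂ) ^ n * heq s hs
  have h2 : ∀ s ∈ Set.Ioo (0 : ℝ) 1, s * f' s = n * f s := by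
    intro s hs
    have hs' : s ∈ Set.Ioo (-1 : ℝ) 1 := ⟨by linarith [hs.1], hs.2⟩
    have h3 := isOpen_Ioo.is_const_of_deriv_eq_zero isPreconnected_Ioo
      (fun s hs => (h1 s hs).differentiableAt.differentiableWithinAt)
      (fun s hs => (h1 s hs).deriv) hs' (show (0 : ℝ) ∈ Set.Ioo (-1 : ℝ) 1 by simp)
    simp only [Complex.ofReal_zero, zero_pow n.succ_ne_zero, zero_mul] at h3
    have h4 : (s : ℂ) ^ (n + 1) ≠ 0 := pow_ne_zero _ (by exact_mod_cast hs.1.ne')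
    exact sub_eq_zero.1 ((mul_eq_zero.1 h3).resolve_left h4)
  have h5 : ∀ s ∈ Set.Ioo (0 : ℝ) 1, HasDerivAt (fun s : ℝ => f s / (s : ℂ) ^ n) 0 s := by
    intro s hs
    have hs' : s ∈ Set.Ioo (-1 : ℝ) 1 := ⟨by linarith [hs.1], hs.2⟩
    have hs0 : (s : ℂ) ≠ 0 := by exact_mod_cast hs.1.ne'
    refine ((hf s hs').div ((hid s).pow n) (pow_ne_zero n hs0)).congr_deriv ?_
    rw [div_eq_zero_iff]
    left
    rcases n with _ | n
    · have := h2 s hs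
      simp only [Nat.cast_zero, zero_mul, mul_eq_zero, hs0, false_or] at this
      simp [this]
    · simp only [Pi.pow_apply, Nat.add_sub_cancel]
      linear_combination (s : ℂ) ^ n * h2 s hs
  -- The quotient `f / s ^ n` is constant; `1 / 2` is an arbitrary point of the interval.
  refine ⟨f (1 / 2) / ((1 / 2 : ℝ) : ℂ) ^ n, fun s hs => ⟨?_, h2 s hs⟩⟩
  have h6 := isOpen_Ioo.is_const_of_deriv_eq_zero isPreconnected_Ioo
      (fun s hs => (h5 s hs).differentiableAt.differentiableWithinAt)
      (fun s hs => (h5 s hs).deriv) hs (show (1 / 2 : ℝ) ∈ Set.Ioo (0 : ℝ) 1 by norm_num)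
  have hs0 : (s : ℂ) ≠ 0 := by exact_mod_cast hs.1.ne'
  rw [← h6]
  field_simp

/-- The potential at `s ξ` of the density `p` on the unit sphere. -/
def zonalPotential (p : MvPolynomial (Fin 3) ℂ) (ξ : UnitSphere) (s : ℝ) : ℂ :=
  ∫ ω : UnitSphere, (invDist s (inner ℝ (ξ : E3) ω) : ℂ) * polyFun p ω ∂sphereMeasure

/-- The radial derivative of `zonalPotential`. -/
def zonalPotentialDeriv (p : MvPolynomial (Fin 3) ℂ) (ξ : UnitSphere) (s : ℝ) : ℂ :=
  ∫ ω : UnitSphere, (((inner ℝ (ξ : E3) ω - s) * invDist s (inner ℝ (ξ : E3) ω) ^ 3 : ℝ) : ℂ)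
    * polyFun p ω ∂sphereMeasure

theorem isOpen_abs_ne_one : IsOpen {s : ℝ | |s| ≠ 1} :=
  isOpen_ne_fun continuous_abs continuous_const

theorem hasDerivAt_zonalPotential (p : MvPolynomial (Fin 3) ℂ) (ξ : UnitSphere) {s : ℝ}
    (hs : |s| ≠ 1) : HasDerivAt (zonalPotential p ξ) (zonalPotentialDeriv p ξ s) s := by
  have hc := continuousOn_invDist (U := {s : ℝ | |s| ≠ 1}) fun _ h => h
  refine hasDerivAt_integral_zonal ξ p isOpen_abs_ne_one
    (Φ := invDist) (Φ' := fun s t => (t - s) * invDist s t ^ 3)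
    (fun s hs t ht => hasDerivAt_invDist_left (invDist_radicand_pos hs ht)) hc ?_ hs
  exact ContinuousOn.mul (by fun_prop) (hc.pow 3)

theorem hasDerivAt_zonalPotentialDeriv (p : MvPolynomial (Fin 3) ℂ) (ξ : UnitSphere) {s : ℝ}
    (hs : |s| ≠ 1) : HasDerivAt (zonalPotentialDeriv p ξ)
      (∫ ω : UnitSphere, ((3 * (inner ℝ (ξ : E3) ω - s) ^ 2 * invDist s (inner ℝ (ξ : E3) ω) ^ 5
        - invDist s (inner ℝ (ξ : E3) ω) ^ 3 : ℝ) : ℂ) * polyFun p ω ∂sphereMeasure) s := by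
  have hc := continuousOn_invDist (U := {s : ℝ | |s| ≠ 1}) fun _ h => h
  refine hasDerivAt_integral_zonal ξ p isOpen_abs_ne_one
    (Φ := fun s t => (t - s) * invDist s t ^ 3)
    (Φ' := fun s t => 3 * (t - s) ^ 2 * invDist s t ^ 5 - invDist s t ^ 3) ?_ ?_ ?_ hs
  · intro s hs t ht
    refine (((hasDerivAt_id s).const_sub t).mul
      ((hasDerivAt_invDist_left (invDist_radicand_pos hs ht)).pow 3)).congr_deriv ?_
    simp
    ring
  · exact ContinuousOn.mul (by fun_prop) (hc.pow 3)
  · exact ContinuousOn.sub (ContinuousOn.mul (by fun_prop) (hc.pow 5)) (hc.pow 3)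

theorem continuous_zonal (ξ : UnitSphere) {F : ℝ → ℝ} (hF : ContinuousOn F (Set.Icc (-1 : ℝ) 1)) :
    Continuous fun ω : UnitSphere => F (inner ℝ (ξ : E3) ω) :=
  hF.comp_continuous (by fun_prop) fun ω => UnitSphere.inner_mem_Icc ξ ω

theorem continuousOn_invDist_right {s : ℝ} (hs : |s| ≠ 1) :
    ContinuousOn (fun t => invDist s t) (Set.Icc (-1 : ℝ) 1) := fun _ ht =>
  (hasDerivAt_invDist_right (invDist_radicand_pos hs ht)).continuousAt.continuousWithinAt

theorem integrable_zonal_mul (ξ : UnitSphere) (p : MvPolynomial (Fin 3) ℂ) {F : ℝ → ℝ}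
    (hF : ContinuousOn F (Set.Icc (-1 : ℝ) 1)) :
    Integrable (fun ω : UnitSphere => (F (inner ℝ (ξ : E3) ω) : ℂ) * polyFun p ω)
      sphereMeasure :=
  integrable_sphereMeasure ((Complex.continuous_ofReal.comp (continuous_zonal ξ hF)).mul
    ((continuous_polyFun p).comp continuous_subtype_val))

/-- Harmonicity of `s ξ ↦ 1 / |s ξ - ω|` says that `s² ∂ₛ² + 2 s ∂ₛ` acts on the kernel as minus
Legendre's operator in `t`; `integral_zonal_laplacian` evaluates the latter. -/
theorem zonalPotential_radial_equation {n : ℕ} {p : MvPolynomial (Fin 3) ℂ}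
    (hp : p ∈ harmonicSubmodule n) (ξ : UnitSphere) {s : ℝ} (hs : |s| ≠ 1) :
    (s : ℂ) ^ 2 * (∫ ω : UnitSphere, ((3 * (inner ℝ (ξ : E3) ω - s) ^ 2
          * invDist s (inner ℝ (ξ : E3) ω) ^ 5
        - invDist s (inner ℝ (ξ : E3) ω) ^ 3 : ℝ) : ℂ) * polyFun p ω ∂sphereMeasure)
      + 2 * s * zonalPotentialDeriv p ξ s = n * (n + 1) * zonalPotential p ξ s := by
  have hc := continuousOn_invDist_right hs
  have key := integral_zonal_laplacian hp ξ (F := fun t => invDist s t)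
    (F' := fun t => s * invDist s t ^ 3) (F'' := fun t => 3 * s ^ 2 * invDist s t ^ 5)
    (fun t ht => hasDerivAt_invDist_right (invDist_radicand_pos hs ht))
    (fun t ht => by
      refine (((hasDerivAt_invDist_right (invDist_radicand_pos hs ht)).pow 3).const_mul
        s).congr_deriv ?_
      simp
      ring)
    (continuousOn_const.mul (hc.pow 5))
  have h1 : (n * (n + 1) : ℂ) * zonalPotential p ξ s
      = -(-(n * (n + 1)) * zonalPotential p ξ s) := by ring
  rw [h1]
  unfold zonalPotential zonalPotentialDeriv
  rw [← key, ← integral_const_mul, ← integral_const_mul, ← integral_neg, ← integral_add]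
  · refine integral_congr_ae (Filter.Eventually.of_forall fun ω => ?_)
    have hw := invDist_eq_pow_mul (invDist_radicand_pos hs (UnitSphere.inner_mem_Icc ξ ω))
    have hw' := congrArg (fun u : ℝ => (u : ℂ)) hw
    simp only at hw' ⊢
    push_cast at hw' ⊢
    generalize (invDist s (inner ℝ (ξ : E3) ω) : ℂ) = w at *
    generalize ((inner ℝ (ξ : E3) (ω : E3) : ℝ) : ℂ) = t at *
    generalize polyFun p ω = P
    linear_combination (-3 * s ^ 2 * w ^ 2 * P) * hw'
  · exact (integrable_zonal_mul ξ p (F := fun t => 3 * (t - s) ^ 2 * invDist s t ^ 5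
      - invDist s t ^ 3) (ContinuousOn.sub (ContinuousOn.mul (by fun_prop) (hc.pow 5))
        (hc.pow 3))).const_mul _
  · exact (integrable_zonal_mul ξ p (F := fun t => (t - s) * invDist s t ^ 3)
      (ContinuousOn.mul (by fun_prop) (hc.pow 3))).const_mul _

theorem exists_zonalPotential_eq {n : ℕ} {p : MvPolynomial (Fin 3) ℂ}
    (hp : p ∈ harmonicSubmodule n) (ξ : UnitSphere) :
    ∃ c : ℂ, ∀ s ∈ Set.Ioo (0 : ℝ) 1, zonalPotential p ξ s = (s : ℂ) ^ n * c
      ∧ s * zonalPotentialDeriv p ξ s = n * zonalPotential p ξ s := by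
  have habs : ∀ s ∈ Set.Ioo (-1 : ℝ) 1, |s| ≠ 1 := fun s hs => (abs_lt.2 hs).ne
  exact eq_pow_mul_of_radial_equation n
    (fun s hs => hasDerivAt_zonalPotential p ξ (habs s hs))
    (fun s hs => hasDerivAt_zonalPotentialDeriv p ξ (habs s hs))
    (fun s hs => zonalPotential_radial_equation hp ξ (habs s hs))

/-! ### The Poisson kernel and the interior potential -/

/-- The radial derivative of the potential expressed through the Poisson kernel. -/
theorem two_mul_zonalPotentialDeriv_add (p : MvPolynomial (Fin 3) ℂ) (ξ : UnitSphere) {s : ℝ}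
    (hs : |s| ≠ 1) :
    2 * (s * zonalPotentialDeriv p ξ s) + zonalPotential p ξ s
      = ∫ ω : UnitSphere, (((1 - s ^ 2) * invDist s (inner ℝ (ξ : E3) ω) ^ 3 : ℝ) : ℂ)
        * polyFun p ω ∂sphereMeasure := by
  have hc := continuousOn_invDist_right hs
  unfold zonalPotential zonalPotentialDeriv
  rw [← integral_const_mul, ← integral_const_mul, ← integral_add]
  · refine integral_congr_ae (Filter.Eventually.of_forall fun ω => ?_)
    have hw := invDist_eq_pow_mul (invDist_radicand_pos hs (UnitSphere.inner_mem_Icc ξ ω))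
    have hw' := congrArg (fun u : ℝ => (u : ℂ)) hw
    simp only at hw' ⊢
    push_cast at hw' ⊢
    generalize (invDist s (inner ℝ (ξ : E3) ω) : ℂ) = w at *
    generalize ((inner ℝ (ξ : E3) (ω : E3) : ℝ) : ℂ) = t at *
    generalize polyFun p ω = P
    linear_combination P * hw'
  · exact ((integrable_zonal_mul ξ p (F := fun t => (t - s) * invDist s t ^ 3)
      (ContinuousOn.mul (by fun_prop) (hc.pow 3))).const_mul _).const_mul _
  · exact integrable_zonal_mul ξ p hc

theorem one_mem_harmonicSubmodule : (1 : MvPolynomial (Fin 3) ℂ) ∈ harmonicSubmodule 0 :=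
  ⟨MvPolynomial.isHomogeneous_one _ _, by simp⟩

theorem polyFun_one (y : E3) : polyFun 1 y = 1 := map_one _

/-- Newton's theorem: degree `0` makes the potential constant on `(0, 1)`, and by continuity the
constant is the value at the centre, where the kernel is `1`. -/
theorem zonalPotential_one (ξ : UnitSphere) {s : ℝ} (hs : s ∈ Set.Ioo (0 : ℝ) 1) :
    zonalPotential 1 ξ s = 4 * Real.pi := by
  obtain ⟨c, hc⟩ := exists_zonalPotential_eq one_mem_harmonicSubmodule ξ
  have h0 : zonalPotential 1 ξ 0 = 4 * Real.pi := by
    simp [zonalPotential, invDist, polyFun_one, -Measure.toSphere_real_apply_univ,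
      sphereMeasure_real_univ]
  have h1 : Filter.Tendsto (zonalPotential 1 ξ) (nhdsWithin 0 (Set.Ioi 0))
      (nhds (zonalPotential 1 ξ 0)) :=
    (hasDerivAt_zonalPotential 1 ξ (by simp)).continuousAt.tendsto.mono_left nhdsWithin_le_nhds
  have h2 : Filter.Tendsto (zonalPotential 1 ξ) (nhdsWithin 0 (Set.Ioi 0)) (nhds c) := by
    refine tendsto_const_nhds.congr' ?_
    filter_upwards [Ioo_mem_nhdsGT (zero_lt_one (α := ℝ))] with u hu
    simp [(hc u hu).1]
  rw [(hc s hs).1, pow_zero, one_mul, ← h0]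
  exact tendsto_nhds_unique h2 h1

theorem integral_invDist (ξ : UnitSphere) {s : ℝ} (hs : s ∈ Set.Ioo (0 : ℝ) 1) :
    ∫ ω : UnitSphere, invDist s (inner ℝ (ξ : E3) ω) ∂sphereMeasure = 4 * Real.pi := by
  have h := zonalPotential_one ξ hs
  simp only [zonalPotential, polyFun_one, mul_one, integral_complex_ofReal] at h
  exact_mod_cast h

theorem integral_poisson (ξ : UnitSphere) {s : ℝ} (hs : s ∈ Set.Ioo (0 : ℝ) 1) :
    (1 - s ^ 2) * ∫ ω : UnitSphere, invDist s (inner ℝ (ξ : E3) ω) ^ 3 ∂sphereMeasure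
      = 4 * Real.pi := by
  have habs : |s| ≠ 1 := by rw [abs_of_pos hs.1]; exact hs.2.ne
  obtain ⟨c, hc⟩ := exists_zonalPotential_eq one_mem_harmonicSubmodule ξ
  have h := two_mul_zonalPotentialDeriv_add 1 ξ habs
  rw [(hc s hs).2, zonalPotential_one ξ hs] at h
  simp only [polyFun_one, mul_one, integral_complex_ofReal, integral_const_mul] at h
  simp only [Nat.cast_zero, zero_mul, mul_zero, zero_add] at h
  exact_mod_cast h.symm

theorem exists_lipschitz_polyFun (p : MvPolynomial (Fin 3) ℂ) :
    ∃ C : ℝ, 0 ≤ C ∧ ∀ ξ ω : UnitSphere,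
      ‖polyFun p ω - polyFun p ξ‖ ≤ C * ‖(ω : E3) - ξ‖ := by
  obtain ⟨C, hC⟩ := (isCompact_closedBall (0 : E3) 1).exists_bound_of_continuousOn
    (continuous_polyDeriv p).continuousOn
  refine ⟨C, (norm_nonneg _).trans (hC 0 (by simp)), fun ξ ω => ?_⟩
  exact (convex_closedBall (0 : E3) 1).norm_image_sub_le_of_norm_hasFDerivWithin_le
    (fun y _ => (hasFDerivAt_polyFun p y).hasFDerivWithinAt) hC
    (Metric.sphere_subset_closedBall ξ.2) (Metric.sphere_subset_closedBall ω.2)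

theorem UnitSphere.norm_sub_sq (ξ ω : UnitSphere) :
    ‖(ω : E3) - ξ‖ ^ 2 = 2 - 2 * inner ℝ (ξ : E3) ω := by
  rw [norm_sub_sq_real, ξ.norm_coe, ω.norm_coe, real_inner_comm]
  ring

/-- By the triangle inequality `|ω - ξ| ≤ |ω - s ξ| + (1 - s)`, and `1 - s ≤ |ω - s ξ|`. -/
theorem norm_sub_mul_invDist_le (ξ ω : UnitSphere) {s : ℝ} (hs : s ∈ Set.Ioo (0 : ℝ) 1) :
    ‖(ω : E3) - ξ‖ * invDist s (inner ℝ (ξ : E3) ω) ≤ 2 := by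
  have ht := UnitSphere.inner_mem_Icc ξ ω
  have hq := invDist_radicand_pos (by rw [abs_of_pos hs.1]; exact hs.2.ne) ht
  rw [invDist, ← div_eq_mul_inv, div_le_iff₀ (Real.sqrt_pos.2 hq)]
  refine abs_le_of_sq_le_sq' ?_ (by positivity) |>.2
  rw [ξ.norm_sub_sq, mul_pow, Real.sq_sqrt hq.le]
  nlinarith [mul_nonneg (sub_nonneg.2 ht.2) hs.1.le, mul_nonneg hs.1.le (sub_nonneg.2 hs.2.le),
    ht.1, ht.2, hs.1, hs.2, sq_nonneg (1 - s)]

/-- The Poisson kernel is an approximate identity. The Lipschitz bound on `p` cancels one power of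
the kernel, and the remaining square is interpolated between the first and third powers, whose
integrals are known exactly; no splitting of the sphere is needed. -/
theorem norm_poisson_sub_le (p : MvPolynomial (Fin 3) ℂ) (ξ : UnitSphere) :
    ∃ C : ℝ, ∀ s ∈ Set.Ioo (0 : ℝ) 1,
      ‖(∫ ω : UnitSphere, (((1 - s ^ 2) * invDist s (inner ℝ (ξ : E3) ω) ^ 3 : ℝ) : ℂ)
        * polyFun p ω ∂sphereMeasure) - 4 * Real.pi * polyFun p ξ‖ ≤ C * √(1 - s ^ 2) := by
  obtain ⟨C, hC0, hC⟩ := exists_lipschitz_polyFun p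
  refine ⟨C * (8 * Real.pi), fun s hs => ?_⟩
  have habs : |s| ≠ 1 := by rw [abs_of_pos hs.1]; exact hs.2.ne
  have hc := continuousOn_invDist_right habs
  have hb0 : 0 ≤ 1 - s ^ 2 := by nlinarith [hs.1, hs.2]
  set b := √(1 - s ^ 2) with hb
  have hbsq : b ^ 2 = 1 - s ^ 2 := Real.sq_sqrt hb0
  have h1 : (4 * Real.pi * polyFun p ξ : ℂ)
      = ∫ ω : UnitSphere, (((1 - s ^ 2) * invDist s (inner ℝ (ξ : E3) ω) ^ 3 : ℝ) : ℂ)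
        * polyFun p ξ ∂sphereMeasure := by
    rw [integral_mul_const, integral_complex_ofReal, integral_const_mul, integral_poisson ξ hs]
    push_cast
    ring
  have hcw := continuous_zonal ξ (F := fun t => (1 - s ^ 2) * invDist s t ^ 3)
    (continuousOn_const.mul (hc.pow 3))
  have i1 : Integrable (fun ω : UnitSphere => b * invDist s (inner ℝ (ξ : E3) ω)) sphereMeasure :=
    integrable_sphereMeasure (continuous_const.mul (continuous_zonal ξ hc))
  have i3 : Integrable (fun ω : UnitSphere => b * ((1 - s ^ 2)
      * invDist s (inner ℝ (ξ : E3) ω) ^ 3)) sphereMeasure :=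
    integrable_sphereMeasure (continuous_const.mul hcw)
  have i2 : Integrable (fun ω : UnitSphere => (((1 - s ^ 2)
      * invDist s (inner ℝ (ξ : E3) ω) ^ 3 : ℝ) : ℂ) * polyFun p ξ) sphereMeasure :=
    integrable_sphereMeasure ((Complex.continuous_ofReal.comp hcw).mul continuous_const)
  rw [h1, ← integral_sub (integrable_zonal_mul ξ p (F := fun t => (1 - s ^ 2) * invDist s t ^ 3)
    (continuousOn_const.mul (hc.pow 3)))
    i2]
  calc _ ≤ ∫ ω : UnitSphere, C * (b * invDist s (inner ℝ (ξ : E3) ω) + b * ((1 - s ^ 2)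
          * invDist s (inner ℝ (ξ : E3) ω) ^ 3)) ∂sphereMeasure := by
        refine norm_integral_le_of_norm_le ((i1.add i3).const_mul C)
          (Filter.Eventually.of_forall fun ω => ?_)
        have h2 := hC ξ ω
        have h3 := norm_sub_mul_invDist_le ξ ω hs
        have hw := invDist_nonneg s (inner ℝ (ξ : E3) ω)
        have hbn : 0 ≤ b := Real.sqrt_nonneg _
        rw [← mul_sub, norm_mul, Complex.norm_real, ← hbsq]
        generalize invDist s (inner ℝ (ξ : E3) ω) = w at *
        rw [Real.norm_of_nonneg (by positivity)]
        calc b ^ 2 * w ^ 3 * ‖polyFun p ω - polyFun p ξ‖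
            ≤ b ^ 2 * w ^ 3 * (C * ‖(ω : E3) - ξ‖) := by gcongr
          _ = C * (b ^ 2 * w ^ 2 * (‖(ω : E3) - ξ‖ * w)) := by ring
          _ ≤ C * (b ^ 2 * w ^ 2 * 2) := by gcongr
          -- This is `2 v² ≤ v + v³` for `v = b w`, that is, `v (1 - v)² ≥ 0`.
          _ ≤ C * (b * w + b * (b ^ 2 * w ^ 3)) := by
            gcongr
            nlinarith [mul_nonneg (mul_nonneg hbn hw) (sq_nonneg (1 - b * w))]
    _ = C * (8 * Real.pi) * b := by
        rw [integral_const_mul, integral_add i1 i3, integral_const_mul, integral_const_mul,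
          integral_const_mul, integral_poisson ξ hs, integral_invDist ξ hs]
        ring

/-- For `u = c sⁿ` the Poisson integral `2 s u' + u` is `(2 n + 1) c sⁿ`; its two limits as `s → 1`
determine `c`. -/
theorem zonalPotential_eq_interior {n : ℕ} {p : MvPolynomial (Fin 3) ℂ}
    (hp : p ∈ harmonicSubmodule n) (ξ : UnitSphere) {s : ℝ} (hs : s ∈ Set.Ioo (0 : ℝ) 1) :
    zonalPotential p ξ s = (s : ℂ) ^ n * (4 * Real.pi / (2 * n + 1) * polyFun p ξ) := by
  obtain ⟨c, hc⟩ := exists_zonalPotential_eq hp ξ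
  obtain ⟨C, hC⟩ := norm_poisson_sub_le p ξ
  have hlim1 : Filter.Tendsto (fun s : ℝ => (2 * n + 1) * ((s : ℂ) ^ n * c))
      (nhdsWithin 1 (Set.Iio 1)) (nhds ((2 * n + 1) * (((1 : ℝ) : ℂ) ^ n * c))) := by
    have : Continuous fun s : ℝ => (2 * n + 1) * ((s : ℂ) ^ n * c) := by fun_prop
    exact (this.tendsto 1).mono_left nhdsWithin_le_nhds
  have hlim2 : Filter.Tendsto (fun s : ℝ => (2 * n + 1) * ((s : ℂ) ^ n * c))
      (nhdsWithin 1 (Set.Iio 1)) (nhds (4 * Real.pi * polyFun p ξ)) := by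
    rw [tendsto_iff_norm_sub_tendsto_zero]
    have h0 : Filter.Tendsto (fun s : ℝ => C * √(1 - s ^ 2)) (nhdsWithin 1 (Set.Iio 1))
        (nhds 0) := by
      have h : Continuous fun s : ℝ => C * √(1 - s ^ 2) := by fun_prop
      simpa using (h.tendsto 1).mono_left (nhdsWithin_le_nhds (s := Set.Iio 1))
    refine squeeze_zero' (Filter.Eventually.of_forall fun _ => norm_nonneg _) ?_ h0
    filter_upwards [Ioo_mem_nhdsLT (zero_lt_one (α := ℝ))] with u hu
    have habs : |u| ≠ 1 := by rw [abs_of_pos hu.1]; exact hu.2.ne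
    have h := hC u hu
    rw [← two_mul_zonalPotentialDeriv_add p ξ habs, (hc u hu).2, (hc u hu).1] at h
    have e : (2 * n + 1) * ((u : ℂ) ^ n * c) = 2 * (n * ((u : ℂ) ^ n * c)) + (u : ℂ) ^ n * c := by
      ring
    rw [e]
    exact h
  have h := tendsto_nhds_unique hlim1 hlim2
  have hn : (2 * n + 1 : ℂ) ≠ 0 := by exact_mod_cast (2 * n).succ_ne_zero
  rw [(hc s hs).1]
  congr 1
  simp only [Complex.ofReal_one, one_pow, one_mul] at h
  field_simp
  linear_combination h

theorem zonalPotentialDeriv_eq_interior {n : ℕ} {p : MvPolynomial (Fin 3) ℂ}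
    (hp : p ∈ harmonicSubmodule n) (ξ : UnitSphere) {s : ℝ} (hs : s ∈ Set.Ioo (0 : ℝ) 1) :
    s * zonalPotentialDeriv p ξ s
      = n * (s : ℂ) ^ n * (4 * Real.pi / (2 * n + 1) * polyFun p ξ) := by
  obtain ⟨c, hc⟩ := exists_zonalPotential_eq hp ξ
  rw [(hc s hs).2, zonalPotential_eq_interior hp ξ hs]
  ring

/-! ### Exterior and boundary values of the potential -/

/-- The Kelvin transform, `|s ξ - ω| = s |s⁻¹ ξ - ω|`; it reduces the exterior to the interior. -/
theorem invDist_inv {s : ℝ} (hs : 0 < s) (t : ℝ) : invDist s t = s⁻¹ * invDist s⁻¹ t := by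
  unfold invDist
  rw [← mul_inv]
  congr 1
  have h : 1 + s ^ 2 - 2 * s * t = s ^ 2 * (1 + s⁻¹ ^ 2 - 2 * s⁻¹ * t) := by
    field_simp
    ring
  rw [h, Real.sqrt_mul (by positivity), Real.sqrt_sq hs.le]

theorem zonalPotential_eq_exterior {n : ℕ} {p : MvPolynomial (Fin 3) ℂ}
    (hp : p ∈ harmonicSubmodule n) (ξ : UnitSphere) {s : ℝ} (hs : 1 < s) :
    zonalPotential p ξ s = ((s : ℂ) ^ (n + 1))⁻¹ * (4 * Real.pi / (2 * n + 1) * polyFun p ξ) := by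
  have hs0 : 0 < s := zero_lt_one.trans hs
  have h : zonalPotential p ξ s = (s : ℂ)⁻¹ * zonalPotential p ξ s⁻¹ := by
    unfold zonalPotential
    rw [← integral_const_mul]
    refine integral_congr_ae (Filter.Eventually.of_forall fun ω => ?_)
    simp only [invDist_inv hs0]
    push_cast
    ring
  rw [h, zonalPotential_eq_interior hp ξ ⟨inv_pos.2 hs0, inv_lt_one_of_one_lt₀ hs⟩]
  push_cast
  rw [pow_succ, mul_inv, inv_pow]
  ring

theorem zonalPotentialDeriv_eq_exterior {n : ℕ} {p : MvPolynomial (Fin 3) ℂ}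
    (hp : p ∈ harmonicSubmodule n) (ξ : UnitSphere) {s : ℝ} (hs : 1 < s) :
    zonalPotentialDeriv p ξ s
      = -(n + 1) * ((s : ℂ) ^ (n + 2))⁻¹ * (4 * Real.pi / (2 * n + 1) * polyFun p ξ) := by
  have hs0 : 0 < s := zero_lt_one.trans hs
  have hsC : (s : ℂ) ≠ 0 := by exact_mod_cast hs0.ne'
  have h1 := hasDerivAt_zonalPotential p ξ (s := s) (by rw [abs_of_pos hs0]; exact hs.ne')
  have hid : HasDerivAt (fun s : ℝ => (s : ℂ)) 1 s := (hasDerivAt_id s).ofReal_comp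
  have h2 : HasDerivAt (fun s : ℝ => ((s : ℂ) ^ (n + 1))⁻¹
      * (4 * Real.pi / (2 * n + 1) * polyFun p ξ)) _ s :=
    ((hid.pow (n + 1)).inv (pow_ne_zero _ hsC)).mul_const _
  have h3 := h1.unique (h2.congr_of_eventuallyEq (by
    filter_upwards [lt_mem_nhds hs] with u hu
    exact zonalPotential_eq_exterior hp ξ hu))
  rw [h3]
  simp only [Pi.pow_apply, Nat.add_sub_cancel]
  push_cast
  field_simp
  ring

/-- The kernel has integral `4 π` and equals `1 / (1 - s)` at `ω = ξ`, so the point has mass at most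
`4 π (1 - s)`. -/
theorem sphereMeasure_singleton (ξ : UnitSphere) : sphereMeasure {ξ} = 0 := by
  have h : ∀ s ∈ Set.Ioo (0 : ℝ) 1, sphereMeasure.real {ξ} ≤ 4 * Real.pi * (1 - s) := by
    intro s hs
    have habs : |s| ≠ 1 := by rw [abs_of_pos hs.1]; exact hs.2.ne
    have hpos : 0 < 1 - s := sub_pos.2 hs.2
    have hw : invDist s (inner ℝ (ξ : E3) ξ) = (1 - s)⁻¹ := by
      rw [invDist, real_inner_self_eq_norm_sq, ξ.norm_coe]
      have : 1 + s ^ 2 - 2 * s * 1 ^ 2 = (1 - s) ^ 2 := by ring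
      rw [this, Real.sqrt_sq hpos.le]
    have h1 : ∫ ω in {ξ}, invDist s (inner ℝ (ξ : E3) ω) ∂sphereMeasure ≤ 4 * Real.pi := by
      rw [← integral_invDist ξ hs]
      exact setIntegral_le_integral
        (integrable_sphereMeasure (continuous_zonal ξ (continuousOn_invDist_right habs)))
        (Filter.Eventually.of_forall fun ω => invDist_nonneg _ _)
    rw [integral_singleton, hw, smul_eq_mul, ← div_eq_mul_inv, div_le_iff₀ hpos] at h1
    exact h1
  have hlim : Filter.Tendsto (fun s : ℝ => 4 * Real.pi * (1 - s)) (nhdsWithin 1 (Set.Iio 1))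
      (nhds 0) := by
    have hc : Continuous fun s : ℝ => 4 * Real.pi * (1 - s) := by fun_prop
    simpa using (hc.tendsto 1).mono_left (nhdsWithin_le_nhds (s := Set.Iio 1))
  have h0 : sphereMeasure.real {ξ} ≤ 0 := by
    refine ge_of_tendsto hlim ?_
    filter_upwards [Ioo_mem_nhdsLT (zero_lt_one (α := ℝ))] with u hu using h u hu
  rw [← measureReal_eq_zero_iff]
  exact le_antisymm h0 measureReal_nonneg


theorem ae_inner_lt_one (ξ : UnitSphere) :
    ∀ᵐ ω : UnitSphere ∂sphereMeasure, inner ℝ (ξ : E3) ω < 1 := by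
  have h : ∀ᵐ ω : UnitSphere ∂sphereMeasure, ω ≠ ξ := by
    rw [ae_iff]
    simpa using sphereMeasure_singleton ξ
  filter_upwards [h] with ω hω
  refine lt_of_le_of_ne (UnitSphere.inner_mem_Icc ξ ω).2 fun h1 => hω ?_
  exact Subtype.ext ((inner_eq_one_iff_of_norm_eq_one ξ.norm_coe ω.norm_coe).1 h1).symm

theorem tendsto_invDist_one {u : ℕ → ℝ} (hu : Filter.Tendsto u Filter.atTop (nhds 1)) {t : ℝ}
    (ht : t < 1) :
    Filter.Tendsto (fun k => invDist (u k) t) Filter.atTop (nhds (invDist 1 t)) :=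
  (hasDerivAt_invDist_left (s := 1) (t := t) (by linarith)).continuousAt.tendsto.comp hu

theorem exists_seq_tendsto_one :
    ∃ u : ℕ → ℝ, (∀ k, u k ∈ Set.Ioo (0 : ℝ) 1) ∧ Filter.Tendsto u Filter.atTop (nhds 1) := by
  obtain ⟨u, -, hu, hlim⟩ := exists_seq_strictMono_tendsto' (zero_lt_one (α := ℝ))
  exact ⟨u, hu, hlim⟩

/-- Fatou's lemma as `s → 1`, the integrals for `s < 1` all being `4 π`. -/
theorem integrable_invDist_one (ξ : UnitSphere) :
    Integrable (fun ω : UnitSphere => invDist 1 (inner ℝ (ξ : E3) ω)) sphereMeasure := by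
  obtain ⟨u, hu, hlim⟩ := exists_seq_tendsto_one
  have habs : ∀ k, |u k| ≠ 1 := fun k => by rw [abs_of_pos (hu k).1]; exact (hu k).2.ne
  have hcont : ∀ k, Continuous fun ω : UnitSphere => invDist (u k) (inner ℝ (ξ : E3) ω) :=
    fun k => continuous_zonal ξ (continuousOn_invDist_right (habs k))
  have hae : ∀ᵐ ω : UnitSphere ∂sphereMeasure, Filter.Tendsto
      (fun k => invDist (u k) (inner ℝ (ξ : E3) ω)) Filter.atTop
      (nhds (invDist 1 (inner ℝ (ξ : E3) ω))) := by
    filter_upwards [ae_inner_lt_one ξ] with ω hω using tendsto_invDist_one hlim hω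
  refine ⟨aestronglyMeasurable_of_tendsto_ae _ (fun k => (hcont k).aestronglyMeasurable) hae, ?_⟩
  refine lt_of_le_of_lt (b := Filter.liminf (fun k => ∫⁻ ω : UnitSphere,
    ‖invDist (u k) (inner ℝ (ξ : E3) ω)‖ₑ ∂sphereMeasure) Filter.atTop) ?_ ?_
  · refine le_trans (le_of_eq (lintegral_congr_ae ?_))
      (lintegral_liminf_le' fun k => (hcont k).aestronglyMeasurable.aemeasurable.enorm)
    filter_upwards [hae] with ω hω using hω.enorm.liminf_eq.symm
  have h : ∀ k, ∫⁻ ω : UnitSphere, ‖invDist (u k) (inner ℝ (ξ : E3) ω)‖ₑ ∂sphereMeasure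
      = ENNReal.ofReal (4 * Real.pi) := by
    intro k
    rw [← integral_invDist ξ (hu k), ofReal_integral_eq_lintegral_ofReal
      (integrable_sphereMeasure (hcont k))
      (Filter.Eventually.of_forall fun ω => invDist_nonneg _ _)]
    exact lintegral_congr fun ω => Real.enorm_eq_ofReal (invDist_nonneg _ _)
  simp only [h, Filter.liminf_const]
  exact ENNReal.ofReal_lt_top

/-- The majorant for the limit `s → 1`; geometrically `|ξ - ω| ≤ 2 |s ξ - ω|`. At `t = 1` it fails,
`invDist 1 1` being `0` by convention. -/
theorem invDist_le_two_mul {s t : ℝ} (hs : s ∈ Set.Ioo (0 : ℝ) 1) (ht : t ∈ Set.Ico (-1 : ℝ) 1) :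
    invDist s t ≤ 2 * invDist 1 t := by
  have hq := invDist_radicand_pos (s := s) (by rw [abs_of_pos hs.1]; exact hs.2.ne)
    ⟨ht.1, ht.2.le⟩
  have hq1 : 0 < 1 + (1 : ℝ) ^ 2 - 2 * 1 * t := by linarith [ht.2]
  unfold invDist
  rw [← div_eq_mul_inv, inv_le_comm₀ (Real.sqrt_pos.2 hq) (by positivity), inv_div,
    div_le_iff₀ two_pos]
  refine Real.sqrt_le_iff.2 ⟨by positivity, ?_⟩
  rw [mul_pow, Real.sq_sqrt hq.le]
  nlinarith [mul_nonneg (sub_nonneg.2 ht.2.le) hs.1.le, mul_nonneg hs.1.le (sub_nonneg.2 hs.2.le),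
    ht.1, ht.2, hs.1, hs.2, sq_nonneg (1 - s)]

theorem zonalPotential_eq_boundary {n : ℕ} {p : MvPolynomial (Fin 3) ℂ}
    (hp : p ∈ harmonicSubmodule n) (ξ : UnitSphere) :
    zonalPotential p ξ 1 = 4 * Real.pi / (2 * n + 1) * polyFun p ξ := by
  obtain ⟨u, hu, hlim⟩ := exists_seq_tendsto_one
  have habs : ∀ k, |u k| ≠ 1 := fun k => by rw [abs_of_pos (hu k).1]; exact (hu k).2.ne
  have cp : Continuous fun ω : UnitSphere => polyFun p ω :=
    (continuous_polyFun p).comp continuous_subtype_val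
  obtain ⟨M, hM⟩ := isCompact_univ.exists_bound_of_continuousOn cp.continuousOn
  have h1 : Filter.Tendsto (fun k => zonalPotential p ξ (u k)) Filter.atTop
      (nhds (zonalPotential p ξ 1)) := by
    refine tendsto_integral_of_dominated_convergence
      (fun ω : UnitSphere => 2 * invDist 1 (inner ℝ (ξ : E3) ω) * M)
      (fun k => (integrable_zonal_mul ξ p (continuousOn_invDist_right (habs k))).1)
      (((integrable_invDist_one ξ).const_mul 2).mul_const M) (fun k => ?_) ?_
    · filter_upwards [ae_inner_lt_one ξ] with ω hω
      rw [norm_mul, Complex.norm_real, Real.norm_of_nonneg (invDist_nonneg _ _)]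
      exact mul_le_mul (invDist_le_two_mul (hu k) ⟨(UnitSphere.inner_mem_Icc ξ ω).1, hω⟩)
        (hM ω (Set.mem_univ _)) (norm_nonneg _)
        (mul_nonneg zero_le_two (invDist_nonneg _ _))
    · filter_upwards [ae_inner_lt_one ξ] with ω hω
      exact ((Complex.continuous_ofReal.tendsto _).comp (tendsto_invDist_one hlim hω)).mul_const _
  have h2 : Filter.Tendsto (fun k => zonalPotential p ξ (u k)) Filter.atTop
      (nhds (((1 : ℝ) : ℂ) ^ n * (4 * Real.pi / (2 * n + 1) * polyFun p ξ))) := by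
    simp only [zonalPotential_eq_interior hp ξ (hu _)]
    exact (((Complex.continuous_ofReal.tendsto _).comp hlim).pow n).mul_const _
  rw [tendsto_nhds_unique h1 h2]
  simp

/-! ### Spheres of arbitrary radius -/

theorem measurableEmbedding_smul_sphere {r : ℝ} (hr : 0 < r) :
    MeasurableEmbedding fun ω : UnitSphere => r • (ω : E3) :=
  ((Homeomorph.smulOfNeZero r hr.ne').measurableEmbedding).comp
    (MeasurableEmbedding.subtype_coe Metric.isClosed_sphere.measurableSet)

theorem integral_surfaceMeasure {r : ℝ} (hr : 0 < r) (g : E3 → ℂ) :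
    ∫ y, g y ∂surfaceMeasure r
      = (r : ℂ) ^ 2 * ∫ ω : UnitSphere, g (r • (ω : E3)) ∂sphereMeasure := by
  rw [surfaceMeasure, integral_smul_measure, (measurableEmbedding_smul_sphere hr).integral_map,
    ENNReal.toReal_ofReal (by positivity), Complex.real_smul]
  push_cast
  rfl

theorem lintegral_surfaceMeasure {r : ℝ} (hr : 0 < r) (g : E3 → ENNReal) :
    ∫⁻ y, g y ∂surfaceMeasure r
      = ENNReal.ofReal (r ^ 2) * ∫⁻ ω : UnitSphere, g (r • (ω : E3)) ∂sphereMeasure := by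
  rw [surfaceMeasure, lintegral_smul_measure, (measurableEmbedding_smul_sphere hr).lintegral_map,
    smul_eq_mul]

theorem ae_surfaceMeasure_iff {r : ℝ} (hr : 0 < r) {P : E3 → Prop} :
    (∀ᵐ y ∂surfaceMeasure r, P y) ↔ ∀ᵐ ω : UnitSphere ∂sphereMeasure, P (r • (ω : E3)) := by
  rw [surfaceMeasure, Measure.ae_ennreal_smul_measure_eq (by simpa using hr.ne'),
    (measurableEmbedding_smul_sphere hr).ae_map_iff]

theorem ae_norm_eq {r : ℝ} (hr : 0 < r) : ∀ᵐ y ∂surfaceMeasure r, ‖y‖ = r := by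
  rw [ae_surfaceMeasure_iff hr]
  refine Filter.Eventually.of_forall fun ω => ?_
  rw [norm_smul, ω.norm_coe, mul_one, Real.norm_of_nonneg hr.le]

theorem unitVec_smul {r : ℝ} (hr : 0 < r) (ω : UnitSphere) : unitVec (r • (ω : E3)) = ω := by
  rw [unitVec, norm_smul, ω.norm_coe, mul_one, Real.norm_of_nonneg hr.le, smul_smul,
    inv_mul_cancel₀ hr.ne', one_smul]

theorem angular_smul {r : ℝ} (hr : 0 < r) (p : MvPolynomial (Fin 3) ℂ) (ω : UnitSphere) :
    angular p (r • (ω : E3)) = polyFun p ω := by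
  rw [angular, unitVec_smul hr, polyFun]

theorem exists_eq_smul_unitSphere {r : ℝ} (hr : 0 < r) {x : E3} (hx : ‖x‖ = r) :
    ∃ ξ : UnitSphere, x = r • (ξ : E3) := by
  refine ⟨⟨r⁻¹ • x, ?_⟩, ?_⟩
  · rw [mem_sphere_zero_iff_norm, norm_smul, hx, norm_inv, Real.norm_of_nonneg hr.le,
      inv_mul_cancel₀ hr.ne']
  · rw [smul_smul, mul_inv_cancel₀ hr.ne', one_smul]

/-! ### The Neumann–Poincaré kernel and its action on harmonics -/

theorem hasFDerivAt_fundSol {z : E3} (hz : z ≠ 0) :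
    HasFDerivAt fundSol ((4 * Real.pi * ‖z‖ ^ 3)⁻¹ • innerSL ℝ z) z := by
  have hz' : 0 < ‖z‖ := norm_pos_iff.2 hz
  have h1 : HasFDerivAt (fun x : E3 => ‖x‖ ^ 2) (2 • innerSL ℝ z) z :=
    (hasStrictFDerivAt_norm_sq z).hasFDerivAt
  have h2 : HasDerivAt (fun q : ℝ => -((4 * Real.pi)⁻¹ * (√q)⁻¹))
      (-((4 * Real.pi)⁻¹ * (-(1 / 2) * (√(‖z‖ ^ 2))⁻¹ ^ 3))) (‖z‖ ^ 2) :=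
    (((hasDerivAt_id (‖z‖ ^ 2)).inv_sqrt (pow_pos hz' 2)).const_mul _).neg
  have h3 := h2.comp_hasFDerivAt z h1
  have h4 : fundSol = (fun q : ℝ => -((4 * Real.pi)⁻¹ * (√q)⁻¹)) ∘ fun x : E3 => ‖x‖ ^ 2 := by
    funext x
    simp only [fundSol, Function.comp, Real.sqrt_sq (norm_nonneg x), one_div, mul_inv]
  rw [h4]
  refine h3.congr_fderiv ?_
  ext v
  rw [Real.sqrt_sq hz'.le]
  simp
  ring

/-- At the origin `fundSol` has the default value `0` but is unbounded nearby. Hence `fderiv` is `0`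
there and the formula for the kernel holds on the diagonal too. -/
theorem not_differentiableAt_fundSol_zero : ¬DifferentiableAt ℝ fundSol 0 := by
  intro h
  have hc := h.continuousAt
  rw [Metric.continuousAt_iff] at hc
  obtain ⟨δ, hδ, hc⟩ := hc 1 one_pos
  have hπ := Real.pi_pos
  set e : E3 := EuclideanSpace.single 0 (1 : ℝ)
  have he : ‖e‖ = 1 := by simp [e]
  -- The second bound forces `|fundSol (a • e)| ≥ 1`, the first keeps `a • e` within `δ` of the
  -- origin.
  set a := min (δ / 2) (4 * Real.pi)⁻¹
  have ha : 0 < a := lt_min (by positivity) (by positivity)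
  have hn : ‖a • e‖ = a := by rw [norm_smul, he, mul_one, Real.norm_of_nonneg ha.le]
  have h1 := hc (x := a • e) (by
    rw [dist_zero_right, hn]
    exact (min_le_left _ _).trans_lt (by linarith))
  have h2 : fundSol 0 = 0 := by simp [fundSol]
  rw [h2, dist_zero_right, fundSol, hn, norm_neg, Real.norm_of_nonneg (by positivity),
    div_lt_one (by positivity)] at h1
  have h3 : 4 * Real.pi * a ≤ 4 * Real.pi * (4 * Real.pi)⁻¹ := by
    gcongr
    exact min_le_right _ _
  rw [mul_inv_cancel₀ (by positivity)] at h3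
  linarith

theorem fderiv_fundSol (z : E3) :
    fderiv ℝ fundSol z = (4 * Real.pi * ‖z‖ ^ 3)⁻¹ • innerSL ℝ z := by
  rcases eq_or_ne z 0 with rfl | hz
  · rw [fderiv_zero_of_not_differentiableAt not_differentiableAt_fundSol_zero]
    simp
  · exact (hasFDerivAt_fundSol hz).fderiv

theorem norm_fderiv_fundSol_le {z : E3} {d : ℝ} (hd : 0 < d) (hz : d ≤ ‖z‖) :
    ‖fderiv ℝ fundSol z‖ ≤ (4 * Real.pi * d ^ 2)⁻¹ := by
  have hz' : 0 < ‖z‖ := hd.trans_le hz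
  have hπ := Real.pi_pos
  rw [fderiv_fundSol, norm_smul, innerSL_apply_norm, Real.norm_of_nonneg (by positivity)]
  have : (4 * Real.pi * ‖z‖ ^ 3)⁻¹ * ‖z‖ = (4 * Real.pi * ‖z‖ ^ 2)⁻¹ := by
    field_simp
  rw [this]
  gcongr

/-- The normal derivative, at `x`, of the fundamental solution with pole `y`. -/
def npKernel (x y : E3) : ℝ := fderiv ℝ fundSol (x - y) (unitVec x)

theorem measurable_npKernel : Measurable fun z : E3 × E3 => npKernel z.1 z.2 := by
  simp only [npKernel, fderiv_fundSol, smul_apply, innerSL_apply_apply]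
  have h : Measurable fun z : E3 × E3 => unitVec z.1 := measurable_unitVec.comp measurable_fst
  have h2 : Measurable fun z : E3 × E3 => z.1 - z.2 := by fun_prop
  exact (((h2.norm.pow_const 3).const_mul _).inv).smul (h2.inner h)

theorem norm_npKernel_le {x y : E3} {d : ℝ} (hd : 0 < d) (h : d ≤ ‖x - y‖) :
    ‖npKernel x y‖ ≤ (4 * Real.pi * d ^ 2)⁻¹ := by
  refine ((fderiv ℝ fundSol (x - y)).le_opNorm _).trans ?_
  refine (mul_le_mul (norm_fderiv_fundSol_le hd h) (norm_unitVec_le x) (norm_nonneg _)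
    (by positivity)).trans ?_
  rw [mul_one]

theorem norm_smul_sub_smul {r ρ : ℝ} (hr : 0 < r) (ξ ω : UnitSphere) :
    ‖ρ • (ξ : E3) - r • (ω : E3)‖⁻¹ = r⁻¹ * invDist (ρ / r) (inner ℝ (ξ : E3) ω) := by
  have h : ‖ρ • (ξ : E3) - r • (ω : E3)‖
      = r * √(1 + (ρ / r) ^ 2 - 2 * (ρ / r) * inner ℝ (ξ : E3) ω) := by
    rw [← Real.sqrt_sq (norm_nonneg _), norm_sub_sq_real, norm_smul, norm_smul, ξ.norm_coe,
      ω.norm_coe, inner_smul_left, inner_smul_right, mul_one, mul_one, Real.norm_eq_abs,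
      Real.norm_eq_abs, sq_abs, sq_abs]
    have h1 : ∀ a : ℝ, r * √a = √(r ^ 2 * a) := fun a => by
      rw [Real.sqrt_mul (sq_nonneg r), Real.sqrt_sq hr.le]
    rw [h1]
    congr 1
    simp only [conj_trivial]
    field_simp
    ring
  rw [h, mul_inv, invDist]

theorem npKernel_smul {r ρ : ℝ} (hr : 0 < r) (hρ : 0 < ρ) (ξ ω : UnitSphere) :
    npKernel (ρ • (ξ : E3)) (r • (ω : E3))
      = (4 * Real.pi * r ^ 2)⁻¹ * ((ρ / r - inner ℝ (ξ : E3) ω)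
        * invDist (ρ / r) (inner ℝ (ξ : E3) ω) ^ 3) := by
  rw [npKernel, fderiv_fundSol, unitVec_smul hρ, smul_apply, innerSL_apply_apply, inner_sub_left,
    inner_smul_left, inner_smul_left, real_inner_self_eq_norm_sq, ξ.norm_coe, mul_inv, ← inv_pow,
    norm_smul_sub_smul hr, real_inner_comm]
  simp only [conj_trivial, smul_eq_mul]
  field_simp

/-- For `|x| = |y| = r` one has `(x - y) · x̂ = |x - y|² / (2 r)`, so on a sphere the singularity
drops to that of the single layer kernel. The kernel is also symmetric and nonnegative there. -/
theorem npKernel_smul_self {r : ℝ} (hr : 0 < r) (ξ ω : UnitSphere) :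
    npKernel (r • (ξ : E3)) (r • (ω : E3))
      = (8 * Real.pi * r ^ 2)⁻¹ * invDist 1 (inner ℝ (ξ : E3) ω) := by
  rw [npKernel_smul hr hr, div_self hr.ne']
  rcases eq_or_lt_of_le (UnitSphere.inner_mem_Icc ξ ω).2 with h | h
  -- On the diagonal both sides are `0`, by the convention for the inverse of zero.
  · norm_num [h, invDist]
  · have h1 := invDist_eq_pow_mul (s := 1) (t := inner ℝ (ξ : E3) ω) (by linarith)
    have h2 : (8 * Real.pi * r ^ 2)⁻¹ = (4 * Real.pi * r ^ 2)⁻¹ / 2 := by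
      field_simp
      norm_num
    rw [h2]
    linear_combination (-(4 * Real.pi * r ^ 2)⁻¹ / 2) * h1

theorem neumannPoincareStar_eq (r : ℝ) (φ : E3 → ℂ) (x : E3) :
    neumannPoincareStar r φ x = ∫ y, npKernel x y • φ y ∂surfaceMeasure r := rfl

theorem integral_npKernel_angular {r ρ : ℝ} (hr : 0 < r) (hρ : 0 < ρ)
    (p : MvPolynomial (Fin 3) ℂ) (ξ : UnitSphere) :
    ∫ y, npKernel (ρ • (ξ : E3)) y • angular p y ∂surfaceMeasure r
      = -(1 / (4 * Real.pi)) * zonalPotentialDeriv p ξ (ρ / r) := by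
  rw [integral_surfaceMeasure hr, zonalPotentialDeriv, ← integral_const_mul, ← integral_const_mul]
  refine integral_congr_ae (Filter.Eventually.of_forall fun ω => ?_)
  have hrC : (r : ℂ) ≠ 0 := by exact_mod_cast hr.ne'
  have hπ : (Real.pi : ℂ) ≠ 0 := by exact_mod_cast Real.pi_ne_zero
  simp only [npKernel_smul hr hρ, angular_smul hr, Complex.real_smul]
  push_cast
  field_simp
  ring

theorem integral_npKernel_angular_self {r : ℝ} (hr : 0 < r)
    (p : MvPolynomial (Fin 3) ℂ) (ξ : UnitSphere) :
    ∫ y, npKernel (r • (ξ : E3)) y • angular p y ∂surfaceMeasure r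
      = 1 / (8 * Real.pi) * zonalPotential p ξ 1 := by
  rw [integral_surfaceMeasure hr, zonalPotential, ← integral_const_mul, ← integral_const_mul]
  refine integral_congr_ae (Filter.Eventually.of_forall fun ω => ?_)
  have hrC : (r : ℂ) ≠ 0 := by exact_mod_cast hr.ne'
  have hπ : (Real.pi : ℂ) ≠ 0 := by exact_mod_cast Real.pi_ne_zero
  simp only [npKernel_smul_self hr, angular_smul hr, Complex.real_smul]
  push_cast
  field_simp

/-- The factor by which the kernel `npKernel`, integrated over the sphere of radius `r` and
evaluated on the sphere of radius `ρ`, multiplies spherical harmonics of degree `n`. -/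
def npFactor (r ρ : ℝ) (n : ℕ) : ℝ :=
  if ρ = r then 1 / (2 * (2 * n + 1))
  -- The last factor is `(ρ / r) ^ (n - 1)`, written without subtraction in the exponent.
  else if ρ < r then -(n / (2 * n + 1) * ((ρ / r) ^ n * (r / ρ)))
  else (n + 1) / (2 * n + 1) * (r / ρ) ^ (n + 2)

/-- Off the sphere the integral is a radial derivative of the potential, interior or exterior; on
it, by `npKernel_smul_self`, a boundary value of the potential itself. -/
theorem integral_npKernel_harmonic {r ρ : ℝ} (hr : 0 < r) (hρ : 0 < ρ) {n : ℕ}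
    {p : MvPolynomial (Fin 3) ℂ} (hp : p ∈ harmonicSubmodule n) {x : E3} (hx : ‖x‖ = ρ) :
    ∫ y, npKernel x y • angular p y ∂surfaceMeasure r = npFactor r ρ n * angular p x := by
  obtain ⟨ξ, rfl⟩ := exists_eq_smul_unitSphere hρ hx
  have hrC : (r : ℂ) ≠ 0 := by exact_mod_cast hr.ne'
  have hρC : (ρ : ℂ) ≠ 0 := by exact_mod_cast hρ.ne'
  have hπ : (Real.pi : ℂ) ≠ 0 := by exact_mod_cast Real.pi_ne_zero
  have hn : (2 * n + 1 : ℂ) ≠ 0 := by exact_mod_cast (2 * n).succ_ne_zero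
  rw [angular_smul hρ, npFactor]
  split_ifs with h1 h2
  · subst h1
    rw [integral_npKernel_angular_self hr, zonalPotential_eq_boundary hp]
    push_cast
    field_simp
    norm_num
  · have hs : ρ / r ∈ Set.Ioo (0 : ℝ) 1 := ⟨by positivity, (div_lt_one hr).2 h2⟩
    have h := zonalPotentialDeriv_eq_interior hp ξ hs
    have h3 : zonalPotentialDeriv p ξ (ρ / r)
        = r / ρ * (n * ((ρ / r : ℝ) : ℂ) ^ n * (4 * Real.pi / (2 * n + 1) * polyFun p ξ)) := by
      rw [← h]
      push_cast
      field_simp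
    rw [integral_npKernel_angular hr hρ, h3]
    push_cast
    field_simp
  · have hs : 1 < ρ / r := (one_lt_div hr).2 (lt_of_le_of_ne (not_lt.1 h2) (Ne.symm h1))
    rw [integral_npKernel_angular hr hρ, zonalPotentialDeriv_eq_exterior hp ξ hs]
    push_cast
    rw [← inv_pow, inv_div]
    field_simp

/-! ### The Schur test and bounded operators on `L²` -/

section Schur

variable {X Z : Type*} [MeasurableSpace X] [MeasurableSpace Z] {μ : Measure X} {ν : Measure Z}

/-- Cauchy–Schwarz for the factorisation `f g = √f · (√f g)`. -/
theorem sq_lintegral_mul_le {f g : Z → ENNReal} (hf : AEMeasurable f ν) (hg : AEMeasurable g ν) :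
    (∫⁻ y, f y * g y ∂ν) ^ 2 ≤ (∫⁻ y, f y ∂ν) * ∫⁻ y, f y * g y ^ 2 ∂ν := by
  have h := ENNReal.lintegral_mul_le_Lp_mul_Lq ν Real.HolderConjugate.two_two
    (hf.pow_const (1 / 2 : ℝ)) ((hf.pow_const (1 / 2 : ℝ)).mul hg)
  have e1 : ∀ a : ENNReal, a ^ (1 / 2 : ℝ) * a ^ (1 / 2 : ℝ) = a := fun a => by
    rw [← ENNReal.rpow_add_of_nonneg _ _ (by norm_num) (by norm_num)]
    norm_num
  have e2 : ∀ a : ENNReal, (a ^ (1 / 2 : ℝ)) ^ (2 : ℝ) = a := fun a => by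
    rw [← ENNReal.rpow_mul]
    norm_num
  have e3 : ∀ a : ENNReal, (a ^ (1 / 2 : ℝ)) ^ 2 = a := fun a => by
    rw [sq, e1]
  simp only [Pi.mul_apply, ← mul_assoc, e1, e2,
    ENNReal.mul_rpow_of_nonneg _ _ (zero_le_two (α := ℝ)), ENNReal.rpow_two] at h
  calc _ ≤ ((∫⁻ y, f y ∂ν) ^ (1 / 2 : ℝ) * (∫⁻ y, f y * g y ^ 2 ∂ν) ^ (1 / 2 : ℝ)) ^ 2 := by
        gcongr
    _ = _ := by rw [mul_pow, e3, e3]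

theorem eLpNorm_two_sq (f : X → ℂ) : eLpNorm f 2 μ ^ 2 = ∫⁻ x, ‖f x‖ₑ ^ 2 ∂μ := by
  have := eLpNorm_nnreal_pow_eq_lintegral (μ := μ) (f := f) (p := 2) (by norm_num)
  simp only [NNReal.coe_ofNat, ENNReal.coe_ofNat, ENNReal.rpow_two] at this
  exact this

variable [SFinite μ] [SFinite ν] {k : X → Z → ℝ} {C : ENNReal}

/-- The Schur test: the integral operator of a kernel with bounded marginals maps `L²` to `L²`. -/
theorem lintegral_sq_kernel_le (hk : Measurable fun z : X × Z => k z.1 z.2)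
    (h1 : ∀ᵐ x ∂μ, ∫⁻ y, ‖k x y‖ₑ ∂ν ≤ C) (h2 : ∀ᵐ y ∂ν, ∫⁻ x, ‖k x y‖ₑ ∂μ ≤ C)
    {g : Z → ENNReal} (hg : AEMeasurable g ν) :
    ∫⁻ x, (∫⁻ y, ‖k x y‖ₑ * g y ∂ν) ^ 2 ∂μ ≤ C ^ 2 * ∫⁻ y, g y ^ 2 ∂ν := by
  have hkx : ∀ x, Measurable fun y => ‖k x y‖ₑ := fun x =>
    (hk.comp measurable_prodMk_left).enorm
  have hky : ∀ y, Measurable fun x => ‖k x y‖ₑ := fun y =>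
    (hk.comp measurable_prodMk_right).enorm
  have hm : AEMeasurable (fun z : X × Z => ‖k z.1 z.2‖ₑ * g z.2 ^ 2) (μ.prod ν) :=
    hk.enorm.aemeasurable.mul ((hg.comp_snd).pow_const 2)
  calc ∫⁻ x, (∫⁻ y, ‖k x y‖ₑ * g y ∂ν) ^ 2 ∂μ
      ≤ ∫⁻ x, C * ∫⁻ y, ‖k x y‖ₑ * g y ^ 2 ∂ν ∂μ := by
        refine lintegral_mono_ae ?_
        filter_upwards [h1] with x hx
        exact (sq_lintegral_mul_le (hkx x).aemeasurable hg).trans (by gcongr)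
    _ = C * ∫⁻ y, ∫⁻ x, ‖k x y‖ₑ * g y ^ 2 ∂μ ∂ν := by
        rw [lintegral_const_mul'' _ hm.lintegral_prod_right', lintegral_lintegral_swap hm]
    _ = C * ∫⁻ y, (∫⁻ x, ‖k x y‖ₑ ∂μ) * g y ^ 2 ∂ν := by
        congr 1
        exact lintegral_congr fun y => lintegral_mul_const _ (hky y)
    _ ≤ C * ∫⁻ y, C * g y ^ 2 ∂ν := by
        gcongr 1
        refine lintegral_mono_ae ?_
        filter_upwards [h2] with y hy
        gcongr
    _ = C ^ 2 * ∫⁻ y, g y ^ 2 ∂ν := by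
        rw [lintegral_const_mul'' _ (hg.pow_const 2), sq, mul_assoc]

theorem exists_kernel_operator (hk : Measurable fun z : X × Z => k z.1 z.2)
    (h1 : ∀ᵐ x ∂μ, ∫⁻ y, ‖k x y‖ₑ ∂ν ≤ C) (h2 : ∀ᵐ y ∂ν, ∫⁻ x, ‖k x y‖ₑ ∂μ ≤ C)
    (hC : C ≠ ⊤) :
    ∃ T : Lp ℂ 2 ν →L[ℂ] Lp ℂ 2 μ, ∀ φ : Lp ℂ 2 ν,
      T φ =ᵐ[μ] fun x => ∫ y, k x y • φ y ∂ν := by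
  have hmeas : ∀ φ : Lp ℂ 2 ν, AEStronglyMeasurable (fun z : X × Z => k z.1 z.2 • φ z.2)
      (μ.prod ν) := fun φ =>
    hk.aestronglyMeasurable.smul (Lp.aestronglyMeasurable φ).comp_snd
  have hsq : ∀ φ : Lp ℂ 2 ν, ∫⁻ x, (∫⁻ y, ‖k x y‖ₑ * ‖φ y‖ₑ ∂ν) ^ 2 ∂μ
      ≤ C ^ 2 * eLpNorm φ 2 ν ^ 2 := fun φ => by
    rw [eLpNorm_two_sq]
    exact lintegral_sq_kernel_le hk h1 h2 (Lp.aestronglyMeasurable φ).aemeasurable.enorm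
  -- Integrability for almost every `x` is what makes the Bochner integral additive in `φ`.
  have hint : ∀ φ : Lp ℂ 2 ν, ∀ᵐ x ∂μ, Integrable (fun y => k x y • φ y) ν := by
    intro φ
    have hm : AEMeasurable (fun x => (∫⁻ y, ‖k x y‖ₑ * ‖φ y‖ₑ ∂ν) ^ 2) μ :=
      AEMeasurable.pow_const (AEMeasurable.lintegral_prod_right'
        (f := fun z : X × Z => ‖k z.1 z.2‖ₑ * ‖φ z.2‖ₑ)
        (hk.enorm.aemeasurable.mul (Lp.aestronglyMeasurable φ).comp_snd.aemeasurable.enorm)) 2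
    have hfin := ae_lt_top' hm (ne_top_of_le_ne_top (ENNReal.mul_ne_top (ENNReal.pow_ne_top hC)
      (ENNReal.pow_ne_top (Lp.eLpNorm_ne_top φ))) (hsq φ))
    filter_upwards [hfin] with x hx
    refine ⟨(hk.comp measurable_prodMk_left).aestronglyMeasurable.smul
      (Lp.aestronglyMeasurable φ), ?_⟩
    have h3 : ∫⁻ y, ‖k x y‖ₑ * ‖φ y‖ₑ ∂ν < ⊤ := by
      by_contra h
      rw [not_lt_top_iff.1 h] at hx
      simp at hx
    simpa only [HasFiniteIntegral, enorm_smul] using h3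
  have hle : ∀ φ : Lp ℂ 2 ν,
      eLpNorm (fun x => ∫ y, k x y • φ y ∂ν) 2 μ ≤ C * eLpNorm φ 2 ν := by
    intro φ
    have h : eLpNorm (fun x => ∫ y, k x y • φ y ∂ν) 2 μ ^ 2 ≤ (C * eLpNorm φ 2 ν) ^ 2 := by
      rw [mul_pow, eLpNorm_two_sq]
      refine le_trans (lintegral_mono fun x => ?_) (hsq φ)
      gcongr
      refine (enorm_integral_le_lintegral_enorm _).trans (le_of_eq ?_)
      simp only [enorm_smul]
    exact (ENNReal.pow_le_pow_left_iff two_ne_zero).1 h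
  have hLp : ∀ φ : Lp ℂ 2 ν, MemLp (fun x => ∫ y, k x y • φ y ∂ν) 2 μ := fun φ =>
    ⟨(hmeas φ).integral_prod_right', (hle φ).trans_lt
      (ENNReal.mul_lt_top hC.lt_top (Lp.eLpNorm_lt_top φ))⟩
  let T : Lp ℂ 2 ν →ₗ[ℂ] Lp ℂ 2 μ :=
    { toFun := fun φ => (hLp φ).toLp _
      map_add' := fun φ ψ => by
        refine Lp.ext ?_
        filter_upwards [(hLp (φ + ψ)).coeFn_toLp, (hLp φ).coeFn_toLp, (hLp ψ).coeFn_toLp,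
          Lp.coeFn_add ((hLp φ).toLp _) ((hLp ψ).toLp _), hint φ, hint ψ] with x a1 a2 a3 a4 a5 a6
        rw [a1, a4, Pi.add_apply, a2, a3, ← integral_add a5 a6]
        refine integral_congr_ae ?_
        filter_upwards [Lp.coeFn_add φ ψ] with y hy
        rw [hy, Pi.add_apply, smul_add]
      map_smul' := fun c φ => by
        refine Lp.ext ?_
        filter_upwards [(hLp (c • φ)).coeFn_toLp, (hLp φ).coeFn_toLp,
          Lp.coeFn_smul c ((hLp φ).toLp _)] with x a1 a2 a3
        rw [a1, RingHom.id_apply, a3, Pi.smul_apply, a2, ← integral_smul]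
        refine integral_congr_ae ?_
        filter_upwards [Lp.coeFn_smul c φ] with y hy
        rw [hy, Pi.smul_apply, smul_comm] }
  refine ⟨T.mkContinuous C.toReal fun φ => ?_, fun φ => (hLp φ).coeFn_toLp⟩
  change ‖(hLp φ).toLp _‖ ≤ _
  rw [Lp.norm_toLp, Lp.norm_def, ← ENNReal.toReal_mul]
  exact ENNReal.toReal_mono (ENNReal.mul_ne_top hC (Lp.eLpNorm_ne_top φ)) (hle φ)

end Schur

/-- The kernel is nonnegative on the sphere, so its marginal is the boundary potential of the
constant `1`. -/
theorem lintegral_npKernel_self {r : ℝ} (hr : 0 < r) (ξ : UnitSphere) :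
    ∫⁻ ω : UnitSphere, ‖npKernel (r • (ξ : E3)) (r • (ω : E3))‖ₑ ∂sphereMeasure
      = ENNReal.ofReal ((8 * Real.pi * r ^ 2)⁻¹ * (4 * Real.pi)) := by
  have h0 := zonalPotential_eq_boundary one_mem_harmonicSubmodule ξ
  simp only [zonalPotential, polyFun_one, mul_one, integral_complex_ofReal, Nat.cast_zero,
    mul_zero, zero_add, div_one] at h0
  have h : ∫ ω : UnitSphere, invDist 1 (inner ℝ (ξ : E3) ω) ∂sphereMeasure = 4 * Real.pi := by
    exact_mod_cast h0
  rw [← h, ← integral_const_mul, ofReal_integral_eq_lintegral_ofReal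
    ((integrable_invDist_one ξ).const_mul _) (Filter.Eventually.of_forall fun ω =>
      mul_nonneg (by positivity) (invDist_nonneg _ _))]
  refine lintegral_congr fun ω => ?_
  rw [npKernel_smul_self hr]
  exact Real.enorm_eq_ofReal (mul_nonneg (by positivity) (invDist_nonneg _ _))

theorem npKernel_smul_self_comm {r : ℝ} (hr : 0 < r) (ξ ω : UnitSphere) :
    npKernel (r • (ξ : E3)) (r • (ω : E3)) = npKernel (r • (ω : E3)) (r • (ξ : E3)) := by
  rw [npKernel_smul_self hr, npKernel_smul_self hr, real_inner_comm]

theorem abs_sub_le_norm_sub {r ρ : ℝ} {x y : E3} (hx : ‖x‖ = ρ) (hy : ‖y‖ = r) :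
    |ρ - r| ≤ ‖x - y‖ := by
  rw [← hx, ← hy]
  exact abs_norm_sub_norm_le x y

/-- For equal radii symmetry gives both marginals at once; for distinct radii `|x - y| ≥ |ρ - r|`
makes the kernel bounded. -/
theorem exists_npKernel_operator {r ρ : ℝ} (hr : 0 < r) (hρ : 0 < ρ) :
    ∃ T : Lp ℂ 2 (surfaceMeasure r) →L[ℂ] Lp ℂ 2 (surfaceMeasure ρ),
      ∀ φ : Lp ℂ 2 (surfaceMeasure r),
        T φ =ᵐ[surfaceMeasure ρ] fun x => ∫ y, npKernel x y • φ y ∂surfaceMeasure r := by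
  rcases eq_or_ne ρ r with rfl | hne
  · refine exists_kernel_operator (C := ENNReal.ofReal (ρ ^ 2)
      * ENNReal.ofReal ((8 * Real.pi * ρ ^ 2)⁻¹ * (4 * Real.pi))) measurable_npKernel ?_ ?_
      (ENNReal.mul_ne_top ENNReal.ofReal_ne_top ENNReal.ofReal_ne_top)
    · rw [ae_surfaceMeasure_iff hr]
      refine Filter.Eventually.of_forall fun ξ => ?_
      rw [lintegral_surfaceMeasure hr, lintegral_npKernel_self hr]
    · rw [ae_surfaceMeasure_iff hr]
      refine Filter.Eventually.of_forall fun ξ => ?_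
      rw [lintegral_surfaceMeasure hr]
      simp only [npKernel_smul_self_comm hr _ ξ]
      rw [lintegral_npKernel_self hr]
  · have hd : 0 < |ρ - r| := abs_pos.2 (sub_ne_zero.2 hne)
    set B := ENNReal.ofReal ((4 * Real.pi * |ρ - r| ^ 2)⁻¹)
    have hB : ∀ x y : E3, ‖x‖ = ρ → ‖y‖ = r → ‖npKernel x y‖ₑ ≤ B := fun x y hx hy => by
      rw [← ofReal_norm]
      exact ENNReal.ofReal_le_ofReal (norm_npKernel_le hd (abs_sub_le_norm_sub hx hy))
    refine exists_kernel_operator (C := max (B * surfaceMeasure r Set.univ)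
      (B * surfaceMeasure ρ Set.univ)) measurable_npKernel ?_ ?_ ?_
    · filter_upwards [ae_norm_eq hρ] with x hx
      refine le_trans ?_ (le_max_left _ _)
      rw [← lintegral_const]
      refine lintegral_mono_ae ?_
      filter_upwards [ae_norm_eq hr] with y hy using hB x y hx hy
    · filter_upwards [ae_norm_eq hr] with y hy
      refine le_trans ?_ (le_max_right _ _)
      rw [← lintegral_const]
      refine lintegral_mono_ae ?_
      filter_upwards [ae_norm_eq hρ] with x hx using hB x y hx hy
    · exact (max_lt (ENNReal.mul_lt_top ENNReal.ofReal_lt_top (measure_lt_top _ _))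
        (ENNReal.mul_lt_top ENNReal.ofReal_lt_top (measure_lt_top _ _))).ne

/-- Off the sphere, the single layer potential may be differentiated under the integral. -/
theorem normalDeriv_singleLayer {r : ℝ} (hr : 0 < r) {φ : E3 → ℂ}
    (hφ : Integrable φ (surfaceMeasure r)) {x : E3} (hx : ‖x‖ ≠ r) :
    normalDeriv (singleLayer r φ) x = ∫ y, npKernel x y • φ y ∂surfaceMeasure r := by
  -- With half the distance to the sphere, every point of the ball around `x` stays at distance at
  -- least `d` from it, so one bound dominates all derivatives.
  set d := |‖x‖ - r| / 2 with hd
  have hd0 : 0 < d := half_pos (abs_pos.2 (sub_ne_zero.2 hx))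
  have hdist : ∀ y : E3, ‖y‖ = r → ∀ z ∈ Metric.ball x d, d ≤ ‖z - y‖ := by
    intro y hy z hz
    have h1 : |‖x‖ - r| ≤ ‖x - y‖ := abs_sub_le_norm_sub rfl hy
    have h2 : ‖x - y‖ ≤ ‖x - z‖ + ‖z - y‖ := by
      simpa using norm_add_le (x - z) (z - y)
    have h3 : ‖x - z‖ < d := by
      rw [← dist_eq_norm, dist_comm]
      exact hz
    linarith
  have hfm : Measurable fundSol := by
    unfold fundSol
    fun_prop
  have hmeas : ∀ z : E3, AEStronglyMeasurable (fun y => fundSol (z - y) • φ y)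
      (surfaceMeasure r) := fun z =>
    (hfm.comp (measurable_const.sub measurable_id)).aestronglyMeasurable.smul hφ.1
  have hmem : x ∈ Metric.ball x d := Metric.mem_ball_self hd0
  have hF' : AEStronglyMeasurable (fun y => (fderiv ℝ fundSol (x - y)).smulRight (φ y))
      (surfaceMeasure r) := by
    have h1 : AEStronglyMeasurable (fun y => fderiv ℝ fundSol (x - y)) (surfaceMeasure r) :=
      ((measurable_fderiv ℝ fundSol).comp
        (measurable_const.sub measurable_id)).aestronglyMeasurable
    exact (ContinuousLinearMap.smulRightL ℝ E3 ℂ).aestronglyMeasurable_comp₂ h1 hφ.1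
  have hbound : ∀ y : E3, ‖y‖ = r → ∀ z ∈ Metric.ball x d,
      ‖(fderiv ℝ fundSol (z - y)).smulRight (φ y)‖ ≤ (4 * Real.pi * d ^ 2)⁻¹ * ‖φ y‖ := by
    intro y hy z hz
    rw [ContinuousLinearMap.norm_smulRight_apply]
    gcongr
    exact norm_fderiv_fundSol_le hd0 (hdist y hy z hz)
  have hint0 : Integrable (fun y => fundSol (x - y) • φ y) (surfaceMeasure r) := by
    refine (hφ.norm.const_mul ((4 * Real.pi * d)⁻¹)).mono' (hmeas x) ?_
    filter_upwards [ae_norm_eq hr] with y hy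
    have h1 := hdist y hy x hmem
    rw [norm_smul]
    gcongr
    rw [fundSol, norm_neg, one_div, Real.norm_of_nonneg (by positivity)]
    gcongr
  have hint' : Integrable (fun y => (fderiv ℝ fundSol (x - y)).smulRight (φ y))
      (surfaceMeasure r) := by
    refine (hφ.norm.const_mul ((4 * Real.pi * d ^ 2)⁻¹)).mono' hF' ?_
    filter_upwards [ae_norm_eq hr] with y hy using hbound y hy x hmem
  have key : HasFDerivAt (singleLayer r φ)
      (∫ y, (fderiv ℝ fundSol (x - y)).smulRight (φ y) ∂surfaceMeasure r) x := by
    refine hasFDerivAt_integral_of_dominated_of_fderiv_le (𝕜 := ℝ)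
      (F := fun z y => fundSol (z - y) • φ y)
      (F' := fun z y => (fderiv ℝ fundSol (z - y)).smulRight (φ y))
      (Metric.ball_mem_nhds x hd0) (Filter.Eventually.of_forall hmeas) hint0 hF' ?_
      (hφ.norm.const_mul ((4 * Real.pi * d ^ 2)⁻¹)) ?_
    · filter_upwards [ae_norm_eq hr] with y hy using hbound y hy
    · filter_upwards [ae_norm_eq hr] with y hy z hz
      have hz0 : z - y ≠ 0 := norm_pos_iff.1 (hd0.trans_le (hdist y hy z hz))
      have h1 : HasFDerivAt (fun z => fundSol (z - y)) (fderiv ℝ fundSol (z - y)) z :=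
        (hasFDerivAt_comp_sub y).2 (hasFDerivAt_fundSol hz0).differentiableAt.hasFDerivAt
      exact h1.smul_const (φ y)
  rw [normalDeriv, key.fderiv, ContinuousLinearMap.integral_apply hint']
  rfl

/-! ### Decomposition of polynomials into harmonic ones -/

/-- The Laplacian of a polynomial. -/
def polyLaplacian : MvPolynomial (Fin 3) ℂ →ₗ[ℂ] MvPolynomial (Fin 3) ℂ :=
  ∑ i, (MvPolynomial.pderiv i).toLinearMap ∘ₗ (MvPolynomial.pderiv i).toLinearMap

theorem polyLaplacian_apply (p : MvPolynomial (Fin 3) ℂ) :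
    polyLaplacian p = ∑ i, MvPolynomial.pderiv i (MvPolynomial.pderiv i p) := by
  simp [polyLaplacian, LinearMap.sum_apply]

theorem mem_harmonicSubmodule {n : ℕ} {p : MvPolynomial (Fin 3) ℂ} :
    p ∈ harmonicSubmodule n ↔ p.IsHomogeneous n ∧ polyLaplacian p = 0 := by
  rw [polyLaplacian_apply]
  rfl

/-- The polynomial `|x|²`. -/
def normSqPoly : MvPolynomial (Fin 3) ℂ := ∑ i, MvPolynomial.X i ^ 2

theorem isHomogeneous_normSqPoly : normSqPoly.IsHomogeneous 2 :=
  MvPolynomial.IsHomogeneous.sum _ _ _ fun i _ => by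
    simpa using (MvPolynomial.isHomogeneous_X ℂ i).pow 2

theorem polyFun_normSqPoly (ω : UnitSphere) : polyFun normSqPoly ω = 1 := by
  have h := congrArg (fun u : ℝ => (u : ℂ)) ω.sum_sq
  simpa [normSqPoly, polyFun, Fin.sum_univ_three] using h

theorem polyLaplacian_normSqPoly_mul {d : ℕ} {q : MvPolynomial (Fin 3) ℂ}
    (hq : q.IsHomogeneous d) :
    polyLaplacian (normSqPoly * q) = (4 * d + 6 : ℂ) • q + normSqPoly * polyLaplacian q := by
  have hE := hq.sum_X_mul_pderiv
  have h6 : ((4 * d + 6 : ℂ) • q) = (4 : MvPolynomial (Fin 3) ℂ) * (d • q) + 6 * q := by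
    rw [MvPolynomial.smul_eq_C_mul, nsmul_eq_mul]
    simp only [map_add, map_mul, map_ofNat, map_natCast]
    ring
  rw [h6, ← hE, polyLaplacian_apply, polyLaplacian_apply]
  simp only [Fin.sum_univ_three, normSqPoly, MvPolynomial.pderiv_mul, map_add,
    MvPolynomial.pderiv_pow, MvPolynomial.pderiv_X, Pi.single_apply]
  have h2 : ∀ i, MvPolynomial.pderiv i (2 : MvPolynomial (Fin 3) ℂ) = 0 := fun i =>
    (MvPolynomial.pderiv i).map_natCast 2
  simp [h2]
  ring

theorem isHomogeneous_normSqPoly_pow_mul {k j : ℕ} {h : MvPolynomial (Fin 3) ℂ}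
    (hh : h.IsHomogeneous k) : (normSqPoly ^ j * h).IsHomogeneous (2 * j + k) :=
  (isHomogeneous_normSqPoly.pow j).mul hh

/-- The point is that the coefficient never vanishes, so the Laplacian can be inverted term by term
on `harmonicSpan`. -/
theorem polyLaplacian_normSqPoly_pow_mul {k : ℕ} {h : MvPolynomial (Fin 3) ℂ}
    (hh : h ∈ harmonicSubmodule k) (j : ℕ) :
    polyLaplacian (normSqPoly ^ (j + 1) * h)
      = (2 * (j + 1) * (2 * j + 2 * k + 3) : ℂ) • (normSqPoly ^ j * h) := by
  have hh' := mem_harmonicSubmodule.1 hh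
  induction j with
  | zero =>
    rw [pow_succ, pow_zero, one_mul, polyLaplacian_normSqPoly_mul hh'.1, hh'.2, mul_zero,
      add_zero, one_mul]
    congr 1
    push_cast
    ring
  | succ j ih =>
    rw [pow_succ' _ (j + 1), mul_assoc,
      polyLaplacian_normSqPoly_mul (isHomogeneous_normSqPoly_pow_mul hh'.1), ih, mul_smul_comm,
      ← mul_assoc, ← pow_succ', ← add_smul]
    congr 1
    push_cast
    ring

/-- The span of the polynomials `|x|^(2 j) h` of degree `n` with `h` harmonic. -/
def harmonicSpan (n : ℕ) : Submodule ℂ (MvPolynomial (Fin 3) ℂ) :=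
  Submodule.span ℂ {p | ∃ j k h, 2 * j + k = n ∧ h ∈ harmonicSubmodule k
    ∧ p = normSqPoly ^ j * h}

theorem isHomogeneous_of_mem_harmonicSpan {n : ℕ} {p : MvPolynomial (Fin 3) ℂ}
    (hp : p ∈ harmonicSpan n) : p.IsHomogeneous n := by
  have h : harmonicSpan n ≤ MvPolynomial.homogeneousSubmodule (Fin 3) ℂ n := by
    refine Submodule.span_le.2 ?_
    rintro _ ⟨j, k, h, rfl, hh, rfl⟩
    exact isHomogeneous_normSqPoly_pow_mul hh.1
  exact h hp

theorem exists_polyLaplacian_eq {n : ℕ} {q : MvPolynomial (Fin 3) ℂ} (hq : q ∈ harmonicSpan n) :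
    ∃ u ∈ harmonicSpan (n + 2), polyLaplacian u = q := by
  refine Submodule.span_induction (p := fun q _ => ∃ u ∈ harmonicSpan (n + 2),
    polyLaplacian u = q) ?_ ⟨0, Submodule.zero_mem _, map_zero _⟩ ?_ ?_ hq
  · rintro _ ⟨j, k, h, rfl, hh, rfl⟩
    have hc : (2 * (j + 1) * (2 * j + 2 * k + 3) : ℂ) ≠ 0 := by
      exact_mod_cast (by positivity : 2 * (j + 1) * (2 * j + 2 * k + 3) ≠ 0)
    refine ⟨(2 * (j + 1) * (2 * j + 2 * k + 3) : ℂ)⁻¹ • (normSqPoly ^ (j + 1) * h),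
      Submodule.smul_mem _ _ (Submodule.subset_span ⟨j + 1, k, h, by ring, hh, rfl⟩), ?_⟩
    rw [map_smul, polyLaplacian_normSqPoly_pow_mul hh, smul_smul, inv_mul_cancel₀ hc, one_smul]
  · rintro _ _ _ _ ⟨u, hu, rfl⟩ ⟨v, hv, rfl⟩
    exact ⟨u + v, Submodule.add_mem _ hu hv, map_add _ _ _⟩
  · rintro c _ _ ⟨u, hu, rfl⟩
    exact ⟨c • u, Submodule.smul_mem _ _ hu, map_smul _ _ _⟩

theorem pderiv_eq_zero_of_isHomogeneous_zero {p : MvPolynomial (Fin 3) ℂ}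
    (hp : p.IsHomogeneous 0) (i : Fin 3) : MvPolynomial.pderiv i p = 0 := by
  rw [← MvPolynomial.totalDegree_zero_iff_isHomogeneous,
    MvPolynomial.totalDegree_eq_zero_iff_eq_C] at hp
  rw [hp, MvPolynomial.pderiv_C]

/-- By induction `Δ p` decomposes, so some `u` in the span has `Δ u = Δ p`, and `p - u` is harmonic.
-/
theorem mem_harmonicSpan_of_isHomogeneous {n : ℕ} {p : MvPolynomial (Fin 3) ℂ}
    (hp : p.IsHomogeneous n) : p ∈ harmonicSpan n := by
  induction n using Nat.strong_induction_on generalizing p with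
  | _ n ih =>
    have hharm : ∀ {q : MvPolynomial (Fin 3) ℂ}, q ∈ harmonicSubmodule n → q ∈ harmonicSpan n :=
      fun {q} hq => Submodule.subset_span ⟨0, n, q, by simp, hq, by simp⟩
    rcases lt_or_ge n 2 with hn | hn
    · refine hharm ⟨hp, Finset.sum_eq_zero fun i _ => ?_⟩
      refine pderiv_eq_zero_of_isHomogeneous_zero ?_ i
      have h := hp.pderiv (i := i)
      -- Truncated subtraction covers `n = 0` and `n = 1` together.
      rwa [show n - 1 = 0 by omega] at h
    · obtain ⟨m, rfl⟩ : ∃ m, n = m + 2 := ⟨n - 2, by omega⟩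
      have hΔ : (polyLaplacian p).IsHomogeneous m := by
        rw [polyLaplacian_apply]
        refine MvPolynomial.IsHomogeneous.sum _ _ _ fun i _ => ?_
        simpa using (hp.pderiv (i := i)).pderiv (i := i)
      obtain ⟨u, hu, hu'⟩ := exists_polyLaplacian_eq (ih m (by omega) hΔ)
      have h1 : p - u ∈ harmonicSpan (m + 2) := hharm (mem_harmonicSubmodule.2
        ⟨hp.sub (isHomogeneous_of_mem_harmonicSpan hu), by rw [map_sub, hu', sub_self]⟩)
      simpa using Submodule.add_mem _ h1 hu

/-! ### The dimension bound for harmonic polynomials -/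

section Dimension

/-- The exponent vector `(a, b, c)`. -/
def expVec (a b c : ℕ) : Fin 3 →₀ ℕ := Finsupp.equivFunOnFinite.symm ![a, b, c]

theorem expVec_add_single_zero (a b c : ℕ) :
    expVec a b c + Finsupp.single 0 1 = expVec (a + 1) b c := by
  ext i
  fin_cases i <;> simp [expVec]

theorem expVec_add_single_one (a b c : ℕ) :
    expVec a b c + Finsupp.single 1 1 = expVec a (b + 1) c := by
  ext i
  fin_cases i <;> simp [expVec]

theorem expVec_add_single_two (a b c : ℕ) :
    expVec a b c + Finsupp.single 2 1 = expVec a b (c + 1) := by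
  ext i
  fin_cases i <;> simp [expVec]

theorem coeff_polyLaplacian (p : MvPolynomial (Fin 3) ℂ) (a b c : ℕ) :
    (polyLaplacian p).coeff (expVec a b c)
      = p.coeff (expVec (a + 2) b c) * ((a + 2) * (a + 1))
        + p.coeff (expVec a (b + 2) c) * ((b + 2) * (b + 1))
        + p.coeff (expVec a b (c + 2)) * ((c + 2) * (c + 1)) := by
  rw [polyLaplacian_apply, Fin.sum_univ_three]
  simp only [MvPolynomial.coeff_add, MvPolynomial.coeff_pderiv, expVec_add_single_zero,
    expVec_add_single_one, expVec_add_single_two]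
  simp [expVec]
  ring

/-- A harmonic polynomial is determined by its terms of degree at most one in the last
variable. -/
theorem eq_zero_of_coeff_eq_zero {n : ℕ} {p : MvPolynomial (Fin 3) ℂ}
    (hp : p ∈ harmonicSubmodule n) (h0 : ∀ a b, p.coeff (expVec a b 0) = 0)
    (h1 : ∀ a b, p.coeff (expVec a b 1) = 0) : p = 0 := by
  have h : ∀ c a b, p.coeff (expVec a b c) = 0 := by
    intro c
    induction c using Nat.strong_induction_on with
    | _ c ih =>
      intro a b
      rcases c with _ | _ | c
      · exact h0 a b
      · exact h1 a b
      -- This coefficient of `Δ p = 0` expresses the terms of degree `c + 2` in the last variable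
      -- through those of degree `c`.
      · have h2 := coeff_polyLaplacian p a b c
        rw [(mem_harmonicSubmodule.1 hp).2, MvPolynomial.coeff_zero, ih c (by omega),
          ih c (by omega), zero_mul, zero_mul, zero_add, zero_add, eq_comm, mul_eq_zero] at h2
        refine h2.resolve_right ?_
        exact_mod_cast (by positivity : (c + 2) * (c + 1) ≠ 0)
  ext m
  have hm : m = expVec (m 0) (m 1) (m 2) := by
    ext i
    fin_cases i <;> simp [expVec]
  rw [hm, h, MvPolynomial.coeff_zero]

/-- The coefficients of degree at most one in the last variable. -/
def lowCoeffs (n : ℕ) : harmonicSubmodule n →ₗ[ℂ] (Fin (n + 1) ⊕ Fin n → ℂ) where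
  toFun p := Sum.elim (fun a => p.1.coeff (expVec a (n - a) 0))
    (fun a => p.1.coeff (expVec a (n - 1 - a) 1))
  map_add' p q := by
    ext (i | i) <;> simp
  map_smul' c p := by
    ext (i | i) <;> simp

theorem coeff_expVec_eq_zero {n : ℕ} {p : MvPolynomial (Fin 3) ℂ} (hp : p.IsHomogeneous n)
    {a b c : ℕ} (h : a + b + c ≠ n) : p.coeff (expVec a b c) = 0 := by
  refine hp.coeff_eq_zero ?_
  rw [Finsupp.degree_eq_sum, Fin.sum_univ_three]
  simpa [expVec] using h

theorem lowCoeffs_injective (n : ℕ) : Function.Injective (lowCoeffs n) := by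
  rw [← LinearMap.ker_eq_bot, LinearMap.ker_eq_bot']
  intro p hp
  refine Subtype.ext (eq_zero_of_coeff_eq_zero p.2 (fun a b => ?_) fun a b => ?_)
  · by_cases h : a + b + 0 = n
    · have h1 := congrFun hp (Sum.inl ⟨a, by omega⟩)
      simp only [lowCoeffs, LinearMap.coe_mk, AddHom.coe_mk, Sum.elim_inl, Pi.zero_apply] at h1
      rwa [show n - a = b by omega] at h1
    · exact coeff_expVec_eq_zero p.2.1 h
  · by_cases h : a + b + 1 = n
    · have h1 := congrFun hp (Sum.inr ⟨a, by omega⟩)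
      simp only [lowCoeffs, LinearMap.coe_mk, AddHom.coe_mk, Sum.elim_inr, Pi.zero_apply] at h1
      rwa [show n - 1 - a = b by omega] at h1
    · exact coeff_expVec_eq_zero p.2.1 h

instance finiteDimensional_harmonicSubmodule (n : ℕ) :
    FiniteDimensional ℂ (harmonicSubmodule n) :=
  FiniteDimensional.of_injective (lowCoeffs n) (lowCoeffs_injective n)

/-- Only the upper bound is needed: an orthonormal family of `2 n + 1` harmonics supplies the lower
one. -/
theorem finrank_harmonicSubmodule_le (n : ℕ) :
    Module.finrank ℂ (harmonicSubmodule n) ≤ 2 * n + 1 := by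
  refine (LinearMap.finrank_le_finrank_of_injective (lowCoeffs_injective n)).trans ?_
  simp
  omega

end Dimension

/-- `(x + i y) ^ n` is harmonic because `1 + i² = 0`. It shows that each `±λₙ` is attained without
presupposing an orthonormal family. -/
theorem exists_harmonic_ne_zero (n : ℕ) :
    ∃ p ∈ harmonicSubmodule n, ∃ ξ : UnitSphere, polyFun p ξ ≠ 0 := by
  refine ⟨(MvPolynomial.X 0 + MvPolynomial.C Complex.I * MvPolynomial.X 1) ^ n, ⟨?_, ?_⟩,
    ⟨EuclideanSpace.single 0 1, by simp⟩, ?_⟩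
  · have h := ((MvPolynomial.isHomogeneous_X ℂ (0 : Fin 3)).add
      ((MvPolynomial.isHomogeneous_X ℂ (1 : Fin 3)).C_mul Complex.I)).pow n
    rwa [one_mul] at h
  · have hI : (MvPolynomial.C Complex.I * MvPolynomial.C Complex.I : MvPolynomial (Fin 3) ℂ)
        = -1 := by
      rw [← map_mul, Complex.I_mul_I, map_neg, map_one]
    simp only [Fin.sum_univ_three, MvPolynomial.pderiv_pow, MvPolynomial.pderiv_mul, map_add,
      MvPolynomial.pderiv_X, MvPolynomial.pderiv_C, Pi.single_apply]
    simp
    generalize (MvPolynomial.X 0 + MvPolynomial.C Complex.I * MvPolynomial.X 1 :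
      MvPolynomial (Fin 3) ℂ) ^ (n - 1 - 1) = A
    generalize ((n - 1 : ℕ) : MvPolynomial (Fin 3) ℂ) = B
    linear_combination ((n : MvPolynomial (Fin 3) ℂ) * B * A) * hI
  · simp [polyFun]

/-! ### Orthogonality and completeness of spherical harmonics -/

theorem coeFn_angularLp (r : ℝ) (p : MvPolynomial (Fin 3) ℂ) :
    angularLp r p =ᵐ[surfaceMeasure r] angular p := (memLp_angular r p).coeFn_toLp

/-- `angularLp` as a linear map. -/
def angularLpLinear (r : ℝ) : MvPolynomial (Fin 3) ℂ →ₗ[ℂ] Lp ℂ 2 (surfaceMeasure r) where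
  toFun := angularLp r
  map_add' p q := by
    unfold angularLp
    rw [← MemLp.toLp_add]
    congr 1
    funext x
    simp [angular]
  map_smul' c p := by
    unfold angularLp
    rw [RingHom.id_apply, ← MemLp.toLp_const_smul]
    congr 1
    funext x
    simp [angular]

theorem angularLpLinear_apply (r : ℝ) (p : MvPolynomial (Fin 3) ℂ) :
    angularLpLinear r p = angularLp r p := rfl

theorem angularLp_congr {r : ℝ} (hr : 0 < r) {p q : MvPolynomial (Fin 3) ℂ}
    (h : ∀ ω : UnitSphere, polyFun p ω = polyFun q ω) : angularLp r p = angularLp r q := by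
  refine (MemLp.toLp_eq_toLp_iff _ _).2 ?_
  rw [Filter.EventuallyEq, ae_surfaceMeasure_iff hr]
  refine Filter.Eventually.of_forall fun ω => ?_
  rw [angular_smul hr, angular_smul hr, h]

theorem polyFun_eq_zero_of_angularLp_eq_zero {r : ℝ} (hr : 0 < r) {p : MvPolynomial (Fin 3) ℂ}
    (h : angularLp r p = 0) (ω : UnitSphere) : polyFun p ω = 0 := by
  have h1 := (coeFn_angularLp r p).symm.trans (h ▸ Lp.coeFn_zero ℂ 2 (surfaceMeasure r))
  rw [Filter.EventuallyEq, ae_surfaceMeasure_iff hr] at h1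
  simp only [angular_smul hr] at h1
  have h2 : Continuous fun ω : UnitSphere => polyFun p ω :=
    (continuous_polyFun p).comp continuous_subtype_val
  have h3 := (Continuous.ae_eq_iff_eq sphereMeasure h2
    (continuous_const (y := (0 : ℂ)))).1 h1
  exact congrFun h3 ω

theorem inner_angularLp {r : ℝ} (hr : 0 < r) (p q : MvPolynomial (Fin 3) ℂ) :
    inner ℂ (angularLp r p) (angularLp r q) = (r : ℂ) ^ 2
      * ∫ ω : UnitSphere, polyFun q ω * starRingEnd ℂ (polyFun p ω) ∂sphereMeasure := by
  rw [L2.inner_def]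
  have h : ∫ x, inner ℂ (angularLp r p x) (angularLp r q x) ∂surfaceMeasure r
      = ∫ x, angular q x * starRingEnd ℂ (angular p x) ∂surfaceMeasure r := by
    refine integral_congr_ae ?_
    filter_upwards [coeFn_angularLp r p, coeFn_angularLp r q] with x h1 h2
    rw [h1, h2, RCLike.inner_apply]
  rw [h, integral_surfaceMeasure hr]
  simp only [angular_smul hr]

theorem sum_angMomentum_sq {n : ℕ} {p : MvPolynomial (Fin 3) ℂ}
    (hp : p ∈ harmonicSubmodule n) (ω : UnitSphere) :
    polyFun (angMomentum 0 1 (angMomentum 0 1 p)) ω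
      + polyFun (angMomentum 0 2 (angMomentum 0 2 p)) ω
      + polyFun (angMomentum 1 2 (angMomentum 1 2 p)) ω = -(n * (n + 1)) * polyFun p ω := by
  have e := sum_coord_mul_polyFun_pderiv hp.1 (ω : E3)
  have e0 := sum_coord_mul_polyFun_pderiv_pderiv hp.1 0 (ω : E3)
  have e1 := sum_coord_mul_polyFun_pderiv_pderiv hp.1 1 (ω : E3)
  have e2 := sum_coord_mul_polyFun_pderiv_pderiv hp.1 2 (ω : E3)
  have hΔ := congrArg (fun q => polyFun q ω) hp.2
  simp only [angMomentum, polyFun_sub, polyFun_mul, polyFun_X, polyFun_add,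
    map_sub, MvPolynomial.pderiv_mul]
  simp only [Fin.sum_univ_three, polyFun_add, pderiv_pderiv_comm 1 0, pderiv_pderiv_comm 2 0,
    pderiv_pderiv_comm 2 1] at e e0 e1 e2 hΔ ⊢
  simp [MvPolynomial.pderiv_X, polyFun] at e e0 e1 e2 hΔ ⊢
  linear_combination (((ω : E3) 0 : ℂ) ^ 2 + ((ω : E3) 1 : ℂ) ^ 2
        + ((ω : E3) 2 : ℂ) ^ 2) * hΔ - ((ω : E3) 0 : ℂ) * e0 - ((ω : E3) 1 : ℂ) * e1
        - ((ω : E3) 2 : ℂ) * e2 - (n + 1) * e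

theorem angMomentum_sub (i j : Fin 3) (p q : MvPolynomial (Fin 3) ℂ) :
    angMomentum i j (p - q) = angMomentum i j p - angMomentum i j q := by
  simp only [angMomentum, map_sub]
  ring

theorem angMomentum_mul (i j : Fin 3) (p q : MvPolynomial (Fin 3) ℂ) :
    angMomentum i j (p * q) = angMomentum i j p * q + p * angMomentum i j q := by
  simp only [angMomentum, MvPolynomial.pderiv_mul]
  ring

theorem integral_angMomentum (i j : Fin 3) (q : MvPolynomial (Fin 3) ℂ) :
    ∫ ω : UnitSphere, polyFun (angMomentum i j q) ω ∂sphereMeasure = 0 := by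
  have h := integral_zonal_mul_angMomentum ⟨EuclideanSpace.single 0 1, by simp⟩
    (F := fun _ => 1) (F' := fun _ => 0) (fun t _ => hasDerivAt_const t 1) continuousOn_const i j q
  simpa using h

theorem integrable_polyFun (p : MvPolynomial (Fin 3) ℂ) :
    Integrable (fun ω : UnitSphere => polyFun p ω) sphereMeasure :=
  integrable_sphereMeasure ((continuous_polyFun p).comp continuous_subtype_val)

/-- Eigenfunctions of the symmetric spherical Laplacian for the distinct eigenvalues `-n (n + 1)`
and `-m (m + 1)`; `w` carries Green's identity. -/
theorem integral_mul_eq_zero_of_harmonic {n m : ℕ} (hnm : n ≠ m) {p q : MvPolynomial (Fin 3) ℂ}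
    (hp : p ∈ harmonicSubmodule n) (hq : q ∈ harmonicSubmodule m) :
    ∫ ω : UnitSphere, polyFun p ω * polyFun q ω ∂sphereMeasure = 0 := by
  let w : Fin 3 → Fin 3 → MvPolynomial (Fin 3) ℂ := fun i j =>
    angMomentum i j (p * angMomentum i j q - angMomentum i j p * q)
  have hw : ∀ ω : UnitSphere, polyFun (w 0 1 + w 0 2 + w 1 2) ω
      = (n * (n + 1) - m * (m + 1)) * (polyFun p ω * polyFun q ω) := by
    intro ω
    simp only [w, angMomentum_sub, angMomentum_mul, polyFun_add, polyFun_sub, polyFun_mul]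
    linear_combination polyFun p ω * sum_angMomentum_sq hq ω
      - polyFun q ω * sum_angMomentum_sq hp ω
  have h0 : ∫ ω : UnitSphere, polyFun (w 0 1 + w 0 2 + w 1 2) ω ∂sphereMeasure = 0 := by
    simp only [polyFun_add]
    have i1 : Integrable (fun ω : UnitSphere => polyFun (w 0 1) ω + polyFun (w 0 2) ω)
      sphereMeasure := (integrable_polyFun _).add (integrable_polyFun _)
    rw [integral_add i1 (integrable_polyFun _), integral_add (integrable_polyFun _)
      (integrable_polyFun _), integral_angMomentum, integral_angMomentum, integral_angMomentum]
    simp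
  simp only [hw] at h0
  rw [integral_const_mul, mul_eq_zero] at h0
  refine h0.resolve_left fun h => hnm ?_
  have h1 : n * (n + 1) = m * (m + 1) := by exact_mod_cast sub_eq_zero.1 h
  by_contra hne
  rcases lt_or_gt_of_ne hne with h2 | h2 <;> nlinarith

/-- The polynomial with conjugate coefficients. -/
def conjPoly (p : MvPolynomial (Fin 3) ℂ) : MvPolynomial (Fin 3) ℂ :=
  MvPolynomial.map (starRingEnd ℂ) p

theorem polyFun_conjPoly (p : MvPolynomial (Fin 3) ℂ) (y : E3) :
    polyFun (conjPoly p) y = starRingEnd ℂ (polyFun p y) := by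
  induction p using MvPolynomial.induction_on with
  | C a => simp [polyFun, conjPoly]
  | add p q hp hq =>
    simp only [conjPoly, map_add, polyFun_add] at hp hq ⊢
    rw [hp, hq]
  | mul_X p i hp =>
    simp only [conjPoly, map_mul, MvPolynomial.map_X, polyFun_mul, polyFun_X] at hp ⊢
    rw [hp, Complex.conj_ofReal]

theorem conjPoly_mem_harmonicSubmodule {n : ℕ} {p : MvPolynomial (Fin 3) ℂ}
    (hp : p ∈ harmonicSubmodule n) : conjPoly p ∈ harmonicSubmodule n := by
  refine ⟨hp.1.map _, ?_⟩
  simp only [conjPoly, MvPolynomial.pderiv_map]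
  rw [← map_sum, hp.2, map_zero]

theorem inner_angularLp_eq_zero {r : ℝ} (hr : 0 < r) {n m : ℕ} (hnm : n ≠ m)
    {p q : MvPolynomial (Fin 3) ℂ} (hp : p ∈ harmonicSubmodule n)
    (hq : q ∈ harmonicSubmodule m) : inner ℂ (angularLp r p) (angularLp r q) = 0 := by
  rw [inner_angularLp hr]
  simp only [← polyFun_conjPoly]
  rw [integral_mul_eq_zero_of_harmonic hnm.symm hq (conjPoly_mem_harmonicSubmodule hp), mul_zero]

/-- The span of the spherical harmonics in `L²` of the sphere of radius `r`. -/
def sphericalHarmonicsSpan (r : ℝ) : Submodule ℂ (Lp ℂ 2 (surfaceMeasure r)) :=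
  Submodule.span ℂ {f | ∃ n, ∃ h ∈ harmonicSubmodule n, f = angularLp r h}

/-- The factors `|x|^(2 j)` in the harmonic decomposition equal `1` on the unit sphere. -/
theorem angularLp_mem_sphericalHarmonicsSpan {r : ℝ} (hr : 0 < r)
    (p : MvPolynomial (Fin 3) ℂ) : angularLp r p ∈ sphericalHarmonicsSpan r := by
  rw [← angularLpLinear_apply, ← MvPolynomial.sum_homogeneousComponent p, map_sum]
  refine Submodule.sum_mem _ fun n _ => ?_
  have h := mem_harmonicSpan_of_isHomogeneous (MvPolynomial.homogeneousComponent_isHomogeneous n p)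
  have hle : harmonicSpan n ≤ (sphericalHarmonicsSpan r).comap (angularLpLinear r) := by
    refine Submodule.span_le.2 ?_
    rintro _ ⟨j, k, h, -, hh, rfl⟩
    refine Submodule.subset_span ⟨k, h, hh, angularLp_congr hr fun ω => ?_⟩
    have h1 : polyFun (normSqPoly ^ j * h) ω = polyFun normSqPoly ω ^ j * polyFun h ω := by
      simp [polyFun]
    rw [h1, polyFun_normSqPoly, one_pow, one_mul]
  exact hle h

/-- The restriction of polynomials to the unit sphere. -/
def restrictSphere : MvPolynomial (Fin 3) ℂ →ₐ[ℂ] C(UnitSphere, ℂ) :=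
  MvPolynomial.aeval fun i => ⟨fun ω => (((ω : E3) i : ℝ) : ℂ), by fun_prop⟩

theorem restrictSphere_apply (p : MvPolynomial (Fin 3) ℂ) (ω : UnitSphere) :
    restrictSphere p ω = polyFun p ω := by
  induction p using MvPolynomial.induction_on with
  | C a => simp [restrictSphere, polyFun]
  | add p q hp hq => rw [map_add, ContinuousMap.add_apply, hp, hq, polyFun_add]
  | mul_X p i hp =>
    rw [map_mul, ContinuousMap.mul_apply, hp, polyFun_mul, polyFun_X]
    simp [restrictSphere]

/-- Complex Stone–Weierstrass; `conjPoly` gives closure under conjugation, and the coordinates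
separate points. -/
theorem dense_range_restrictSphere : Dense (Set.range restrictSphere) := by
  let A : StarSubalgebra ℂ C(UnitSphere, ℂ) :=
    { restrictSphere.range with
      star_mem' := by
        rintro _ ⟨p, rfl⟩
        refine ⟨conjPoly p, ?_⟩
        ext ω
        change restrictSphere (conjPoly p) ω = star (restrictSphere p ω)
        rw [restrictSphere_apply, restrictSphere_apply, polyFun_conjPoly]
        rfl }
  have hsep : A.SeparatesPoints := by
    intro ω ω' hne
    have h : ∃ i, (ω : E3) i ≠ (ω' : E3) i := by
      by_contra! h
      exact hne (Subtype.ext (PiLp.ext h))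
    obtain ⟨i, hi⟩ := h
    refine ⟨_, ⟨restrictSphere (MvPolynomial.X i), ⟨MvPolynomial.X i, rfl⟩, rfl⟩, ?_⟩
    change restrictSphere (MvPolynomial.X i) ω ≠ restrictSphere (MvPolynomial.X i) ω'
    rw [restrictSphere_apply, restrictSphere_apply, polyFun_X, polyFun_X]
    exact_mod_cast hi
  have h := ContinuousMap.starSubalgebra_topologicalClosure_eq_top_of_separatesPoints A hsep
  intro f
  have hf : f ∈ A.topologicalClosure := h ▸ StarSubalgebra.mem_top
  exact hf

theorem topologicalClosure_sphericalHarmonicsSpan {r : ℝ} (hr : 0 < r) :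
    (sphericalHarmonicsSpan r).topologicalClosure = ⊤ := by
  rw [← Submodule.dense_iff_topologicalClosure_eq_top]
  have hd := BoundedContinuousFunction.toLp_denseRange ℂ (surfaceMeasure r) ℂ
    (p := 2) ENNReal.ofNat_ne_top
  refine Dense.of_closure (hd.mono ?_)
  rintro _ ⟨g, rfl⟩
  rw [Metric.mem_closure_iff]
  intro ε hε
  -- `M` bounds the `L²` norm by the supremum norm; approximating to within `ε / (M + 1)` gives a
  -- strict inequality without knowing `M ≠ 0`.
  set M : ℝ := measureUnivNNReal (surfaceMeasure r) ^ (2 : ENNReal).toReal⁻¹ with hM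
  have hM0 : 0 ≤ M := by positivity
  let G : C(UnitSphere, ℂ) := ⟨fun ω => g (r • (ω : E3)), by fun_prop⟩
  obtain ⟨_, hp, ⟨p, rfl⟩⟩ := Metric.dense_iff.1 dense_range_restrictSphere G (ε / (M + 1))
    (by positivity)
  refine ⟨angularLp r p, angularLp_mem_sphericalHarmonicsSpan hr p, ?_⟩
  rw [dist_eq_norm]
  have hbound : ∀ᵐ x ∂surfaceMeasure r,
      ‖(BoundedContinuousFunction.toLp 2 (surfaceMeasure r) ℂ g - angularLp r p) x‖
        ≤ ε / (M + 1) := by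
    have h1 : ∀ᵐ x ∂surfaceMeasure r, ‖g x - angular p x‖ ≤ ε / (M + 1) := by
      rw [ae_surfaceMeasure_iff hr]
      refine Filter.Eventually.of_forall fun ω => ?_
      rw [angular_smul hr, ← restrictSphere_apply, ← dist_eq_norm]
      have h2 := ContinuousMap.dist_apply_le_dist (f := G) (g := restrictSphere p) ω
      rw [Metric.mem_ball, dist_comm] at hp
      exact h2.trans hp.le
    filter_upwards [h1, Lp.coeFn_sub (BoundedContinuousFunction.toLp 2 (surfaceMeasure r) ℂ g)
      (angularLp r p), coeFn_angularLp r p,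
      BoundedContinuousFunction.coeFn_toLp 2 (surfaceMeasure r) ℂ g] with x h2 h3 h4 h5
    rw [h3, Pi.sub_apply, h4, h5]
    exact h2
  refine (Lp.norm_le_of_ae_bound (by positivity) hbound).trans_lt ?_
  rw [← hM, mul_div_assoc', div_lt_iff₀ (by positivity)]
  nlinarith

theorem eq_zero_of_inner_angularLp_eq_zero {r : ℝ} (hr : 0 < r) {ψ : Lp ℂ 2 (surfaceMeasure r)}
    (h : ∀ n, ∀ p ∈ harmonicSubmodule n, inner ℂ (angularLp r p) ψ = 0) : ψ = 0 := by
  have h1 := (Submodule.topologicalClosure_eq_top_iff).1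
    (topologicalClosure_sphericalHarmonicsSpan hr)
  have h2 : ψ ∈ (sphericalHarmonicsSpan r)ᗮ := by
    rw [sphericalHarmonicsSpan, Submodule.mem_orthogonal]
    intro u hu
    refine Submodule.span_induction (p := fun u _ => inner ℂ u ψ = 0) ?_ (inner_zero_left _) ?_ ?_
      hu
    · rintro _ ⟨n, p, hp, rfl⟩
      exact h n p hp
    · intro u v _ _ hu hv
      rw [inner_add_left, hu, hv, add_zero]
    · intro c u _ hu
      rw [inner_smul_left, hu, mul_zero]
  rwa [h1, Submodule.mem_bot] at h2

/-! ### Harmonic coefficients of kernel operators -/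

/-- `N` is the integral operator with kernel `npKernel` from the sphere of radius `r` to the sphere
of radius `ρ`. -/
def IsKernelOperator (r ρ : ℝ)
    (N : Lp ℂ 2 (surfaceMeasure r) →L[ℂ] Lp ℂ 2 (surfaceMeasure ρ)) : Prop :=
  ∀ φ : Lp ℂ 2 (surfaceMeasure r),
    N φ =ᵐ[surfaceMeasure ρ] fun x => ∫ y, npKernel x y • φ y ∂surfaceMeasure r

theorem IsKernelOperator.apply_angularLp {r ρ : ℝ} (hr : 0 < r) (hρ : 0 < ρ)
    {N : Lp ℂ 2 (surfaceMeasure r) →L[ℂ] Lp ℂ 2 (surfaceMeasure ρ)} (hN : IsKernelOperator r ρ N)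
    {n : ℕ} {p : MvPolynomial (Fin 3) ℂ} (hp : p ∈ harmonicSubmodule n) :
    N (angularLp r p) = (npFactor r ρ n : ℂ) • angularLp ρ p := by
  refine Lp.ext ?_
  filter_upwards [hN (angularLp r p), Lp.coeFn_smul (npFactor r ρ n : ℂ) (angularLp ρ p),
    coeFn_angularLp ρ p, ae_norm_eq hρ] with x h1 h2 h3 h4
  rw [h1, h2, Pi.smul_apply, h3, smul_eq_mul, ← integral_npKernel_harmonic hr hρ hp h4]
  refine integral_congr_ae ?_
  filter_upwards [coeFn_angularLp r p] with y hy
  rw [hy]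

/-- Both sides are continuous functionals of `φ` that agree on spherical harmonics, hence everywhere
by density; no adjoint has to be computed. Dividing by the squared radius normalises the
coefficients. -/
theorem IsKernelOperator.inner_apply {r ρ : ℝ} (hr : 0 < r) (hρ : 0 < ρ)
    {N : Lp ℂ 2 (surfaceMeasure r) →L[ℂ] Lp ℂ 2 (surfaceMeasure ρ)} (hN : IsKernelOperator r ρ N)
    {n : ℕ} {p : MvPolynomial (Fin 3) ℂ} (hp : p ∈ harmonicSubmodule n)
    (φ : Lp ℂ 2 (surfaceMeasure r)) :
    inner ℂ (angularLp ρ p) (N φ) / (ρ : ℂ) ^ 2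
      = npFactor r ρ n * (inner ℂ (angularLp r p) φ / (r : ℂ) ^ 2) := by
  have hrC : (r : ℂ) ≠ 0 := by exact_mod_cast hr.ne'
  have hρC : (ρ : ℂ) ≠ 0 := by exact_mod_cast hρ.ne'
  have key : ((ρ : ℂ) ^ 2)⁻¹ • (innerSL ℂ (angularLp ρ p)).comp N
      = ((npFactor r ρ n : ℂ) * ((r : ℂ) ^ 2)⁻¹) • innerSL ℂ (angularLp r p) := by
    refine ContinuousLinearMap.ext_on
      (s := {f | ∃ n, ∃ h ∈ harmonicSubmodule n, f = angularLp r h}) ?_ ?_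
    · exact (Submodule.dense_iff_topologicalClosure_eq_top).2
        (topologicalClosure_sphericalHarmonicsSpan hr)
    · rintro _ ⟨m, q, hq, rfl⟩
      simp only [smul_apply, ContinuousLinearMap.comp_apply, innerSL_apply_apply,
        hN.apply_angularLp hr hρ hq, inner_smul_right, smul_eq_mul]
      rcases eq_or_ne n m with rfl | hnm
      · rw [inner_angularLp hr, inner_angularLp hρ]
        field_simp
      · rw [inner_angularLp_eq_zero hr hnm hp hq, inner_angularLp_eq_zero hρ hnm hp hq]
        simp
  have h := congrArg (fun f : Lp ℂ 2 (surfaceMeasure r) →L[ℂ] ℂ => f φ) key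
  simp only [smul_apply, ContinuousLinearMap.comp_apply, innerSL_apply_apply, smul_eq_mul] at h
  rw [div_eq_inv_mul, h]
  ring

section Harmonics

variable {n : ℕ} {Y : Set.Icc (-(n : ℤ)) n → MvPolynomial (Fin 3) ℂ}

theorem IsOrthonormalSphericalHarmonics.mem (hY : IsOrthonormalSphericalHarmonics n Y)
    (m : Set.Icc (-(n : ℤ)) n) : Y m ∈ harmonicSubmodule n :=
  ⟨hY.homogeneous m, hY.harmonic m⟩

theorem IsOrthonormalSphericalHarmonics.inner_angularLp_eq
    (hY : IsOrthonormalSphericalHarmonics n Y) {r : ℝ} (hr : 0 < r)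
    (m m' : Set.Icc (-(n : ℤ)) n) :
    inner ℂ (angularLp r (Y m)) (angularLp r (Y m')) = if m = m' then (r : ℂ) ^ 2 else 0 := by
  have h := hY.orthonormal m' m
  rw [integral_surfaceMeasure one_pos] at h
  simp only [angular_smul one_pos, Complex.ofReal_one, one_pow, one_mul] at h
  rw [inner_angularLp hr, h]
  simp [eq_comm]

/-- The index set has `2 n + 1` elements, already the largest possible dimension, and orthonormality
gives independence. -/
theorem IsOrthonormalSphericalHarmonics.span_eq (hY : IsOrthonormalSphericalHarmonics n Y) :
    Submodule.span ℂ (Set.range Y) = harmonicSubmodule n := by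
  let v : Set.Icc (-(n : ℤ)) n → harmonicSubmodule n := fun m => ⟨Y m, hY.mem m⟩
  have hort : Orthonormal ℂ fun m => angularLp 1 (Y m) := by
    classical
    rw [orthonormal_iff_ite]
    intro m m'
    rw [hY.inner_angularLp_eq one_pos]
    simp
  have hli : LinearIndependent ℂ v :=
    LinearIndependent.of_comp ((angularLpLinear 1).comp (harmonicSubmodule n).subtype)
      hort.linearIndependent
  have hcard : Fintype.card (Set.Icc (-(n : ℤ)) n) = 2 * n + 1 := by
    have h := Int.card_fintype_Icc_of_le (a := -(n : ℤ)) (b := n) (by omega)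
    omega
  have hfin : Fintype.card (Set.Icc (-(n : ℤ)) n) = Module.finrank ℂ (harmonicSubmodule n) :=
    le_antisymm hli.fintype_card_le_finrank (hcard ▸ finrank_harmonicSubmodule_le n)
  have htop := hli.span_eq_top_of_card_eq_finrank' hfin
  have h := congrArg (Submodule.map (harmonicSubmodule n).subtype) htop
  rw [Submodule.map_span, Submodule.map_top, Submodule.range_subtype, ← Set.range_comp] at h
  exact h

/-- The difference of the two sides is orthogonal to harmonics of every degree, so completeness
applies. -/
theorem IsOrthonormalSphericalHarmonics.eq_sum (hY : IsOrthonormalSphericalHarmonics n Y)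
    {r : ℝ} (hr : 0 < r) {ψ : Lp ℂ 2 (surfaceMeasure r)}
    (hψ : ∀ k, k ≠ n → ∀ p ∈ harmonicSubmodule k, inner ℂ (angularLp r p) ψ = 0) :
    ψ = ∑ m, (inner ℂ (angularLp r (Y m)) ψ / (r : ℂ) ^ 2) • angularLp r (Y m) := by
  have hrC : (r : ℂ) ≠ 0 := by exact_mod_cast hr.ne'
  rw [← sub_eq_zero]
  refine eq_zero_of_inner_angularLp_eq_zero hr fun k p hp => ?_
  rcases eq_or_ne k n with rfl | hk
  · rw [← hY.span_eq] at hp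
    refine Submodule.span_induction (p := fun p _ => inner ℂ (angularLp r p)
      (ψ - ∑ m, (inner ℂ (angularLp r (Y m)) ψ / (r : ℂ) ^ 2) • angularLp r (Y m)) = 0)
      ?_ ?_ ?_ ?_ hp
    · rintro _ ⟨m, rfl⟩
      simp only [inner_sub_right, inner_sum, inner_smul_right, hY.inner_angularLp_eq hr,
        mul_ite, mul_zero, Finset.sum_ite_eq, Finset.mem_univ, if_true]
      field_simp
      simp
    · rw [← angularLpLinear_apply, map_zero, inner_zero_left]
    · intro p q _ _ h1 h2
      rw [← angularLpLinear_apply, map_add, inner_add_left, angularLpLinear_apply,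
        angularLpLinear_apply, h1, h2, add_zero]
    · intro c p _ h1
      rw [← angularLpLinear_apply, map_smul, inner_smul_left, angularLpLinear_apply, h1, mul_zero]
  · rw [inner_sub_right, hψ k hk p hp, inner_sum, zero_sub, neg_eq_zero]
    refine Finset.sum_eq_zero fun m _ => ?_
    rw [inner_smul_right, inner_angularLp_eq_zero hr hk hp (hY.mem m), mul_zero]

end Harmonics

/-! ### Algebra of the 2×2 blocks -/

theorem npRoot_sq {ρ : ℝ} (hρ : 0 < ρ) (n : ℕ) :
    npRoot ρ n ^ 2 = 1 + 4 * n * (n + 1) * ρ ^ (2 * n + 1) :=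
  Real.sq_sqrt (by positivity)

theorem npEigenvalue_sq {ρ : ℝ} (hρ : 0 < ρ) (n : ℕ) :
    npEigenvalue ρ n ^ 2
      = (1 / (2 * (2 * n + 1))) ^ 2 * (1 + 4 * n * (n + 1) * ρ ^ (2 * n + 1)) := by
  rw [npEigenvalue, mul_pow, npRoot_sq hρ]

/-- With `w = (2 n + 1)⁻²` and `v = ρ ^ (2 n + 1)`, four times the square is `w + (1 - w) v`. It
increases with `w` and `v`, strictly with `w` as `v < 1`, and both decrease with `n`. Hence
different degrees never share an eigenvalue. -/
theorem strictAnti_npEigenvalue_sq {ρ : ℝ} (hρ : 0 < ρ) (hρ1 : ρ < 1) :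
    StrictAnti fun n => npEigenvalue ρ n ^ 2 := by
  have hform : ∀ n : ℕ, npEigenvalue ρ n ^ 2
      = 1 / 4 * (1 / (2 * n + 1 : ℝ) ^ 2 + (1 - 1 / (2 * n + 1 : ℝ) ^ 2) * ρ ^ (2 * n + 1)) := by
    intro n
    rw [npEigenvalue_sq hρ]
    field_simp
    ring
  intro n m hnm
  simp only [hform]
  have hw : 1 / (2 * m + 1 : ℝ) ^ 2 < 1 / (2 * n + 1 : ℝ) ^ 2 := by
    gcongr
  have hw1 : 1 / (2 * n + 1 : ℝ) ^ 2 ≤ 1 := by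
    rw [div_le_one (by positivity)]
    nlinarith [(Nat.cast_nonneg n : (0 : ℝ) ≤ n)]
  have hv : ρ ^ (2 * m + 1) ≤ ρ ^ (2 * n + 1) :=
    pow_le_pow_of_le_one hρ.le hρ1.le (by omega)
  have hv1 : ρ ^ (2 * m + 1) < 1 := pow_lt_one₀ hρ.le hρ1 (by omega)
  generalize 1 / (2 * m + 1 : ℝ) ^ 2 = w' at *
  generalize 1 / (2 * n + 1 : ℝ) ^ 2 = w at *
  nlinarith [mul_nonneg (sub_nonneg.2 hw1) (sub_nonneg.2 hv), mul_pos (sub_pos.2 hw)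
    (sub_pos.2 hv1)]

theorem npFactor_self (r : ℝ) (n : ℕ) : npFactor r r n = 1 / (2 * (2 * n + 1)) := if_pos rfl

theorem npFactor_of_lt {r ρ : ℝ} (h : ρ < r) (n : ℕ) :
    npFactor r ρ n = -(n / (2 * n + 1) * ((ρ / r) ^ n * (r / ρ))) := by
  rw [npFactor, if_neg h.ne, if_pos h]

theorem npFactor_of_gt {r ρ : ℝ} (h : r < ρ) (n : ℕ) :
    npFactor r ρ n = (n + 1) / (2 * n + 1) * (r / ρ) ^ (n + 2) := by
  rw [npFactor, if_neg h.ne', if_neg h.not_gt]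

/-- The determinant of the trace-free degree-`n` block, in the form `b c = a² - λₙ²`. -/
theorem npFactor_mul_npFactor {ri re : ℝ} (hri : 0 < ri) (hre : ri < re) (n : ℕ) :
    npFactor re ri n * npFactor ri re n
      = (1 / (2 * (2 * n + 1))) ^ 2 - npEigenvalue (ri / re) n ^ 2 := by
  have hre0 : 0 < re := hri.trans hre
  rw [npEigenvalue_sq (by positivity), npFactor_of_lt hre, npFactor_of_gt hre]
  have h : re / ri = (ri / re)⁻¹ := (inv_div _ _).symm
  have hx : ri / re ≠ 0 := by positivity
  rw [h]
  generalize ri / re = x at *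
  field_simp
  ring

theorem npFactor_pos {ri re : ℝ} (hri : 0 < ri) (hre : ri < re) (n : ℕ) :
    0 < npFactor ri re n := by
  rw [npFactor_of_gt hre]
  have hre0 : 0 < re := hri.trans hre
  positivity

/-- It identifies the coefficients of `npPair` as `2 (2 n + 1)` times the block eigenvector `(λ - a,
c)`. -/
theorem two_mul_pow_eq {ri re : ℝ} (hre : ri < re) (n : ℕ) :
    2 * (n + 1) * (ri / re) ^ (n + 2) = 2 * (2 * n + 1) * npFactor ri re n := by
  rw [npFactor_of_gt hre]
  field_simp

/-! ### Eigenvalues and eigenspaces of the two-sphere operator -/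

section TwoSpheres

variable {ri re : ℝ}
  {Nii : Lp ℂ 2 (surfaceMeasure ri) →L[ℂ] Lp ℂ 2 (surfaceMeasure ri)}
  {Nie : Lp ℂ 2 (surfaceMeasure ri) →L[ℂ] Lp ℂ 2 (surfaceMeasure re)}
  {Nei : Lp ℂ 2 (surfaceMeasure re) →L[ℂ] Lp ℂ 2 (surfaceMeasure ri)}
  {Nee : Lp ℂ 2 (surfaceMeasure re) →L[ℂ] Lp ℂ 2 (surfaceMeasure re)}

/-- The block operator built from the kernel operators between the two spheres. -/
def npBlock (Nii : Lp ℂ 2 (surfaceMeasure ri) →L[ℂ] Lp ℂ 2 (surfaceMeasure ri))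
    (Nie : Lp ℂ 2 (surfaceMeasure ri) →L[ℂ] Lp ℂ 2 (surfaceMeasure re))
    (Nei : Lp ℂ 2 (surfaceMeasure re) →L[ℂ] Lp ℂ 2 (surfaceMeasure ri))
    (Nee : Lp ℂ 2 (surfaceMeasure re) →L[ℂ] Lp ℂ 2 (surfaceMeasure re)) :
    DensitySpace ri re →L[ℂ] DensitySpace ri re :=
  let P : DensitySpace ri re →L[ℂ] Lp ℂ 2 (surfaceMeasure ri) := ContinuousLinearMap.fst ℂ _ _
  let Q : DensitySpace ri re →L[ℂ] Lp ℂ 2 (surfaceMeasure re) := ContinuousLinearMap.snd ℂ _ _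
  (-(Nii.comp P) - Nei.comp Q).prod (Nie.comp P + Nee.comp Q)

theorem npBlock_apply (φ : DensitySpace ri re) :
    npBlock Nii Nie Nei Nee φ = (-Nii φ.1 - Nei φ.2, Nie φ.1 + Nee φ.2) := rfl

theorem isNPOperator_npBlock (hri : 0 < ri) (hre : ri < re)
    (hii : IsKernelOperator ri ri Nii) (hie : IsKernelOperator ri re Nie)
    (hei : IsKernelOperator re ri Nei) (hee : IsKernelOperator re re Nee) :
    IsNPOperator ri re (npBlock Nii Nie Nei Nee) := by
  have hre0 : 0 < re := hri.trans hre
  intro φ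
  have i1 : Integrable φ.1 (surfaceMeasure ri) := (Lp.memLp φ.1).integrable one_le_two
  have i2 : Integrable φ.2 (surfaceMeasure re) := (Lp.memLp φ.2).integrable one_le_two
  rw [npBlock_apply]
  constructor
  · filter_upwards [Lp.coeFn_sub (-Nii φ.1) (Nei φ.2), Lp.coeFn_neg (Nii φ.1), hii φ.1, hei φ.2,
      ae_norm_eq hri] with x h1 h2 h3 h4 h5
    rw [h1, Pi.sub_apply, h2, Pi.neg_apply, h3, h4, neumannPoincareStar_eq,
      normalDeriv_singleLayer hre0 i2 (h5.trans_ne hre.ne)]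
  · filter_upwards [Lp.coeFn_add (Nie φ.1) (Nee φ.2), hie φ.1, hee φ.2,
      ae_norm_eq hre0] with x h1 h2 h3 h4
    rw [h1, Pi.add_apply, h2, h3, neumannPoincareStar_eq,
      normalDeriv_singleLayer hri i1 (h4.trans_ne hre.ne')]

/-- Only the square of `s` enters, so both signs of the root are treated together. -/
theorem npBlock_npPair (hri : 0 < ri) (hre : ri < re)
    (hii : IsKernelOperator ri ri Nii) (hie : IsKernelOperator ri re Nie)
    (hei : IsKernelOperator re ri Nei) (hee : IsKernelOperator re re Nee) {n : ℕ} {s : ℝ}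
    (hs : s ^ 2 = npRoot (ri / re) n ^ 2) {p : MvPolynomial (Fin 3) ℂ}
    (hp : p ∈ harmonicSubmodule n) :
    npBlock Nii Nie Nei Nee (npPair ri re n s p)
      = ((1 / (2 * (2 * n + 1)) * s : ℝ) : ℂ) • npPair ri re n s p := by
  have hre0 : 0 < re := hri.trans hre
  have hn : (2 * n + 1 : ℝ) ≠ 0 := by positivity
  have hprod := npFactor_mul_npFactor hri hre n
  rw [npEigenvalue, mul_pow, ← hs] at hprod
  have e1 : -(1 / (2 * (2 * n + 1)) * (s - 1)) - npFactor re ri n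
      * (2 * (2 * n + 1) * npFactor ri re n) = 1 / (2 * (2 * n + 1)) * s * (s - 1) := by
    rw [show npFactor re ri n * (2 * (2 * n + 1) * npFactor ri re n)
      = 2 * (2 * n + 1) * (npFactor re ri n * npFactor ri re n) by ring, hprod]
    field_simp
    ring
  have e2 : npFactor ri re n * (s - 1) + 1 / (2 * (2 * n + 1))
      * (2 * (2 * n + 1) * npFactor ri re n)
      = 1 / (2 * (2 * n + 1)) * s * (2 * (2 * n + 1) * npFactor ri re n) := by
    field_simp
    ring
  rw [npBlock_apply, npPair, two_mul_pow_eq hre]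
  simp only [map_smul, hii.apply_angularLp hri hri hp, hie.apply_angularLp hri hre0 hp,
    hei.apply_angularLp hre0 hri hp, hee.apply_angularLp hre0 hre0 hp, npFactor_self, smul_smul,
    Prod.smul_mk, ← neg_smul, ← sub_smul, ← add_smul]
  refine Prod.ext ?_ ?_
  · simp only
    congr 1
    have h := congrArg (fun u : ℝ => (u : ℂ)) e1
    push_cast at h ⊢
    linear_combination h
  · simp only
    congr 1
    have h := congrArg (fun u : ℝ => (u : ℂ)) e2
    push_cast at h ⊢
    linear_combination h

/-- The second component decides; the first vanishes when `s = 1`, which occurs for `n = 0`. -/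
theorem npPair_ne_zero (hri : 0 < ri) (hre : ri < re) {n : ℕ} (s : ℝ)
    {p : MvPolynomial (Fin 3) ℂ} (hp : angularLp re p ≠ 0) : npPair ri re n s p ≠ 0 := by
  intro h
  have h1 := congrArg Prod.snd h
  rw [npPair, two_mul_pow_eq hre] at h1
  have h2 : ((2 * (2 * n + 1) * npFactor ri re n : ℝ) : ℂ) ≠ 0 := by
    have := npFactor_pos hri hre n
    exact_mod_cast (by positivity : 2 * (2 * n + 1) * npFactor ri re n ≠ 0)
  exact (smul_ne_zero h2 hp) h1

/-- The coefficients of an eigenvector satisfy a two-dimensional eigenvalue equation. -/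
theorem coeff_of_npBlock_eq_smul (hri : 0 < ri) (hre : ri < re)
    (hii : IsKernelOperator ri ri Nii) (hie : IsKernelOperator ri re Nie)
    (hei : IsKernelOperator re ri Nei) (hee : IsKernelOperator re re Nee) {z : ℂ}
    {φ : DensitySpace ri re} (hφ : npBlock Nii Nie Nei Nee φ = z • φ) {n : ℕ}
    {p : MvPolynomial (Fin 3) ℂ} (hp : p ∈ harmonicSubmodule n) :
    -((1 / (2 * (2 * n + 1)) : ℝ) * (inner ℂ (angularLp ri p) φ.1 / (ri : ℂ) ^ 2))
        - npFactor re ri n * (inner ℂ (angularLp re p) φ.2 / (re : ℂ) ^ 2)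
      = z * (inner ℂ (angularLp ri p) φ.1 / (ri : ℂ) ^ 2) ∧
    npFactor ri re n * (inner ℂ (angularLp ri p) φ.1 / (ri : ℂ) ^ 2)
        + (1 / (2 * (2 * n + 1)) : ℝ) * (inner ℂ (angularLp re p) φ.2 / (re : ℂ) ^ 2)
      = z * (inner ℂ (angularLp re p) φ.2 / (re : ℂ) ^ 2) := by
  have hre0 : 0 < re := hri.trans hre
  rw [npBlock_apply] at hφ
  have h1 := congrArg (fun ψ : DensitySpace ri re => inner ℂ (angularLp ri p) ψ.1 / (ri : ℂ) ^ 2) hφ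
  have h2 := congrArg (fun ψ : DensitySpace ri re => inner ℂ (angularLp re p) ψ.2 / (re : ℂ) ^ 2) hφ
  simp only [inner_sub_right, inner_neg_right, inner_add_right, Prod.smul_fst, Prod.smul_snd,
    inner_smul_right, sub_div, neg_div, add_div, mul_div_assoc, hii.inner_apply hri hri hp,
    hie.inner_apply hri hre0 hp, hei.inner_apply hre0 hri hp, hee.inner_apply hre0 hre0 hp,
    npFactor_self] at h1 h2
  exact ⟨h1, h2⟩

/-- The block minus `z` has determinant `z² - λₙ²`; the linear combinations are Cramer's rule. -/
theorem coeff_eq_zero_of_npBlock_eq_smul (hri : 0 < ri) (hre : ri < re)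
    (hii : IsKernelOperator ri ri Nii) (hie : IsKernelOperator ri re Nie)
    (hei : IsKernelOperator re ri Nei) (hee : IsKernelOperator re re Nee) {z : ℂ}
    {φ : DensitySpace ri re} (hφ : npBlock Nii Nie Nei Nee φ = z • φ) {n : ℕ}
    (hz : z ^ 2 ≠ (npEigenvalue (ri / re) n : ℂ) ^ 2)
    {p : MvPolynomial (Fin 3) ℂ} (hp : p ∈ harmonicSubmodule n) :
    inner ℂ (angularLp ri p) φ.1 = 0 ∧ inner ℂ (angularLp re p) φ.2 = 0 := by
  have hre0 : 0 < re := hri.trans hre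
  have hriC : (ri : ℂ) ^ 2 ≠ 0 := pow_ne_zero 2 (by exact_mod_cast hri.ne')
  have hreC : (re : ℂ) ^ 2 ≠ 0 := pow_ne_zero 2 (by exact_mod_cast hre0.ne')
  obtain ⟨h1, h2⟩ := coeff_of_npBlock_eq_smul hri hre hii hie hei hee hφ hp
  have hprod : (npFactor re ri n : ℂ) * npFactor ri re n
      = ((1 / (2 * (2 * n + 1)) : ℝ) : ℂ) ^ 2 - (npEigenvalue (ri / re) n : ℂ) ^ 2 := by
    exact_mod_cast npFactor_mul_npFactor hri hre n
  have hd := sub_ne_zero.2 hz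
  have ha : inner ℂ (angularLp ri p) φ.1 / (ri : ℂ) ^ 2 = 0 := by
    refine (mul_eq_zero.1 ?_).resolve_left hd
    generalize inner ℂ (angularLp ri p) φ.1 / (ri : ℂ) ^ 2 = a at *
    generalize inner ℂ (angularLp re p) φ.2 / (re : ℂ) ^ 2 = b at *
    linear_combination (((1 / (2 * (2 * n + 1)) : ℝ) : ℂ) - z) * h1 + npFactor re ri n * h2
      - a * hprod
  have hb : inner ℂ (angularLp re p) φ.2 / (re : ℂ) ^ 2 = 0 := by
    refine (mul_eq_zero.1 ?_).resolve_left hd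
    generalize inner ℂ (angularLp ri p) φ.1 / (ri : ℂ) ^ 2 = a at *
    generalize inner ℂ (angularLp re p) φ.2 / (re : ℂ) ^ 2 = b at *
    linear_combination (-npFactor ri re n : ℂ) * h1
      - (((1 / (2 * (2 * n + 1)) : ℝ) : ℂ) + z) * h2 - b * hprod
  exact ⟨(div_eq_zero_iff.1 ha).resolve_right hriC, (div_eq_zero_iff.1 hb).resolve_right hreC⟩

/-- Coefficients of degrees other than `n` vanish because the `λₖ²` are distinct. In degree `n` the
second row, whose off-diagonal entry is nonzero, recovers the inner coefficient from the outer one.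
-/
theorem eigenspace_npBlock (hri : 0 < ri) (hre : ri < re)
    (hii : IsKernelOperator ri ri Nii) (hie : IsKernelOperator ri re Nie)
    (hei : IsKernelOperator re ri Nei) (hee : IsKernelOperator re re Nee) {n : ℕ} {s : ℝ}
    (hs : s ^ 2 = npRoot (ri / re) n ^ 2)
    {Y : Set.Icc (-(n : ℤ)) n → MvPolynomial (Fin 3) ℂ}
    (hY : IsOrthonormalSphericalHarmonics n Y) :
    eigenspace (npBlock Nii Nie Nei Nee : Module.End ℂ (DensitySpace ri re))
        ((1 / (2 * (2 * n + 1)) * s : ℝ) : ℂ)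
      = Submodule.span ℂ (Set.range fun m => npPair ri re n s (Y m)) := by
  have hre0 : 0 < re := hri.trans hre
  have hρ : 0 < ri / re := by positivity
  have hρ1 : ri / re < 1 := (div_lt_one hre0).2 hre
  refine le_antisymm (fun φ hφ => ?_) (Submodule.span_le.2 ?_)
  · have hφ' : npBlock Nii Nie Nei Nee φ = ((1 / (2 * (2 * n + 1)) * s : ℝ) : ℂ) • φ :=
      mem_eigenspace_iff.1 hφ
    have hzero : ∀ k, k ≠ n → ∀ p ∈ harmonicSubmodule k,
        inner ℂ (angularLp ri p) φ.1 = 0 ∧ inner ℂ (angularLp re p) φ.2 = 0 := by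
      intro k hk p hp
      refine coeff_eq_zero_of_npBlock_eq_smul hri hre hii hie hei hee hφ' ?_ hp
      intro h
      have h1 : (1 / (2 * (2 * n + 1)) * s) ^ 2 = npEigenvalue (ri / re) k ^ 2 := by
        exact_mod_cast h
      rw [mul_pow, hs, ← mul_pow] at h1
      exact hk ((strictAnti_npEigenvalue_sq hρ hρ1).injective h1.symm)
    have hg := npFactor_pos hri hre n
    have hgC : (npFactor ri re n : ℂ) ≠ 0 := by exact_mod_cast hg.ne'
    have hn : (2 * n + 1 : ℂ) ≠ 0 := by exact_mod_cast (2 * n).succ_ne_zero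
    have hsum : φ = ∑ m, ((inner ℂ (angularLp re (Y m)) φ.2 / (re : ℂ) ^ 2)
        / ((2 * (2 * n + 1) * npFactor ri re n : ℝ) : ℂ)) • npPair ri re n s (Y m) := by
      refine Prod.ext ?_ ?_
      · conv_lhs => rw [hY.eq_sum hri fun k hk p hp => (hzero k hk p hp).1]
        rw [Prod.fst_sum]
        refine Finset.sum_congr rfl fun m _ => ?_
        rw [Prod.smul_fst, npPair, smul_smul]
        congr 1
        have h2 := (coeff_of_npBlock_eq_smul hri hre hii hie hei hee hφ' (hY.mem m)).2
        generalize inner ℂ (angularLp ri (Y m)) φ.1 / (ri : ℂ) ^ 2 = a at *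
        generalize inner ℂ (angularLp re (Y m)) φ.2 / (re : ℂ) ^ 2 = b at *
        push_cast at h2 ⊢
        field_simp at h2 ⊢
        linear_combination h2
      · conv_lhs => rw [hY.eq_sum hre0 fun k hk p hp => (hzero k hk p hp).2]
        rw [Prod.snd_sum]
        refine Finset.sum_congr rfl fun m _ => ?_
        rw [Prod.smul_snd, npPair, two_mul_pow_eq hre, smul_smul]
        congr 1
        push_cast
        field_simp
    rw [hsum]
    exact Submodule.sum_mem _ fun m _ => Submodule.smul_mem _ _ (Submodule.subset_span ⟨m, rfl⟩)
  · rintro _ ⟨m, rfl⟩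
    exact mem_eigenspace_iff.2 (npBlock_npPair hri hre hii hie hei hee hs (hY.mem m))

/-- For any other `z` all harmonic coefficients of an eigenvector vanish, hence the vector itself by
completeness. -/
theorem hasEigenvalue_npBlock_iff (hri : 0 < ri) (hre : ri < re)
    (hii : IsKernelOperator ri ri Nii) (hie : IsKernelOperator ri re Nie)
    (hei : IsKernelOperator re ri Nei) (hee : IsKernelOperator re re Nee) (z : ℂ) :
    HasEigenvalue (npBlock Nii Nie Nei Nee : Module.End ℂ (DensitySpace ri re)) z ↔
      ∃ n : ℕ, z = (npEigenvalue (ri / re) n : ℂ) ∨ z = -(npEigenvalue (ri / re) n : ℂ) := by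
  have hre0 : 0 < re := hri.trans hre
  constructor
  · intro h
    obtain ⟨φ, hφ, hφ0⟩ := h.exists_hasEigenvector
    by_contra! hne
    refine hφ0 ?_
    have hzero := fun n p (hp : p ∈ harmonicSubmodule n) =>
      coeff_eq_zero_of_npBlock_eq_smul hri hre hii hie hei hee (mem_eigenspace_iff.1 hφ)
        (fun hz => (sq_eq_sq_iff_eq_or_eq_neg.1 hz).elim (hne n).1 (hne n).2) hp
    exact Prod.ext (eq_zero_of_inner_angularLp_eq_zero hri fun n p hp => (hzero n p hp).1)
      (eq_zero_of_inner_angularLp_eq_zero hre0 fun n p hp => (hzero n p hp).2)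
  · rintro ⟨n, hz⟩
    obtain ⟨p, hp, ξ, hξ⟩ := exists_harmonic_ne_zero n
    have hp0 : angularLp re p ≠ 0 := fun h =>
      hξ (polyFun_eq_zero_of_angularLp_eq_zero hre0 h ξ)
    have key : ∀ s : ℝ, s ^ 2 = npRoot (ri / re) n ^ 2 →
        HasEigenvalue (npBlock Nii Nie Nei Nee : Module.End ℂ (DensitySpace ri re))
          ((1 / (2 * (2 * n + 1)) * s : ℝ) : ℂ) := fun s hs =>
      hasEigenvalue_of_hasEigenvector (x := npPair ri re n s p)
        ⟨mem_eigenspace_iff.2 (npBlock_npPair hri hre hii hie hei hee hs hp),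
          npPair_ne_zero hri hre s hp0⟩
    rcases hz with rfl | rfl
    · exact key _ rfl
    · have h := key (-npRoot (ri / re) n) (neg_sq _)
      rwa [mul_neg, Complex.ofReal_neg] at h

end TwoSpheres

end

theorem proposition3p2 (ri re : ℝ) (hri : 0 < ri) (hre : ri < re) :
    (∀ (r₀ : ℝ), 0 < r₀ →
      ∀ (n : ℕ) (Y : Set.Icc (-(n : ℤ)) n → MvPolynomial (Fin 3) ℂ),
        IsOrthonormalSphericalHarmonics n Y → ∀ m, ∀ x : E3, ‖x‖ = r₀ →
          neumannPoincareStar r₀ (angular (Y m)) x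
            = 1 / (2 * (2 * (n : ℂ) + 1)) * angular (Y m) x) ∧
    ∃ T : DensitySpace ri re →L[ℂ] DensitySpace ri re, IsNPOperator ri re T ∧
      (∀ z : ℂ, HasEigenvalue (T : Module.End ℂ (DensitySpace ri re)) z ↔
        ∃ n : ℕ, z = (npEigenvalue (ri / re) n : ℂ) ∨ z = -(npEigenvalue (ri / re) n : ℂ)) ∧
      ∀ (n : ℕ) (Y : Set.Icc (-(n : ℤ)) n → MvPolynomial (Fin 3) ℂ),
        IsOrthonormalSphericalHarmonics n Y →
          (∀ m, HasEigenvector (T : Module.End ℂ (DensitySpace ri re)) (npEigenvalue (ri / re) n : ℂ)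
            (npPair ri re n (npRoot (ri / re) n) (Y m))) ∧
          (∀ m, HasEigenvector (T : Module.End ℂ (DensitySpace ri re)) (-(npEigenvalue (ri / re) n : ℂ))
            (npPair ri re n (-npRoot (ri / re) n) (Y m))) ∧
          eigenspace (T : Module.End ℂ (DensitySpace ri re)) (npEigenvalue (ri / re) n : ℂ)
            = Submodule.span ℂ (Set.range fun m =>
                npPair ri re n (npRoot (ri / re) n) (Y m)) ∧
          eigenspace (T : Module.End ℂ (DensitySpace ri re)) (-(npEigenvalue (ri / re) n : ℂ))
            = Submodule.span ℂ (Set.range fun m =>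
                npPair ri re n (-npRoot (ri / re) n) (Y m)) := by
  have hre0 : 0 < re := hri.trans hre
  refine ⟨fun r₀ hr₀ n Y hY m x hx => ?_, ?_⟩
  · rw [neumannPoincareStar_eq, integral_npKernel_harmonic hr₀ hr₀ (hY.mem m) hx, npFactor_self]
    push_cast
    rfl
  obtain ⟨Nii, hii⟩ := exists_npKernel_operator hri hri
  obtain ⟨Nie, hie⟩ := exists_npKernel_operator hri hre0
  obtain ⟨Nei, hei⟩ := exists_npKernel_operator hre0 hri
  obtain ⟨Nee, hee⟩ := exists_npKernel_operator hre0 hre0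
  refine ⟨npBlock Nii Nie Nei Nee, isNPOperator_npBlock hri hre hii hie hei hee,
    hasEigenvalue_npBlock_iff hri hre hii hie hei hee, fun n Y hY => ?_⟩
  have hneg : -(npEigenvalue (ri / re) n : ℂ)
      = ((1 / (2 * (2 * n + 1)) * -npRoot (ri / re) n : ℝ) : ℂ) := by
    rw [mul_neg, Complex.ofReal_neg]
    rfl
  have hY0 : ∀ m, angularLp re (Y m) ≠ 0 := fun m h => by
    have h1 := hY.inner_angularLp_eq hre0 m m
    rw [h, inner_zero_left, if_pos rfl] at h1
    exact pow_ne_zero 2 (by exact_mod_cast hre0.ne') h1.symm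
  have hpos := eigenspace_npBlock hri hre hii hie hei hee rfl hY
  have hneg' := eigenspace_npBlock hri hre hii hie hei hee (neg_sq (npRoot (ri / re) n)) hY
  rw [← hneg] at hneg'
  exact ⟨fun m => ⟨hpos.ge (Submodule.subset_span ⟨m, rfl⟩), npPair_ne_zero hri hre _ (hY0 m)⟩,
    fun m => ⟨hneg'.ge (Submodule.subset_span ⟨m, rfl⟩), npPair_ne_zero hri hre _ (hY0 m)⟩,
    hpos, hneg'⟩
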